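/- \textbf{Theorem.} For a graph $G=(V,E)$ let $N_G[v]=\{v\}\cup\{u: uv\in E\}$ and, for an edge $e=xy$, let $N_G[e]=N_G[x]\cup N_G[y]$. A set $L\subseteq V$ is a \emph{liar's vertex-edge dominating set} of $G$ if $|N_G[e]\cap L|\ge 2$ for every $e\in E$ and $|(N_G[e]\cup N_G[e'])\cap L|\ge 3$ for every two distinct edges $e,e'\in E$. A liar's vertex-edge dominating set of minimum cardinality of a given tree can be computed in linear time. Precisely: there are a fixed deterministic random access machine program $P$ and constants $C,k\in\mathbb N$ such that, for every tree $T$ on the vertex set $\{0,\dots,n-1\}$ and every enumeration of its edges as a list of pairs of vertices (each edge once, in any order and orientation), $P$, started with $n$, the number of edges and the edge list in its memory, halts after at most $C\,n$ steps and leaves in its memory the characteristic vector of a liar's vertex-edge dominating set of $T$ of minimum cardinality. Here every instruction (assignment of a constant, copying, addition, truncated subtraction, indirect read, indirect write, and comparison of two registers) costs one step, and all numbers written during the computation are at most $(n+1)^k$, that is, they are words of $O(\log n)$ bits. -/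

import Mathlib

/-! ### Liar's vertex-edge dominating sets -/

namespace SimpleGraph

variable {V : Type*}

/-- The closed neighbourhood `N_G[v]` of a vertex. -/
def closedNbhd (G : SimpleGraph V) (v : V) : Set V :=
  insert v (G.neighborSet v)

/-- The closed neighbourhood `N_G[xy] = N_G[x] ∪ N_G[y]` of an edge `xy`. -/
def edgeClosedNbhd (G : SimpleGraph V) (e : Sym2 V) : Set V :=
  {w | ∃ x ∈ e, w ∈ G.closedNbhd x}

/-- `L` is a liar's vertex-edge dominating set of `G`. -/
def IsLiarsVEDominating (G : SimpleGraph V) (L : Finset V) : Prop :=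
  (∀ e ∈ G.edgeSet, 2 ≤ (G.edgeClosedNbhd e ∩ (L : Set V)).ncard) ∧
  (∀ e ∈ G.edgeSet, ∀ e' ∈ G.edgeSet, e ≠ e' →
    3 ≤ ((G.edgeClosedNbhd e ∪ G.edgeClosedNbhd e') ∩ (L : Set V)).ncard)

/-- `L` is a liar's vertex-edge dominating set of `G` of minimum cardinality. -/
def IsMinLiarsVEDominating (G : SimpleGraph V) (L : Finset V) : Prop :=
  G.IsLiarsVEDominating L ∧ ∀ L' : Finset V, G.IsLiarsVEDominating L' → L.card ≤ L'.card

end SimpleGraph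

/-! ### A random access machine with unit-cost instructions on bounded words

A fixed program works on registers and on a random access memory, all of whose cells hold natural
numbers. Every instruction and every test costs one step. The only arithmetic is addition and
truncated subtraction, and a computation that would write a number exceeding the bound `W` gets
stuck, so that a completed run never handles a word larger than `W` (or than the input words). -/

namespace WordRAM

/-- The contents of the registers and of the memory cells. -/
structure State where
  reg : ℕ → ℕ
  mem : ℕ → ℕ

/-- Instructions; the arguments `d`, `a`, `b` are register names. -/
inductive Op where
  /-- `d := k` -/
  | const (d k : ℕ)
  /-- `d := a` -/
  | copy (d a : ℕ)
  /-- `d := a + b` -/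
  | add (d a b : ℕ)
  /-- `d := a - b` (truncated at zero) -/
  | sub (d a b : ℕ)
  /-- `d := mem[a]` -/
  | load (d a : ℕ)
  /-- `mem[a] := b` -/
  | store (a b : ℕ)

/-- The number that an instruction writes. -/
def Op.result (s : State) : Op → ℕ
  | .const _ k => k
  | .copy _ a => s.reg a
  | .add _ a b => s.reg a + s.reg b
  | .sub _ a b => s.reg a - s.reg b
  | .load _ a => s.mem (s.reg a)
  | .store _ b => s.reg b

/-- The state after the execution of an instruction. -/
def Op.exec (s : State) (o : Op) : State :=
  match o with
  | .const d _ | .copy d _ | .add d _ _ | .sub d _ _ | .load d _ =>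
      { s with reg := Function.update s.reg d (o.result s) }
  | .store a _ => { s with mem := Function.update s.mem (s.reg a) (o.result s) }

/-- Tests: comparison of the contents of two registers. -/
inductive Test where
  | lt (a b : ℕ)
  | eq (a b : ℕ)

/-- The truth of a test in a state. -/
def Test.Holds (s : State) : Test → Prop
  | .lt a b => s.reg a < s.reg b
  | .eq a b => s.reg a = s.reg b

/-- Programs. -/
inductive Program where
  | skip
  | op (o : Op)
  | seq (p q : Program)
  | ite (b : Test) (p q : Program)
  | loop (b : Test) (p : Program)

/-- `Run W p s t s'`: started in state `s`, the program `p` halts after exactly `t` steps in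
state `s'`, and every number written on the way is at most `W`. Programs are deterministic, so
for given `W`, `p`, `s` there is at most one such pair `t`, `s'`. -/
inductive Run (W : ℕ) : Program → State → ℕ → State → Prop where
  | skip (s : State) : Run W .skip s 1 s
  | op (o : Op) (s : State) (h : o.result s ≤ W) : Run W (.op o) s 1 (o.exec s)
  | seq {p q : Program} {s s' s'' : State} {t t' : ℕ} (hp : Run W p s t s')
      (hq : Run W q s' t' s'') : Run W (.seq p q) s (t + t') s''
  | iteTrue {b : Test} {p q : Program} {s s' : State} {t : ℕ} (hb : b.Holds s)
      (hp : Run W p s t s') : Run W (.ite b p q) s (1 + t) s'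
  | iteFalse {b : Test} {p q : Program} {s s' : State} {t : ℕ} (hb : ¬ b.Holds s)
      (hq : Run W q s t s') : Run W (.ite b p q) s (1 + t) s'
  | loopTrue {b : Test} {p : Program} {s s' s'' : State} {t t' : ℕ} (hb : b.Holds s)
      (hp : Run W p s t s') (hl : Run W (.loop b p) s' t' s'') :
      Run W (.loop b p) s (1 + t + t') s''
  | loopFalse {b : Test} {p : Program} {s : State} (hb : ¬ b.Holds s) :
      Run W (.loop b p) s 1 s

/-- The initial state on an input word list: it fills the memory from address `0` on; all other
cells and all registers are zero. -/
def initState (input : List ℕ) : State where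
  reg := fun _ => 0
  mem := fun i => input.getD i 0

/-- The list `l` enumerates the edges of `G`, each edge exactly once, in an arbitrary order and
with an arbitrary order of its two ends. -/
def IsEdgeList {n : ℕ} (G : SimpleGraph (Fin n)) (l : List (Fin n × Fin n)) : Prop :=
  (l.map fun p => s(p.1, p.2)).Nodup ∧
    ∀ e : Sym2 (Fin n), e ∈ G.edgeSet ↔ e ∈ l.map fun p => s(p.1, p.2)

/-- The input words for a graph with the vertices `0, …, n - 1` given by a list of its edges: the
number of vertices, the number of edges, and then the two ends of each edge in turn. -/
def graphInput {n : ℕ} (l : List (Fin n × Fin n)) : List ℕ :=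
  n :: l.length :: l.flatMap fun p => [(p.1 : ℕ), (p.2 : ℕ)]

/-- In state `s`, the memory cells `0, …, n - 1` hold the characteristic vector of `L`. -/
def OutputsSet {n : ℕ} (s : State) (L : Finset (Fin n)) : Prop :=
  ∀ v : Fin n, s.mem v = if v ∈ L then 1 else 0

end WordRAM

namespace SimpleGraph

variable {V : Type*} {G : SimpleGraph V}

/-! ### Short cycles and leaves of acyclic graphs -/

/-! On a tree the domination condition becomes local. For an edge `xy`, `N[xy] = N(x) ∪ N(y)`, and
this union is disjoint because there are no triangles. With `c(v)` the number of neighbours of `v`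
in `L`, the condition on single edges therefore reads `c(x) + c(y) ≥ 2`. For two edges `xy`, `xz`
the sets `N(y)` and `N(z)` meet only in `x`, so the condition on pairs reads `c(x) + c(y) + c(z) ≥ 3
+ [x ∈ L]`. Disjoint edges add nothing. If some edge joins them, their neighbourhoods cover those of
two adjacent edges. Otherwise two common vertices would create a cycle of length at most 6, so at
most one vertex is shared and 2 + 2 - 1 = 3 vertices of `L` are seen. This is
`IsAcyclic.isLiarsVEDominating_iff`.

A finite tree automaton checks such a condition. The state of a vertex consists of its membership in
`L`, a guess of `c(v)`, the number of neighbours in `L` absorbed so far, and the least guess among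
the absorbed neighbours. The least guess suffices for the pairs: a new neighbour has to be tested
only against the worst earlier one. No inequality demands more than 4, so all numbers may be cut off
at 4 and 250 states remain. `LiarsVE.exists_runs_iff` says that accepting runs are exactly the
consistent guesses.

If leaves are removed one by one, each being absorbed into its only remaining neighbour, the
cheapest run is found by dynamic programming on a cost table per vertex. Since the whole vertex set
is feasible, the optimum is at most `n`, and `n + 1` can serve as infinity.
`TreeAutomaton.table_le_runCost` shows that the table is a lower bound, and
`TreeAutomaton.Runs.unabsorb`, applied backwards, yields a run that attains it.

The machine needs no adjacency lists. It keeps for each vertex its degree and the sum of the numbers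
of its neighbours; for a leaf this sum is its neighbour. A scan follows a chain of newly created
leaves before it advances, so every step removes a leaf or moves the scan, which gives at most `2 *
n` steps. The number of automaton states is a constant, so the loops over states and transitions are
unrolled into straight-line code and each absorption or reconstruction takes constant time. -/

theorem IsAcyclic.no_three_cycle (h : G.IsAcyclic) {a b c : V} (hab : G.Adj a b) (hbc : G.Adj b c)
    (hca : G.Adj c a) : False := by
  refine h (.cons hab (.cons hbc (.cons hca .nil))) ?_
  simp [Walk.isCycle_def, hab.ne, hbc.ne, hca.ne, hab.ne', hca.ne']

theorem IsAcyclic.no_four_cycle (h : G.IsAcyclic) {a b c d : V} (hab : G.Adj a b)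
    (hbc : G.Adj b c) (hcd : G.Adj c d) (hda : G.Adj d a) (hac : a ≠ c) (hbd : b ≠ d) : False := by
  refine h (.cons hab (.cons hbc (.cons hcd (.cons hda .nil)))) ?_
  simp [Walk.isCycle_def, hab.ne, hbc.ne, hcd.ne, hda.ne, hab.ne', hda.ne', hac,
    hac.symm, hbd]

theorem IsAcyclic.no_five_cycle (h : G.IsAcyclic) {a b c d e : V} (hab : G.Adj a b)
    (hbc : G.Adj b c) (hcd : G.Adj c d) (hde : G.Adj d e) (hea : G.Adj e a)
    (hd : [a, b, c, d, e].Nodup) : False := by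
  refine h (.cons hab (.cons hbc (.cons hcd (.cons hde (.cons hea .nil))))) ?_
  simp [Walk.isCycle_def] at hd ⊢
  grind

theorem IsAcyclic.no_six_cycle (h : G.IsAcyclic) {a b c d e f : V} (hab : G.Adj a b)
    (hbc : G.Adj b c) (hcd : G.Adj c d) (hde : G.Adj d e) (hef : G.Adj e f) (hfa : G.Adj f a)
    (hd : [a, b, c, d, e, f].Nodup) : False := by
  refine h (.cons hab (.cons hbc (.cons hcd (.cons hde (.cons hef (.cons hfa .nil)))))) ?_
  simp [Walk.isCycle_def] at hd ⊢
  grind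

/-- A finite acyclic graph with an edge has a vertex with exactly one neighbour. -/
theorem IsAcyclic.exists_existsUnique_adj [Finite V] (h : G.IsAcyclic) {a b : V}
    (hab : G.Adj a b) : ∃ u, ∃! w, G.Adj u w := by
  classical
  have := Fintype.ofFinite V
  -- The first vertex of a longest path works: a neighbour off the path would extend it, and a
  -- neighbour on the path other than the second vertex would close a cycle.
  let S : Set ℕ := {k | ∃ (u v : V) (p : G.Walk u v), p.IsPath ∧ p.length = k}
  have hS1 : 1 ∈ S := ⟨a, b, .cons hab .nil, by simp [hab.ne], by simp⟩
  have hbdd : BddAbove S := ⟨Fintype.card V, by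
    rintro k ⟨u, v, p, hp, rfl⟩
    exact hp.length_lt.le⟩
  obtain ⟨u, v, p, hp, hlen⟩ := Nat.sSup_mem ⟨1, hS1⟩ hbdd
  have h1 : 1 ≤ p.length := hlen ▸ le_csSup hbdd hS1
  have hnn : ¬ p.Nil := by
    intro hn
    rw [← Walk.length_eq_zero_iff] at hn
    omega
  refine ⟨u, p.snd, p.adj_snd hnn, fun w hw => ?_⟩
  by_cases hmem : w ∈ p.support
  · exact h.eq_snd_of_adj_start hp hw hmem
  · have : (p.length + 1) ∈ S := ⟨w, v, .cons hw.symm p, hp.cons hmem, by simp⟩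
    have := le_csSup hbdd this
    omega

/-! ### Counting form of the domination condition -/

/-- The number of neighbours of `v` in `L`. -/
noncomputable def nbrCount (G : SimpleGraph V) (L : Finset V) (v : V) : ℕ :=
  (G.neighborSet v ∩ (L : Set V)).ncard

/-- The ends themselves need no separate mention, since each lies in the open neighbourhood of the
other. -/
theorem edgeClosedNbhd_mk {x y : V} (h : G.Adj x y) :
    G.edgeClosedNbhd s(x, y) = G.neighborSet x ∪ G.neighborSet y := by
  ext w
  simp only [edgeClosedNbhd, closedNbhd, Sym2.mem_iff, Set.mem_ofPred_eq, Set.mem_union,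
    Set.mem_insert_iff, mem_neighborSet]
  constructor
  · rintro ⟨z, rfl | rfl, rfl | hw⟩
    · exact .inr h.symm
    · exact .inl hw
    · exact .inl h
    · exact .inr hw
  · rintro (hw | hw)
    · exact ⟨x, .inl rfl, .inr hw⟩
    · exact ⟨y, .inr rfl, .inr hw⟩

theorem IsAcyclic.disjoint_neighborSet (hG : G.IsAcyclic) {x y : V} (h : G.Adj x y) :
    Disjoint (G.neighborSet x) (G.neighborSet y) := by
  rw [Set.disjoint_left]
  exact fun w hx hy => hG.no_three_cycle h hy (SimpleGraph.Adj.symm hx)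

theorem IsAcyclic.ncard_edge (hG : G.IsAcyclic) (L : Finset V) {x y : V} (h : G.Adj x y) :
    (G.edgeClosedNbhd s(x, y) ∩ (L : Set V)).ncard = G.nbrCount L x + G.nbrCount L y := by
  rw [edgeClosedNbhd_mk h, Set.union_inter_distrib_right, nbrCount, nbrCount]
  exact Set.ncard_union_eq ((hG.disjoint_neighborSet h).mono Set.inter_subset_left
    Set.inter_subset_left) (L.finite_toSet.inter_of_right _) (L.finite_toSet.inter_of_right _)

-- Inclusion-exclusion. The absence of triangles separates `N(x)` from `N(y)` and `N(z)`, and the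
-- absence of 4-cycles leaves `x` as the only common neighbour of `y` and `z`. The indicator of `x`
-- stands on the left to avoid truncated subtraction.
open Classical in
theorem IsAcyclic.ncard_adjacent_edges (hG : G.IsAcyclic) (L : Finset V) {x y z : V}
    (hy : G.Adj x y) (hz : G.Adj x z) (hyz : y ≠ z) :
    ((G.edgeClosedNbhd s(x, y) ∪ G.edgeClosedNbhd s(x, z)) ∩ (L : Set V)).ncard
      + (if x ∈ L then 1 else 0) = G.nbrCount L x + G.nbrCount L y + G.nbrCount L z := by
  have hf : ∀ S : Set V, (S ∩ (L : Set V)).Finite := fun S => L.finite_toSet.inter_of_right _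
  have e1 : (G.edgeClosedNbhd s(x, y) ∪ G.edgeClosedNbhd s(x, z)) ∩ (L : Set V) =
      (G.neighborSet x ∩ L) ∪ ((G.neighborSet y ∩ L) ∪ (G.neighborSet z ∩ L)) := by
    rw [edgeClosedNbhd_mk hy, edgeClosedNbhd_mk hz]
    ext; simp; tauto
  have hd : Disjoint (G.neighborSet x ∩ (L : Set V))
      ((G.neighborSet y ∩ L) ∪ (G.neighborSet z ∩ L)) := by
    rw [Set.disjoint_union_right]
    exact ⟨(hG.disjoint_neighborSet hy).mono Set.inter_subset_left Set.inter_subset_left,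
      (hG.disjoint_neighborSet hz).mono Set.inter_subset_left Set.inter_subset_left⟩
  have hi : (G.neighborSet y ∩ (L : Set V)) ∩ (G.neighborSet z ∩ L) = {x} ∩ (L : Set V) := by
    ext w
    simp only [Set.mem_inter_iff, mem_neighborSet, Set.mem_singleton_iff]
    constructor
    · rintro ⟨⟨h1, h2⟩, h3, -⟩
      refine ⟨?_, h2⟩
      by_contra hne
      exact hG.no_four_cycle hy h1 h3.symm hz.symm (Ne.symm hne) hyz
    · rintro ⟨rfl, h⟩
      exact ⟨⟨hy.symm, h⟩, hz.symm, h⟩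
  have hx : ({x} ∩ (L : Set V)).ncard = if x ∈ L then 1 else 0 := by
    split_ifs with h
    · rw [Set.inter_eq_left.2 (by simpa using h)]; simp
    · rw [Set.singleton_inter_eq_empty.2 (by simpa using h)]; simp
  have := Set.ncard_union_add_ncard_inter (G.neighborSet y ∩ (L : Set V)) (G.neighborSet z ∩ L)
    (hf _) (hf _)
  rw [e1, Set.ncard_union_eq hd (hf _) ((hf _).union (hf _)), nbrCount, nbrCount, nbrCount]
  rw [hi, hx] at this
  omega

/-- Two disjoint edges of an acyclic graph that are not joined by an edge have at most one common
vertex in their closed neighbourhoods. -/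
theorem IsAcyclic.subsingleton_inter_edgeClosedNbhd (hG : G.IsAcyclic) {x y z w : V}
    (hxy : G.Adj x y) (hzw : G.Adj z w) (hxz : x ≠ z) (hxw : x ≠ w) (hyz : y ≠ z) (hyw : y ≠ w)
    (nxz : ¬ G.Adj x z) (nxw : ¬ G.Adj x w) (nyz : ¬ G.Adj y z) (nyw : ¬ G.Adj y w) :
    (G.edgeClosedNbhd s(x, y) ∩ G.edgeClosedNbhd s(z, w)).Subsingleton := by
  -- By symmetry one common vertex `a` may be taken adjacent to `x` and `z`. A second one, `b`,
  -- closes a cycle through `x, a, z, b`, possibly also through `w` and `y`; its length is 4, 5 or 6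
  -- according to the ends to which `b` is attached.
  have key : ∀ {x y z w a b : V}, G.Adj x y → G.Adj z w → x ≠ z → x ≠ w → y ≠ z → y ≠ w →
      ¬ G.Adj x z → ¬ G.Adj x w → ¬ G.Adj y z → ¬ G.Adj y w → G.Adj x a → G.Adj z a →
      (G.Adj x b ∨ G.Adj y b) → (G.Adj z b ∨ G.Adj w b) → a = b := by
    intro x y z w a b hxy hzw hxz hxw hyz hyw nxz nxw nyz nyw hxa hza h1 h2
    by_contra hab
    have hax := hxa.ne
    have haz := hza.ne
    have hay : a ≠ y := by rintro rfl; exact nyz hza.symm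
    have haw : a ≠ w := by rintro rfl; exact nxw hxa
    have hbx : b ≠ x := by
      rintro rfl
      rcases h2 with h2 | h2
      · exact nxz h2.symm
      · exact nxw h2.symm
    have hby : b ≠ y := by
      rintro rfl
      rcases h2 with h2 | h2
      · exact nyz h2.symm
      · exact nyw h2.symm
    have hbz : b ≠ z := by
      rintro rfl
      rcases h1 with h1 | h1
      · exact nxz h1
      · exact nyz h1
    have hbw : b ≠ w := by
      rintro rfl
      rcases h1 with h1 | h1
      · exact nxw h1
      · exact nyw h1
    have hxy' := hxy.ne
    have hzw' := hzw.ne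
    rcases h1 with h1 | h1 <;> rcases h2 with h2 | h2
    · exact hG.no_four_cycle hxa hza.symm h2 h1.symm hxz hab
    · exact hG.no_five_cycle hxa hza.symm hzw h2 h1.symm (by simp; grind)
    · exact hG.no_five_cycle hxa hza.symm h2 h1.symm hxy.symm (by simp; grind)
    · exact hG.no_six_cycle hxa hza.symm hzw h2 h1.symm hxy.symm (by simp; grind)
  rw [edgeClosedNbhd_mk hxy, edgeClosedNbhd_mk hzw]
  rintro a ⟨ha1 | ha1, ha2 | ha2⟩ b ⟨hb1, hb2⟩
  · exact key hxy hzw hxz hxw hyz hyw nxz nxw nyz nyw ha1 ha2 hb1 hb2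
  · exact key hxy hzw.symm hxw hxz hyw hyz nxw nxz nyw nyz ha1 ha2 hb1 hb2.symm
  · exact key hxy.symm hzw hyz hyw hxz hxw nyz nyw nxz nxw ha1 ha2 hb1.symm hb2
  · exact key hxy.symm hzw.symm hyw hyz hxw hxz nyw nyz nxw nxz ha1 ha2 hb1.symm hb2.symm

open Classical in
/-- In an acyclic graph, being a liar's vertex-edge dominating set is a condition on the numbers of
neighbours in the set, for single edges and for pairs of adjacent edges. -/
theorem IsAcyclic.isLiarsVEDominating_iff (hG : G.IsAcyclic) (L : Finset V) :
    G.IsLiarsVEDominating L ↔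
      (∀ x y, G.Adj x y → 2 ≤ G.nbrCount L x + G.nbrCount L y) ∧
      (∀ x y z, G.Adj x y → G.Adj x z → y ≠ z →
        3 + (if x ∈ L then 1 else 0) ≤ G.nbrCount L x + G.nbrCount L y + G.nbrCount L z) := by
  have hf : ∀ S : Set V, (S ∩ (L : Set V)).Finite := fun S => L.finite_toSet.inter_of_right _
  constructor
  · rintro ⟨h1, h2⟩
    refine ⟨fun x y h => ?_, fun x y z hy hz hyz => ?_⟩
    · rw [← hG.ncard_edge L h]
      exact h1 _ h
    · rw [← hG.ncard_adjacent_edges L hy hz hyz]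
      have := h2 s(x, y) hy s(x, z) hz (by
        intro h
        rw [Sym2.congr_right] at h
        exact hyz h)
      omega
  · rintro ⟨h1, h2⟩
    have hadj : ∀ {x y z}, G.Adj x y → G.Adj x z → y ≠ z →
        3 ≤ ((G.edgeClosedNbhd s(x, y) ∪ G.edgeClosedNbhd s(x, z)) ∩ (L : Set V)).ncard := by
      intro x y z hy hz hyz
      have e := hG.ncard_adjacent_edges L hy hz hyz
      have := h2 x y z hy hz hyz
      omega
    -- When `yz` joins the two edges, their neighbourhoods contain `N(x) ∪ N(y) ∪ N(z)`, which is
    -- what the adjacent edges `yx` and `yz` see.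
    have hjoin : ∀ {x y z w}, G.Adj x y → G.Adj z w → G.Adj y z → x ≠ z →
        3 ≤ ((G.edgeClosedNbhd s(x, y) ∪ G.edgeClosedNbhd s(z, w)) ∩ (L : Set V)).ncard := by
      intro x y z w hxy hzw hyz hne
      refine (hadj hxy.symm hyz hne).trans (Set.ncard_le_ncard ?_ (hf _))
      rw [edgeClosedNbhd_mk hxy, edgeClosedNbhd_mk hzw, edgeClosedNbhd_mk hxy.symm,
        edgeClosedNbhd_mk hyz]
      refine Set.inter_subset_inter_left _ ?_
      intro v
      simp only [Set.mem_union]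
      tauto
    refine ⟨fun e he => ?_, fun e he e' he' hne => ?_⟩
    · induction e with | _ x y =>
      rw [hG.ncard_edge L he]
      exact h1 x y he
    · induction e with | _ x y =>
      induction e' with | _ z w =>
      rw [mem_edgeSet] at he he'
      by_cases hxz : x = z
      · subst hxz
        exact hadj he he' (by rintro rfl; exact hne rfl)
      by_cases hxw : x = w
      · subst hxw
        rw [Sym2.eq_swap (a := z)]
        exact hadj he he'.symm (by rintro rfl; exact hne Sym2.eq_swap)
      by_cases hyz : y = z
      · subst hyz
        rw [Sym2.eq_swap (a := x)]
        exact hadj he.symm he' hxw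
      by_cases hyw : y = w
      · subst hyw
        rw [Sym2.eq_swap (a := x), Sym2.eq_swap (a := z)]
        exact hadj he.symm he'.symm hxz
      by_cases nyz : G.Adj y z
      · exact hjoin he he' nyz hxz
      by_cases nyw : G.Adj y w
      · rw [Sym2.eq_swap (a := z)]
        exact hjoin he he'.symm nyw hxw
      by_cases nxz : G.Adj x z
      · rw [Sym2.eq_swap (a := x)]
        exact hjoin he.symm he' nxz hyz
      by_cases nxw : G.Adj x w
      · rw [Sym2.eq_swap (a := x), Sym2.eq_swap (a := z)]
        exact hjoin he.symm he'.symm nxw hyw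
      -- The remaining pairs are disjoint and not joined: each edge sees two vertices of `L` and at
      -- most one is counted twice, which leaves three.
      have hs := hG.subsingleton_inter_edgeClosedNbhd he he' hxz hxw hyz hyw nxz nxw nyz nyw
      rw [Set.union_inter_distrib_right]
      have e := Set.ncard_union_add_ncard_inter (G.edgeClosedNbhd s(x, y) ∩ (L : Set V))
        (G.edgeClosedNbhd s(z, w) ∩ (L : Set V)) (hf _) (hf _)
      have hle : ((G.edgeClosedNbhd s(x, y) ∩ (L : Set V)) ∩
          (G.edgeClosedNbhd s(z, w) ∩ (L : Set V))).ncard ≤ 1 := by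
        rw [Set.ncard_le_one ((hf _).subset Set.inter_subset_left)]
        exact fun a ha b hb => hs ⟨ha.1.1, ha.2.1⟩ ⟨hb.1.1, hb.2.1⟩
      rw [hG.ncard_edge L he, hG.ncard_edge L he'] at e
      have := h1 x y he
      have := h1 z w he'
      omega

/-! ### Feasibility of the whole vertex set -/

theorem two_le_nbrCount_univ [Fintype V] {x y z : V} (hy : G.Adj x y) (hz : G.Adj x z)
    (hyz : y ≠ z) : 2 ≤ G.nbrCount Finset.univ x := by
  rw [nbrCount, ← Set.ncard_pair hyz]
  exact Set.ncard_le_ncard (by rintro v (rfl | rfl) <;> simpa) (Set.toFinite _)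

theorem one_le_nbrCount_univ [Fintype V] {x y : V} (hy : G.Adj x y) :
    1 ≤ G.nbrCount Finset.univ x := by
  rw [nbrCount, ← Set.ncard_singleton y]
  exact Set.ncard_le_ncard (by rintro v rfl; simpa) (Set.toFinite _)

/-- The common end of two edges has at least two neighbours and each outer end at least one, so the
sum is at least 4 = 3 + 1. This provides the feasible solution that keeps the optimum at most `n`.
-/
theorem IsAcyclic.isLiarsVEDominating_univ [Fintype V] (hG : G.IsAcyclic) :
    G.IsLiarsVEDominating Finset.univ := by
  rw [hG.isLiarsVEDominating_iff]
  refine ⟨fun x y h => ?_, fun x y z hy hz hyz => ?_⟩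
  · have := one_le_nbrCount_univ h
    have := one_le_nbrCount_univ h.symm
    omega
  · have := two_le_nbrCount_univ hy hz hyz
    have := one_le_nbrCount_univ hy.symm
    have := one_le_nbrCount_univ hz.symm
    simp
    omega

end SimpleGraph

/-! ### Elimination orders and optimal runs of tree automata -/

/-- A finite weighted tree automaton. States are the numbers below `N`; a transition `(a, b, c)`
absorbs a child in state `b` into its parent in state `a`, whose new state is `c`. -/
structure TreeAutomaton where
  N : ℕ
  trans : List (ℕ × ℕ × ℕ)
  ini : ℕ → Bool
  lab : ℕ → ℕ
  acc : ℕ → Bool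
  trans_lt : ∀ t ∈ trans, t.1 < N ∧ t.2.1 < N ∧ t.2.2 < N
  lab_le : ∀ q, lab q ≤ 1

section Elimination

variable {V : Type*}

/-- `es` lists pairs of a leaf and its neighbour, in an order in which the leaves can be removed
successively until only the root `r` remains. -/
structure IsElimination (es : List (V × V)) (r : V) : Prop where
  pairwise : es.Pairwise fun e f => e.1 ≠ f.1 ∧ e.1 ≠ f.2
  fst_ne_snd : ∀ e ∈ es, e.1 ≠ e.2
  fst_ne_root : ∀ e ∈ es, e.1 ≠ r
  snd_mem : ∀ e ∈ es, e.2 = r ∨ e.2 ∈ es.map Prod.fst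

theorem IsElimination.tail {e : V × V} {es : List (V × V)} {r : V}
    (h : IsElimination (e :: es) r) : IsElimination es r where
  pairwise := (List.pairwise_cons.1 h.pairwise).2
  fst_ne_snd f hf := h.fst_ne_snd f (List.mem_cons_of_mem _ hf)
  fst_ne_root f hf := h.fst_ne_root f (List.mem_cons_of_mem _ hf)
  snd_mem f hf := by
    rcases h.snd_mem f (List.mem_cons_of_mem _ hf) with h1 | h1
    · exact .inl h1
    · rw [List.map_cons, List.mem_cons] at h1
      exact .inr (h1.resolve_left fun h2 => ((List.pairwise_cons.1 h.pairwise).1 f hf).2 h2.symm)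

theorem IsElimination.drop {es : List (V × V)} {r : V} (h : IsElimination es r)
    (i : ℕ) : IsElimination (es.drop i) r := by
  induction i generalizing es with
  | zero => exact h
  | succ i ih =>
    cases es with
    | nil => exact h
    | cons e es => exact ih h.tail

variable [DecidableEq V]

/-- The vertices that occur in an elimination order. -/
def elimVerts (es : List (V × V)) (r : V) : Finset V := insert r (es.map Prod.fst).toFinset

theorem elimVerts_cons (e : V × V) (es : List (V × V)) (r : V) :
    elimVerts (e :: es) r = insert e.1 (elimVerts es r) := by
  simp [elimVerts, Finset.insert_comm]

theorem IsElimination.fst_notMem {e : V × V} {es : List (V × V)} {r : V}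
    (h : IsElimination (e :: es) r) : e.1 ∉ elimVerts es r := by
  have h1 := (List.pairwise_cons.1 h.pairwise).1
  have h2 := h.fst_ne_root e (by simp)
  simp only [elimVerts, Finset.mem_insert, List.mem_toFinset, List.mem_map, not_or, not_exists,
    not_and]
  exact ⟨h2, fun f hf he => (h1 f hf).1 he.symm⟩

theorem IsElimination.snd_mem_elimVerts {e : V × V} {es : List (V × V)} {r : V}
    (h : IsElimination (e :: es) r) : e.2 ∈ elimVerts es r := by
  have h1 := h.snd_mem e (by simp)
  have h2 := h.fst_ne_snd e (by simp)
  simp only [elimVerts, Finset.mem_insert, List.mem_toFinset]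
  exact h1.imp_right fun h => (List.mem_cons.1 (by simpa using h)).resolve_left h2.symm

namespace TreeAutomaton

variable (𝒜 : TreeAutomaton)

/-- The automaton, started with the states `σ`, can be run along `es`, and the root is then in
state `q`. -/
def Runs : List (V × V) → (V → ℕ) → V → ℕ → Prop
  | [], σ, r, q => σ r = q
  | e :: es, σ, r, q => ∃ x, (σ e.2, σ e.1, x) ∈ 𝒜.trans ∧ Runs es (Function.update σ e.2 x) r q

/-- A run never consults vertices outside the elimination order. In particular, the entry of a leaf
that has already been absorbed may be changed freely. -/
theorem Runs.congr {𝒜 : TreeAutomaton} {es : List (V × V)} {σ τ : V → ℕ} {r : V} {q : ℕ}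
    (he : IsElimination es r) (h : 𝒜.Runs es σ r q) (hστ : ∀ v ∈ elimVerts es r, σ v = τ v) :
    𝒜.Runs es τ r q := by
  induction es generalizing σ τ with
  | nil => rw [Runs] at *; rw [← h, hστ r (by simp [elimVerts])]
  | cons e es ih =>
    obtain ⟨x, hx, h⟩ := h
    have h2 : e.2 ∈ elimVerts (e :: es) r := by
      rw [elimVerts_cons]; exact Finset.mem_insert_of_mem he.snd_mem_elimVerts
    have h1 : e.1 ∈ elimVerts (e :: es) r := by
      rw [elimVerts_cons]; exact Finset.mem_insert_self _ _
    refine ⟨x, by rwa [← hστ _ h1, ← hστ _ h2], ih he.tail h fun v hv => ?_⟩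
    rw [Function.update_apply, Function.update_apply,
      hστ v (by rw [elimVerts_cons]; exact Finset.mem_insert_of_mem hv)]

/-! ### Dynamic programming along an elimination order -/

/-- The least cost, cut off at `I`, of a transition to `q` when the costs of the states of the
parent and of the child are `a` and `b`. -/
def best (ts : List (ℕ × ℕ × ℕ)) (I : ℕ) (a b : ℕ → ℕ) (q : ℕ) : ℕ :=
  ts.foldl (fun x t => if t.2.2 = q ∧ a t.1 + b t.2.1 < x then a t.1 + b t.2.1 else x) I

theorem best_append_singleton (ts : List (ℕ × ℕ × ℕ)) (I : ℕ) (a b : ℕ → ℕ) (q : ℕ)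
    (t : ℕ × ℕ × ℕ) : best (ts ++ [t]) I a b q =
      if t.2.2 = q ∧ a t.1 + b t.2.1 < best ts I a b q then a t.1 + b t.2.1
      else best ts I a b q := by
  rw [best, List.foldl_append]
  rfl

theorem best_le_cutoff (ts : List (ℕ × ℕ × ℕ)) (I : ℕ) (a b : ℕ → ℕ) (q : ℕ) :
    best ts I a b q ≤ I := by
  induction ts using List.reverseRecOn with
  | nil => simp [best]
  | append_singleton ts t ih => rw [best_append_singleton]; split_ifs <;> omega

theorem best_le (ts : List (ℕ × ℕ × ℕ)) (I : ℕ) (a b : ℕ → ℕ) {x y z : ℕ}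
    (h : (x, y, z) ∈ ts) : best ts I a b z ≤ a x + b y := by
  induction ts using List.reverseRecOn with
  | nil => simp at h
  | append_singleton ts t ih =>
    rw [best_append_singleton]
    rcases List.mem_append.1 h with h | h
    · have := ih h
      split_ifs <;> omega
    · rw [List.mem_singleton] at h
      subst h
      simp only [true_and]
      split_ifs <;> omega

/-- The change of the cost table when the leaf `e.1` is absorbed into `e.2`. -/
def absorb (I : ℕ) (D : V → ℕ → ℕ) (e : V × V) : V → ℕ → ℕ :=
  Function.update D e.2 (best 𝒜.trans I (D e.2) (D e.1))

/-- The cost table after the removal of the leaves in `es`. -/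
def table (I : ℕ) (D : V → ℕ → ℕ) (es : List (V × V)) : V → ℕ → ℕ := es.foldl (𝒜.absorb I) D

theorem table_append_singleton (I : ℕ) (D : V → ℕ → ℕ) (es : List (V × V)) (e : V × V) :
    𝒜.table I D (es ++ [e]) = 𝒜.absorb I (𝒜.table I D es) e := by
  simp [table]

theorem absorb_le {I : ℕ} {D : V → ℕ → ℕ} (hD : ∀ v q, D v q ≤ I) (e : V × V) (v : V) (q : ℕ) :
    𝒜.absorb I D e v q ≤ I := by
  rw [absorb, Function.update_apply]
  split_ifs
  · exact best_le_cutoff _ _ _ _ _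
  · exact hD v q

theorem table_le {I : ℕ} {D : V → ℕ → ℕ} (hD : ∀ v q, D v q ≤ I) (es : List (V × V)) (v : V)
    (q : ℕ) : 𝒜.table I D es v q ≤ I := by
  induction es using List.reverseRecOn generalizing v q with
  | nil => exact hD v q
  | append_singleton es e ih => rw [table_append_singleton]; exact 𝒜.absorb_le ih _ _ _

/-- The cost of a run. -/
def runCost (D : V → ℕ → ℕ) (es : List (V × V)) (r : V) (σ : V → ℕ) : ℕ :=
  ∑ v ∈ elimVerts es r, D v (σ v)

theorem runCost_cons (D : V → ℕ → ℕ) {e : V × V} {es : List (V × V)} {r : V}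
    (h : IsElimination (e :: es) r) (σ : V → ℕ) :
    runCost D (e :: es) r σ = D e.1 (σ e.1) + D e.2 (σ e.2) +
      ∑ v ∈ (elimVerts es r).erase e.2, D v (σ v) := by
  rw [runCost, elimVerts_cons, Finset.sum_insert h.fst_notMem,
    ← Finset.add_sum_erase _ _ h.snd_mem_elimVerts]
  ring

theorem runCost_absorb (I : ℕ) (D : V → ℕ → ℕ) {e : V × V} {es : List (V × V)} {r : V}
    (h : IsElimination (e :: es) r) (σ τ : V → ℕ)
    (hστ : ∀ v ∈ (elimVerts es r).erase e.2, σ v = τ v) :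
    runCost (𝒜.absorb I D e) es r τ = best 𝒜.trans I (D e.2) (D e.1) (τ e.2) +
      ∑ v ∈ (elimVerts es r).erase e.2, D v (σ v) := by
  rw [runCost, ← Finset.add_sum_erase _ _ h.snd_mem_elimVerts, absorb, Function.update_self]
  congr 1
  refine Finset.sum_congr rfl fun v hv => ?_
  rw [Function.update_of_ne (Finset.ne_of_mem_erase hv), hστ v hv]

/-- Every transition used by a run is a candidate in the minimum formed by `best`, so absorbing
along the run never raises the cost. This is the lower bound; `Runs.unabsorb` shows that it is
attained as long as the cutoff is not reached. -/
theorem table_le_runCost (I : ℕ) (D : V → ℕ → ℕ) {es : List (V × V)} {r : V}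
    (h : IsElimination es r) {σ : V → ℕ} {q : ℕ} (hr : 𝒜.Runs es σ r q) :
    𝒜.table I D es r q ≤ runCost D es r σ := by
  induction es generalizing D σ with
  | nil =>
    rw [Runs] at hr
    simp [table, runCost, elimVerts, hr]
  | cons e es ih =>
    obtain ⟨x, hx, hr⟩ := hr
    refine (ih (𝒜.absorb I D e) h.tail hr).trans ?_
    rw [𝒜.runCost_absorb I D h σ, runCost_cons D h, Function.update_self]
    · have := best_le 𝒜.trans I (D e.2) (D e.1) hx
      omega
    · intro v hv
      rw [Function.update_of_ne (Finset.ne_of_mem_erase hv)]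

/-- One step of the reconstruction of an optimal run. -/
theorem Runs.unabsorb {𝒜 : TreeAutomaton} (I : ℕ) (D : V → ℕ → ℕ) {e : V × V}
    {es : List (V × V)} {r : V} (h : IsElimination (e :: es) r) {σ : V → ℕ} {q x y : ℕ}
    (hr : 𝒜.Runs es σ r q) (ht : (x, y, σ e.2) ∈ 𝒜.trans)
    (hb : best 𝒜.trans I (D e.2) (D e.1) (σ e.2) = D e.2 x + D e.1 y) {τ : V → ℕ}
    (hτ : τ = Function.update (Function.update σ e.2 x) e.1 y) :
    𝒜.Runs (e :: es) τ r q ∧ runCost D (e :: es) r τ = runCost (𝒜.absorb I D e) es r σ := by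
  have h12 := h.fst_ne_snd e (by simp)
  have t2 : τ e.2 = x := by
    rw [hτ, Function.update_of_ne h12.symm, Function.update_self]
  have t1 : τ e.1 = y := by rw [hτ, Function.update_self]
  have hv : ∀ v ∈ elimVerts es r, v ≠ e.2 → τ v = σ v := by
    intro v hv h2
    rw [hτ, Function.update_of_ne, Function.update_of_ne h2]
    rintro rfl
    exact h.fst_notMem hv
  constructor
  · refine ⟨σ e.2, by rwa [t1, t2], hr.congr h.tail fun v hve => ?_⟩
    rw [Function.update_apply]
    split_ifs with hv2
    · rw [hv2]
    · exact (hv v hve hv2).symm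
  · rw [runCost_cons D h, 𝒜.runCost_absorb I D h τ, t1, t2, hb]
    · ring
    · exact fun v hve => hv v (Finset.mem_of_mem_erase hve) (Finset.ne_of_mem_erase hve)

end TreeAutomaton

end Elimination

/-! ### The automaton for liar's vertex-edge dominating sets -/

section NeighbourList

variable {V : Type*} [DecidableEq V]

/-- The other ends of the pairs in `es` that contain `v`. -/
def nbrList (es : List (V × V)) (v : V) : List V :=
  es.flatMap fun e => (if e.1 = v then [e.2] else []) ++ (if e.2 = v then [e.1] else [])

@[simp]
theorem nbrList_nil (v : V) : nbrList [] v = [] := rfl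

theorem nbrList_cons (e : V × V) (es : List (V × V)) (v : V) : nbrList (e :: es) v =
    ((if e.1 = v then [e.2] else []) ++ (if e.2 = v then [e.1] else [])) ++ nbrList es v := rfl

theorem mem_nbrList {es : List (V × V)} {v w : V} :
    w ∈ nbrList es v ↔ s(v, w) ∈ es.map fun p => s(p.1, p.2) := by
  simp only [nbrList, List.mem_flatMap, List.mem_append, List.mem_ite_nil_right,
    List.mem_singleton, List.mem_map, Sym2.eq_iff]
  refine exists_congr fun e => and_congr_right fun _ => ?_
  tauto

theorem nodup_nbrList {es : List (V × V)} (h : (es.map fun p => s(p.1, p.2)).Nodup)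
    (hne : ∀ e ∈ es, e.1 ≠ e.2) (v : V) : (nbrList es v).Nodup := by
  induction es with
  | nil => simp
  | cons e es ih =>
    rw [List.map_cons, List.nodup_cons] at h
    have ih := ih h.2 fun f hf => hne f (List.mem_cons_of_mem _ hf)
    have h12 := hne e (by simp)
    rw [nbrList_cons]
    split_ifs with h1 h2 h2
    · exact absurd (h1.trans h2.symm) h12
    · subst h1
      simpa [mem_nbrList, ih] using h.1
    · subst h2
      simp only [List.nil_append, List.singleton_append, List.nodup_cons, mem_nbrList, ih, and_true]
      rw [Sym2.eq_swap]
      exact h.1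
    · simpa

/-- A leaf is listed at the moment when one edge at it remains, and no later pair mentions it. -/
theorem IsElimination.nbrList_fst {e : V × V} {es : List (V × V)} {r : V}
    (h : IsElimination (e :: es) r) : nbrList (e :: es) e.1 = [e.2] := by
  have h12 := h.fst_ne_snd e (by simp)
  have h1 := (List.pairwise_cons.1 h.pairwise).1
  have : nbrList es e.1 = [] := by
    rw [List.eq_nil_iff_forall_not_mem]
    intro w hw
    simp only [mem_nbrList, List.mem_map, Sym2.eq_iff] at hw
    obtain ⟨f, hf, h⟩ := hw
    have := h1 f hf
    grind
  simp [nbrList_cons, this, h12.symm]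

theorem nbrList_cons_snd {e : V × V} (h : e.1 ≠ e.2) (es : List (V × V)) :
    nbrList (e :: es) e.2 = e.1 :: nbrList es e.2 := by
  simp [nbrList_cons, h]

theorem nbrList_cons_of_ne {e : V × V} {v : V} (h1 : v ≠ e.1) (h2 : v ≠ e.2)
    (es : List (V × V)) : nbrList (e :: es) v = nbrList es v := by
  simp [nbrList_cons, h1.symm, h2.symm]

end NeighbourList

/-! ### States and transitions of the automaton -/

namespace LiarsVE

/-- Whether the vertex is in the set. -/
def lab (q : ℕ) : ℕ := q % 2

/-- The predicted number of neighbours in the set, cut off at `4`. -/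
def goal (q : ℕ) : ℕ := q / 2 % 5

/-- The number of neighbours in the set so far, cut off at `4`. -/
def seen (q : ℕ) : ℕ := q / 10 % 5

/-- The least prediction of a neighbour so far. -/
def low (q : ℕ) : ℕ := q / 50 % 5

/-- The state with the given components. -/
def code (l g k m : ℕ) : ℕ := l + 2 * g + 10 * k + 50 * m

/-- Mixed radix notation with digits in bases 2, 5, 5, 5, whence 2 · 5 · 5 · 5 = 250 states. -/
theorem code_spec {l g k m : ℕ} (hl : l ≤ 1) (hg : g ≤ 4) (hk : k ≤ 4) (hm : m ≤ 4) :
    lab (code l g k m) = l ∧ goal (code l g k m) = g ∧ seen (code l g k m) = k ∧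
      low (code l g k m) = m ∧ code l g k m < 250 := by
  unfold lab goal seen low code
  omega

theorem lab_le (q : ℕ) : lab q ≤ 1 := by unfold lab; omega
theorem goal_le (q : ℕ) : goal q ≤ 4 := by unfold goal; omega
theorem seen_le (q : ℕ) : seen q ≤ 4 := by unfold seen; omega
theorem low_le (q : ℕ) : low q ≤ 4 := by unfold low; omega

/-- The condition for absorbing a child in state `b` into its parent in state `a`. -/
def Compatible (a b : ℕ) : Prop :=
  2 ≤ goal a + goal b ∧ 3 + lab a ≤ goal a + goal b + low a ∧
    3 + lab b ≤ goal b + goal a + low b ∧ min 4 (seen b + lab a) = goal b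

instance (a b : ℕ) : Decidable (Compatible a b) := by unfold Compatible; infer_instance

/-- The new state of the parent. -/
def next (a b : ℕ) : ℕ :=
  code (lab a) (goal a) (min 4 (seen a + lab b)) (min (low a) (goal b))

theorem next_spec (a b : ℕ) : lab (next a b) = lab a ∧ goal (next a b) = goal a ∧
    seen (next a b) = min 4 (seen a + lab b) ∧ low (next a b) = min (low a) (goal b) ∧
      next a b < 250 :=
  code_spec (lab_le _) (goal_le _) (min_le_left _ _) ((min_le_left _ _).trans (low_le _))

/-- The tree automaton that recognises liar's vertex-edge dominating sets. -/
def automaton : TreeAutomaton where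
  N := 250
  trans := (((List.range 250) ×ˢ (List.range 250)).filter fun t => Compatible t.1 t.2).map
    fun t => (t.1, t.2, next t.1 t.2)
  ini q := seen q = 0 ∧ low q = 4
  lab := lab
  acc q := seen q = goal q
  trans_lt t ht := by
    rw [List.mem_map] at ht
    obtain ⟨⟨a, b⟩, h, rfl⟩ := ht
    rw [List.mem_filter, List.mem_product, List.mem_range, List.mem_range] at h
    exact ⟨h.1.1, h.1.2, (next_spec a b).2.2.2.2⟩
  lab_le := lab_le

theorem mem_trans {a b c : ℕ} : (a, b, c) ∈ automaton.trans ↔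
    a < 250 ∧ b < 250 ∧ Compatible a b ∧ c = next a b := by
  simp only [automaton, List.mem_map, List.mem_filter, List.mem_product, List.mem_range,
    decide_eq_true_eq, Prod.exists, Prod.mk.injEq]
  constructor
  · rintro ⟨x, y, ⟨⟨h1, h2⟩, h3⟩, rfl, rfl, rfl⟩
    exact ⟨h1, h2, h3, rfl⟩
  · rintro ⟨h1, h2, h3, rfl⟩
    exact ⟨a, b, ⟨⟨h1, h2⟩, h3⟩, rfl, rfl, rfl⟩

variable {V : Type*} [DecidableEq V]

theorem lab_update (σ : V → ℕ) (u v : V) (b : ℕ) :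
    lab (Function.update σ u (next (σ u) b) v) = lab (σ v) := by
  rw [Function.update_apply]
  split_ifs with hv
  · rw [(next_spec _ _).1, hv]
  · rfl

theorem goal_update (σ : V → ℕ) (u v : V) (b : ℕ) :
    goal (Function.update σ u (next (σ u) b) v) = goal (σ v) := by
  rw [Function.update_apply]
  split_ifs with hv
  · rw [(next_spec _ _).2.1, hv]
  · rfl

/-- The condition at a vertex that an accepting run checks. -/
def VertexCondition (es : List (V × V)) (σ : V → ℕ) (v : V) : Prop :=
  min 4 (seen (σ v) + ((nbrList es v).map fun y => lab (σ y)).sum) = goal (σ v) ∧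
  (∀ y ∈ nbrList es v, 3 + lab (σ v) ≤ goal (σ v) + goal (σ y) + low (σ v)) ∧
  (nbrList es v).Pairwise fun y z => 3 + lab (σ v) ≤ goal (σ v) + goal (σ y) + goal (σ z)

/-- All other neighbours of the leaf have been absorbed into its state, so its condition is settled
by the parent alone. These two clauses are the ones that `Compatible` imposes on the child. -/
theorem vertexCondition_fst {e : V × V} {es : List (V × V)} {r : V}
    (h : IsElimination (e :: es) r) (σ : V → ℕ) :
    VertexCondition (e :: es) σ e.1 ↔ min 4 (seen (σ e.1) + lab (σ e.2)) = goal (σ e.1) ∧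
      3 + lab (σ e.1) ≤ goal (σ e.1) + goal (σ e.2) + low (σ e.1) := by
  simp [VertexCondition, h.nbrList_fst]

/-- Absorbing the child moves its share of the condition into the state: its label goes into `seen`,
and the tests of the pairs formed by the child and a later neighbour go into `low`. Only the test of
the child against the earlier neighbours has to be made at once. -/
theorem vertexCondition_snd {e : V × V} {es : List (V × V)} (h : e.1 ≠ e.2) (σ : V → ℕ) :
    VertexCondition (e :: es) σ e.2 ↔
      3 + lab (σ e.2) ≤ goal (σ e.2) + goal (σ e.1) + low (σ e.2) ∧
        VertexCondition es (Function.update σ e.2 (next (σ e.2) (σ e.1))) e.2 := by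
  obtain ⟨n1, n2, n3, n4, -⟩ := next_spec (σ e.2) (σ e.1)
  simp only [VertexCondition, nbrList_cons_snd h, lab_update, goal_update, Function.update_self,
    n1, n2, n3, n4,
    List.map_cons, List.sum_cons, List.forall_mem_cons, List.pairwise_cons,
    min_def (low _)]
  -- Cutting off after each addition has the same effect as cutting off the total.
  have e1 : ∀ s, min 4 (seen (σ e.2) + (lab (σ e.1) + s)) =
      min 4 (min 4 (seen (σ e.2) + lab (σ e.1)) + s) := by intro s; omega
  rw [e1]
  constructor
  · rintro ⟨h1, ⟨h2, h3⟩, h4, h5⟩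
    refine ⟨h2, h1, fun y hy => ?_, h5⟩
    have := h3 y hy
    have := h4 y hy
    split_ifs <;> omega
  · rintro ⟨h2, h1, h3, h5⟩
    refine ⟨h1, ⟨h2, fun y hy => ?_⟩, fun y hy => ?_, h5⟩
    · have := h3 y hy
      split_ifs at this <;> omega
    · have := h3 y hy
      split_ifs at this <;> omega

theorem vertexCondition_of_ne {e : V × V} {es : List (V × V)} {v : V} (h1 : v ≠ e.1)
    (h2 : v ≠ e.2) (σ : V → ℕ) : VertexCondition (e :: es) σ v ↔
        VertexCondition es (Function.update σ e.2 (next (σ e.2) (σ e.1))) v := by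
  simp only [VertexCondition, nbrList_cons_of_ne h1 h2, lab_update, goal_update, Function.update_of_ne h2]

/-- Induction along the elimination order: `Compatible` is the conjunction of the edge condition,
the final check of the leaf and the immediate check of its parent. The rest of the condition is
passed on in the updated state, and acceptance compares count and guess at the root. -/
theorem exists_runs_iff {es : List (V × V)} {r : V} (he : IsElimination es r) {σ : V → ℕ}
    (hσ : ∀ v, σ v < 250) :
    (∃ q, automaton.acc q = true ∧ automaton.Runs es σ r q) ↔
      (∀ v ∈ elimVerts es r, VertexCondition es σ v) ∧
        ∀ e ∈ es, 2 ≤ goal (σ e.1) + goal (σ e.2) := by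
  induction es generalizing σ with
  | nil =>
    have := seen_le (σ r)
    simp [TreeAutomaton.Runs, elimVerts, VertexCondition, automaton, this]
  | cons e es ih =>
    have h12 := he.fst_ne_snd e (by simp)
    have hn := (next_spec (σ e.2) (σ e.1)).2.2.2.2
    have ih := ih he.tail (σ := Function.update σ e.2 (next (σ e.2) (σ e.1))) fun v => by
      rw [Function.update_apply]; split_ifs <;> simp [hσ, hn]
    simp only [goal_update] at ih
    have e1 : (∃ q, automaton.acc q = true ∧ automaton.Runs (e :: es) σ r q) ↔
        Compatible (σ e.2) (σ e.1) ∧ ∃ q, automaton.acc q = true ∧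
          automaton.Runs es (Function.update σ e.2 (next (σ e.2) (σ e.1))) r q := by
      simp only [TreeAutomaton.Runs, mem_trans]
      constructor
      · rintro ⟨q, hq, x, ⟨-, -, hc, rfl⟩, hx⟩
        exact ⟨hc, q, hq, hx⟩
      · rintro ⟨hc, q, hq, hx⟩
        exact ⟨q, hq, _, ⟨hσ _, hσ _, hc, rfl⟩, hx⟩
    have e2 : (∀ v ∈ elimVerts es r, VertexCondition (e :: es) σ v) ↔
        3 + lab (σ e.2) ≤ goal (σ e.2) + goal (σ e.1) + low (σ e.2) ∧
        ∀ v ∈ elimVerts es r,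
          VertexCondition es (Function.update σ e.2 (next (σ e.2) (σ e.1))) v := by
      have hv : ∀ v ∈ elimVerts es r, v ≠ e.1 := by
        rintro v hv rfl
        exact he.fst_notMem hv
      constructor
      · refine fun h => ⟨((vertexCondition_snd h12 σ).1 (h _ he.snd_mem_elimVerts)).1,
          fun v hve => ?_⟩
        by_cases h2 : v = e.2
        · subst h2
          exact ((vertexCondition_snd h12 σ).1 (h _ hve)).2
        · exact (vertexCondition_of_ne (hv v hve) h2 σ).1 (h v hve)
      · rintro ⟨h1, h⟩ v hve
        by_cases h2 : v = e.2
        · subst h2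
          exact (vertexCondition_snd h12 σ).2 ⟨h1, h _ hve⟩
        · exact (vertexCondition_of_ne (hv v hve) h2 σ).2 (h v hve)
    rw [e1, ih, elimVerts_cons, Finset.forall_mem_insert, e2, vertexCondition_fst he,
      List.forall_mem_cons, Compatible, add_comm (goal (σ e.2)) (goal (σ e.1))]
    tauto

/-! ### Accepting runs and liar's vertex-edge dominating sets -/

open SimpleGraph

variable {T : SimpleGraph V} {es : List (V × V)}

theorem nbrCount_eq_sum (hn : (es.map fun p => s(p.1, p.2)).Nodup)
    (hm : ∀ e, e ∈ T.edgeSet ↔ e ∈ es.map fun p => s(p.1, p.2)) (L : Finset V) (v : V) :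
    T.nbrCount L v = ((nbrList es v).map fun y => if y ∈ L then 1 else 0).sum := by
  have hne : ∀ e ∈ es, e.1 ≠ e.2 := fun e he => T.ne_of_adj (by
    rw [← mem_edgeSet, hm, List.mem_map]
    exact ⟨e, he, rfl⟩)
  rw [← List.sum_toFinset _ (nodup_nbrList hn hne v), ← Finset.card_filter,
    nbrCount, ← Set.ncard_coe_finset]
  congr 1
  ext w
  simp [mem_nbrList, ← hm, mem_edgeSet]

variable {r : V}

/-- Accepting runs of the automaton yield liar's vertex-edge dominating sets. -/
theorem isLiarsVEDominating_of_runs [Fintype V] (hT : T.IsAcyclic)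
    (hn : (es.map fun p => s(p.1, p.2)).Nodup)
    (hm : ∀ e, e ∈ T.edgeSet ↔ e ∈ es.map fun p => s(p.1, p.2)) (he : IsElimination es r)
    (hr : elimVerts es r = Finset.univ) {σ : V → ℕ} (hσ : ∀ v, σ v < 250)
    (hi : ∀ v, automaton.ini (σ v) = true) {q : ℕ} (hq : automaton.acc q = true)
    (h : automaton.Runs es σ r q) :
    T.IsLiarsVEDominating (Finset.univ.filter fun v => lab (σ v) = 1) := by
  obtain ⟨h1, h2⟩ := (exists_runs_iff he hσ).1 ⟨q, hq, h⟩
  have hi : ∀ v, seen (σ v) = 0 ∧ low (σ v) = 4 := fun v => by simpa [automaton] using hi v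
  have hlab : ∀ v, lab (σ v) = if v ∈ Finset.univ.filter fun v => lab (σ v) = 1 then 1 else 0 := by
    intro v
    have := lab_le (σ v)
    simp only [Finset.mem_filter_univ]
    split_ifs <;> omega
  -- Since `seen` starts at 0, the vertex condition forces each guess to equal the true number of
  -- neighbours, cut off at 4. No inequality asks for more than 4, so the cutoff loses nothing.
  have hgoal : ∀ v, goal (σ v) =
      min 4 (T.nbrCount (Finset.univ.filter fun v => lab (σ v) = 1) v) := by
    intro v
    rw [nbrCount_eq_sum hn hm, ← (h1 v (by simp [hr])).1, (hi v).1, zero_add]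
    simp_rw [← hlab]
  rw [hT.isLiarsVEDominating_iff]
  constructor
  · intro x y hxy
    have hx := hgoal x
    have hy := hgoal y
    rw [← mem_edgeSet, hm, List.mem_map] at hxy
    obtain ⟨e, hes, hexy⟩ := hxy
    have := h2 e hes
    rw [Sym2.eq_iff] at hexy
    rcases hexy with ⟨e1, e2⟩ | ⟨e1, e2⟩ <;> rw [e1, e2] at this <;> omega
  · intro x y z hy hz hyz
    rw [← mem_edgeSet, hm, ← mem_nbrList] at hy hz
    have hp := (h1 x (by simp [hr])).2.2
    -- `Pairwise` compares entries in list order; symmetry extends it to any two distinct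
    -- neighbours.
    have : Std.Symm fun y z => 3 + lab (σ x) ≤ goal (σ x) + goal (σ y) + goal (σ z) :=
      ⟨fun a b h => by omega⟩
    have := hp.forall hy hz hyz
    have hx := hgoal x
    have hy := hgoal y
    have hz := hgoal z
    have hl := hlab x
    split_ifs at hl ⊢ <;> omega

/-- Liar's vertex-edge dominating sets yield accepting runs of the automaton. -/
theorem exists_runs_of_isLiarsVEDominating (hT : T.IsAcyclic)
    (hn : (es.map fun p => s(p.1, p.2)).Nodup)
    (hm : ∀ e, e ∈ T.edgeSet ↔ e ∈ es.map fun p => s(p.1, p.2)) (he : IsElimination es r)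
    {L : Finset V} (hL : T.IsLiarsVEDominating L) :
    ∃ (σ : V → ℕ) (q : ℕ), (∀ v, σ v < 250) ∧ (∀ v, automaton.ini (σ v) = true) ∧
      (∀ v, lab (σ v) = if v ∈ L then 1 else 0) ∧
      automaton.acc q = true ∧ automaton.Runs es σ r q := by
  have hne : ∀ e ∈ es, e.1 ≠ e.2 := fun e he => T.ne_of_adj (by
    rw [← mem_edgeSet, hm, List.mem_map]
    exact ⟨e, he, rfl⟩)
  rw [hT.isLiarsVEDominating_iff] at hL
  -- The guesses are the true numbers. Nothing has been seen, and `low` starts at 4 because 3 + 1 ≤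
  -- 4 makes the test of the first neighbour vacuous.
  let σ : V → ℕ := fun v => code (if v ∈ L then 1 else 0) (min 4 (T.nbrCount L v)) 0 4
  have hs : ∀ v, lab (σ v) = (if v ∈ L then 1 else 0) ∧ goal (σ v) = min 4 (T.nbrCount L v) ∧
      seen (σ v) = 0 ∧ low (σ v) = 4 ∧ σ v < 250 := fun v =>
    code_spec (by split_ifs <;> simp) (min_le_left _ _) (by simp) (by simp)
  have hrun : ∃ q, automaton.acc q = true ∧ automaton.Runs es σ r q := by
    rw [exists_runs_iff he fun v => (hs v).2.2.2.2]
    constructor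
    · intro v _
      refine ⟨?_, fun y hy => ?_, ?_⟩
      · rw [(hs v).2.1, (hs v).2.2.1, zero_add, nbrCount_eq_sum hn hm]
        simp_rw [fun y => (hs y).1]
      · rw [mem_nbrList, ← hm, mem_edgeSet] at hy
        have := hL.1 v y hy
        rw [(hs v).1, (hs v).2.1, (hs y).2.1, (hs v).2.2.2.1]
        split_ifs <;> omega
      · refine (nodup_nbrList hn hne v).imp_of_mem fun {y z} hy hz hyz => ?_
        rw [mem_nbrList, ← hm, mem_edgeSet] at hy hz
        have := hL.2 v y z hy hz hyz
        rw [(hs v).1, (hs v).2.1, (hs y).2.1, (hs z).2.1]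
        split_ifs at this ⊢ <;> omega
    · intro e hes
      have : T.Adj e.1 e.2 := by
        rw [← mem_edgeSet, hm, List.mem_map]
        exact ⟨e, hes, rfl⟩
      have := hL.1 _ _ this
      rw [(hs _).2.1, (hs _).2.1]
      omega
  obtain ⟨q, hq, hr⟩ := hrun
  exact ⟨σ, q, fun v => (hs v).2.2.2.2, fun v => by simp [automaton, (hs v).2.2.1, (hs v).2.2.2.1],
    fun v => (hs v).1, hq, hr⟩

end LiarsVE

/-! ### Reasoning about random access machine programs -/

namespace WordRAM

/-- The state with a changed register. -/
def State.set (s : State) (d x : ℕ) : State := { s with reg := Function.update s.reg d x }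

/-- The state with a changed memory cell. -/
def State.put (s : State) (a x : ℕ) : State := { s with mem := Function.update s.mem a x }

@[simp] theorem State.set_mem (s : State) (d x : ℕ) : (s.set d x).mem = s.mem := rfl
@[simp] theorem State.put_reg (s : State) (a x : ℕ) : (s.put a x).reg = s.reg := rfl

@[simp] theorem State.set_reg (s : State) (d x r : ℕ) :
    (s.set d x).reg r = if r = d then x else s.reg r := by
  simp [State.set, Function.update_apply]

theorem State.put_mem (s : State) (a x b : ℕ) :
    (s.put a x).mem b = if b = a then x else s.mem b := by
  simp [State.put, Function.update_apply]

/-- A bound for the running time of a program without loops. -/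
def Program.cost : Program → ℕ
  | .skip => 1
  | .op _ => 1
  | .seq p q => p.cost + q.cost
  | .ite _ p q => 1 + (p.cost + q.cost)
  | .loop _ _ => 0

/-- The weakest precondition of a program without loops. -/
def wp (W : ℕ) : Program → (State → Prop) → State → Prop
  | .skip, Q, s => Q s
  | .op o, Q, s => o.result s ≤ W ∧ Q (o.exec s)
  | .seq p q, Q, s => wp W p (wp W q Q) s
  | .ite b p q, Q, s => (b.Holds s → wp W p Q s) ∧ (¬ b.Holds s → wp W q Q s)
  | .loop _ _, _, _ => False

/-- The program halts within `T` steps in a state that satisfies `Q`. -/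
def Ends (W : ℕ) (p : Program) (s : State) (T : ℕ) (Q : State → Prop) : Prop :=
  ∃ t s', Run W p s t s' ∧ t ≤ T ∧ Q s'

variable {W : ℕ} {Q : State → Prop} {s : State}

/-- The cost of a conditional counts both branches, so it bounds whichever is taken. Loops have a
false precondition and are treated only by `Ends.loop`. -/
theorem Ends.of_wp {p : Program} (h : wp W p Q s) : Ends W p s p.cost Q := by
  induction p generalizing Q s with
  | skip => exact ⟨1, s, .skip s, le_rfl, h⟩
  | op o => exact ⟨1, _, .op o s h.1, le_rfl, h.2⟩
  | seq p q ihp ihq =>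
    obtain ⟨t, s', hr, ht, h⟩ := ihp h
    obtain ⟨t', s'', hr', ht', h⟩ := ihq h
    exact ⟨_, _, .seq hr hr', Nat.add_le_add ht ht', h⟩
  | ite b p q ihp ihq =>
    by_cases hb : b.Holds s
    · obtain ⟨t, s', hr, ht, h⟩ := ihp (h.1 hb)
      exact ⟨_, _, .iteTrue hb hr, by simp only [Program.cost]; omega, h⟩
    · obtain ⟨t, s', hr, ht, h⟩ := ihq (h.2 hb)
      exact ⟨_, _, .iteFalse hb hr, by simp only [Program.cost]; omega, h⟩
  | loop b p => exact h.elim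

theorem Ends.seq {p q : Program} {T T' : ℕ} {R : State → Prop} (h : Ends W p s T R)
    (h' : ∀ s', R s' → Ends W q s' T' Q) : Ends W (.seq p q) s (T + T') Q := by
  obtain ⟨t, s', hr, ht, h⟩ := h
  obtain ⟨t', s'', hr', ht', h⟩ := h' s' h
  exact ⟨_, _, .seq hr hr', Nat.add_le_add ht ht', h⟩

/-- The rule for loops: the invariant is indexed by a bound for the number of iterations. -/
theorem Ends.loop {b : Test} {p : Program} (I : ℕ → State → Prop)
    (h : ∀ m s, I m s → b.Holds s → ∃ m', m = m' + 1 ∧ wp W p (I m') s)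
    {m : ℕ} (hs : I m s) (hQ : ∀ m s, I m s → ¬ b.Holds s → Q s) :
    Ends W (.loop b p) s (1 + m * (1 + p.cost)) Q := by
  induction m generalizing s with
  | zero =>
    have hb : ¬ b.Holds s := fun hb => by
      obtain ⟨m', hm, -⟩ := h 0 s hs hb
      omega
    exact ⟨1, s, .loopFalse hb, by omega, hQ _ _ hs hb⟩
  | succ m ih =>
    by_cases hb : b.Holds s
    · obtain ⟨m', hm, hw⟩ := h _ s hs hb
      obtain rfl : m = m' := by omega
      obtain ⟨t, s', hr, ht, hI⟩ := Ends.of_wp hw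
      obtain ⟨t', s'', hr', ht', hq⟩ := ih hI
      exact ⟨_, _, .loopTrue hb hr hr', by rw [Nat.succ_mul]; omega, hq⟩
    · exact ⟨1, s, .loopFalse hb, by omega, hQ _ _ hs hb⟩

/-! ### Weakest preconditions of instructions and of unrolled lists -/

theorem wp_seq {p q : Program} : wp W (.seq p q) Q s ↔ wp W p (wp W q Q) s := Iff.rfl

theorem wp_const {d k : ℕ} : wp W (.op (.const d k)) Q s ↔ k ≤ W ∧ Q (s.set d k) := Iff.rfl

theorem wp_copy {d a : ℕ} : wp W (.op (.copy d a)) Q s ↔ s.reg a ≤ W ∧ Q (s.set d (s.reg a)) :=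
  Iff.rfl

theorem wp_add {d a b : ℕ} : wp W (.op (.add d a b)) Q s ↔
    s.reg a + s.reg b ≤ W ∧ Q (s.set d (s.reg a + s.reg b)) := Iff.rfl

theorem wp_sub {d a b : ℕ} : wp W (.op (.sub d a b)) Q s ↔
    s.reg a - s.reg b ≤ W ∧ Q (s.set d (s.reg a - s.reg b)) := Iff.rfl

theorem wp_load {d a : ℕ} : wp W (.op (.load d a)) Q s ↔
    s.mem (s.reg a) ≤ W ∧ Q (s.set d (s.mem (s.reg a))) := Iff.rfl

theorem wp_store {a b : ℕ} : wp W (.op (.store a b)) Q s ↔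
    s.reg b ≤ W ∧ Q (s.put (s.reg a) (s.reg b)) := Iff.rfl

theorem wp_ite_lt {a b : ℕ} {p q : Program} : wp W (.ite (.lt a b) p q) Q s ↔
    (s.reg a < s.reg b → wp W p Q s) ∧ (¬ s.reg a < s.reg b → wp W q Q s) := Iff.rfl

theorem wp_ite_eq {a b : ℕ} {p q : Program} : wp W (.ite (.eq a b) p q) Q s ↔
    (s.reg a = s.reg b → wp W p Q s) ∧ (¬ s.reg a = s.reg b → wp W q Q s) := Iff.rfl

theorem wp_mono {p : Program} {Q' : State → Prop} (h : wp W p Q s) (hQ : ∀ s, Q s → Q' s) :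
    wp W p Q' s := by
  induction p generalizing Q Q' s with
  | skip => exact hQ _ h
  | op o => exact ⟨h.1, hQ _ h.2⟩
  | seq p q ihp ihq => exact ihp h fun s hs => ihq hs hQ
  | ite b p q ihp ihq => exact ⟨fun hb => ihp (h.1 hb) hQ, fun hb => ihq (h.2 hb) hQ⟩
  | loop b p => exact h

/-- The sequential composition of the programs `f a` for `a` in a list. -/
def forList {α : Type*} (f : α → Program) : List α → Program
  | [] => .skip
  | a :: l => .seq (f a) (forList f l)

theorem wp_forList_aux {α : Type*} {f : α → Program} (I : List α → State → Prop) (l : List α) :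
    ∀ (pre suf : List α) (s : State), pre ++ suf = l → I pre s →
      (∀ pre a suf s, pre ++ a :: suf = l → I pre s → wp W (f a) (I (pre ++ [a])) s) →
      wp W (forList f suf) (I l) s := by
  intro pre suf
  induction suf generalizing pre with
  | nil =>
    intro s hl h _
    rw [List.append_nil] at hl
    exact hl ▸ h
  | cons a suf ih =>
    intro s hl h hf
    rw [forList, wp_seq]
    exact wp_mono (hf pre a suf s hl h) fun s' hs' => ih (pre ++ [a]) s' (by simpa) hs' hf

/-- The rule for `forList`: the invariant is indexed by the processed part of the list. -/
theorem wp_forList {α : Type*} {f : α → Program} {l : List α} (I : List α → State → Prop)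
    (h0 : I [] s) (hf : ∀ pre a s, a ∈ l → I pre s → wp W (f a) (I (pre ++ [a])) s)
    (hQ : ∀ s, I l s → Q s) : wp W (forList f l) Q s :=
  wp_mono (wp_forList_aux I l [] l s rfl h0 fun pre a suf s hl => hf pre a s (hl ▸ by simp)) hQ

/-- This version lets the invariant use that the current entry has not been treated before; saving a
table needs it, because each cell is overwritten right after it has been read. -/
theorem wp_forList_nodup {α : Type*} {f : α → Program} {l : List α} (hl : l.Nodup)
    (I : List α → State → Prop) (h0 : I [] s)
    (hf : ∀ pre a s, a ∈ l → a ∉ pre → I pre s → wp W (f a) (I (pre ++ [a])) s)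
    (hQ : ∀ s, I l s → Q s) : wp W (forList f l) Q s := by
  refine wp_mono (wp_forList_aux I l [] l s rfl h0 fun pre a suf s hs => ?_) hQ
  subst hs
  refine hf pre a s (by simp) fun ha => ?_
  exact (List.nodup_append.1 hl).2.2 a ha a (by simp) rfl

/-! ### Arrays

The memory is divided into arrays of length `n`: entry `v` of array `j` is in cell `j * n + v`.
Register `20 + j` holds the address of array `j`, register `0` holds `n`, register `1` holds `1`,
register `2` holds `n + 1`, and register `8` is used to compute addresses. -/

structure Layout (n K : ℕ) (s : State) : Prop where
  size : s.reg 0 = n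
  one : s.reg 1 = 1
  inf : s.reg 2 = n + 1
  base : ∀ j < K, s.reg (20 + j) = j * n

theorem Layout.set {n K d : ℕ} (h : Layout n K s) (h3 : 3 ≤ d) (h20 : d < 20) (x : ℕ) :
    Layout n K (s.set d x) where
  size := by rw [State.set_reg, if_neg (by omega), h.size]
  one := by rw [State.set_reg, if_neg (by omega), h.one]
  inf := by rw [State.set_reg, if_neg (by omega), h.inf]
  base j hj := by rw [State.set_reg, if_neg (by omega), h.base j hj]

theorem Layout.put {n K : ℕ} (h : Layout n K s) (a x : ℕ) : Layout n K (s.put a x) :=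
  ⟨h.size, h.one, h.inf, h.base⟩

/-- `d := A j [v]` -/
def ld (d j v : ℕ) : Program := .seq (.op (.add 8 (20 + j) v)) (.op (.load d 8))

/-- `A j [v] := a` -/
def st (j v a : ℕ) : Program := .seq (.op (.add 8 (20 + j) v)) (.op (.store 8 a))

theorem address_le {n K j : ℕ} (hj : j < K) (hW : K * n ≤ W) (x : Fin n) : j * n + x ≤ W := by
  have h1 : (j + 1) * n ≤ K * n := Nat.mul_le_mul_right _ hj
  rw [Nat.succ_mul] at h1
  have := x.isLt
  omega

theorem wp_ld {n K d j v : ℕ} (hL : Layout n K s) (hj : j < K) (hW : K * n ≤ W) {x : Fin n}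
    (hv : s.reg v = x) (hx : s.mem (j * n + x) ≤ W)
    (hQ : Q ((s.set 8 (j * n + x)).set d (s.mem (j * n + x)))) : wp W (ld d j v) Q s := by
  have e : s.reg (20 + j) + s.reg v = j * n + x := by rw [hL.base j hj, hv]
  rw [ld, wp_seq, wp_add, wp_load, e]
  refine ⟨address_le hj hW x, ?_, ?_⟩
  · simpa using hx
  · simpa using hQ

theorem wp_st {n K j v a : ℕ} (hL : Layout n K s) (hj : j < K) (hW : K * n ≤ W) {x : Fin n}
    (hv : s.reg v = x) (ha : a ≠ 8) (hx : s.reg a ≤ W)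
    (hQ : Q ((s.set 8 (j * n + x)).put (j * n + x) (s.reg a))) : wp W (st j v a) Q s := by
  have e : s.reg (20 + j) + s.reg v = j * n + x := by rw [hL.base j hj, hv]
  rw [st, wp_seq, wp_add, wp_store, e]
  refine ⟨address_le hj hW x, ?_, ?_⟩
  · simpa [ha] using hx
  · simpa [ha] using hQ

/-- Uniqueness of quotient and remainder modulo `n`: entries of different arrays never share a cell.
-/
theorem address_inj {n i j : ℕ} {u v : Fin n} : i * n + u = j * n + v ↔ i = j ∧ u = v := by
  have hn : 0 < n := u.pos
  constructor
  · intro h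
    have h1 := congrArg (· / n) h
    simp only [Nat.mul_comm _ n, Nat.mul_add_div hn, Nat.div_eq_of_lt u.isLt,
      Nat.div_eq_of_lt v.isLt, Nat.add_zero] at h1
    subst h1
    exact ⟨rfl, Fin.ext (by omega)⟩
  · rintro ⟨rfl, rfl⟩
    rfl

theorem State.put_mem_address (s : State) {n : ℕ} (i j x : ℕ) (u v : Fin n) :
    (s.put (j * n + v) x).mem (i * n + u) = if i = j ∧ u = v then x else s.mem (i * n + u) := by
  rw [State.put_mem]
  simp only [address_inj]

/-! ### The start of the computation -/

/-- Computation of the addresses of the arrays. -/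
def bases : ℕ → Program
  | 0 => .skip
  | j + 1 => .seq (bases j) (.op (.add (20 + (j + 1)) (20 + j) 0))

theorem wp_bases {n K : ℕ} (hn : s.reg 0 = n) (h0 : s.reg 20 = 0) (hW : K * n ≤ W)
    (hQ : ∀ s', s'.mem = s.mem → (∀ r < 20, s'.reg r = s.reg r) →
      (∀ j ≤ K, s'.reg (20 + j) = j * n) → Q s') : wp W (bases K) Q s := by
  induction K generalizing Q with
  | zero =>
    refine hQ s rfl (fun _ _ => rfl) fun j hj => ?_
    obtain rfl : j = 0 := by omega
    simpa using h0
  | succ K ih =>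
    rw [Nat.succ_mul] at hW
    refine ih (by omega) fun s' hm hr hb => ?_
    have e : s'.reg (20 + K) + s'.reg 0 = (K + 1) * n := by
      rw [hb K le_rfl, hr 0 (by omega), hn, Nat.succ_mul]
    rw [wp_add, e]
    refine ⟨by rw [Nat.succ_mul]; omega, hQ _ hm (fun r hr' => ?_) fun j hj => ?_⟩
    · rw [State.set_reg, if_neg (by omega), hr r hr']
    · rw [State.set_reg]
      split_ifs with hjK
      · obtain rfl : j = K + 1 := by omega
        rfl
      · exact hb j (by omega)

/-- The program that sets up the registers. -/
def setup (K : ℕ) : Program :=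
  .seq (.op (.load 0 0)) (.seq (.op (.const 1 1)) (.seq (.op (.add 2 0 1))
    (.seq (.op (.load 4 1)) (bases K))))

theorem wp_setup {n K m : ℕ} (hr : ∀ r, s.reg r = 0) (h0 : s.mem 0 = n) (h1 : s.mem 1 = m)
    (hW : K * n ≤ W) (hn : n + 1 ≤ W) (hm : m ≤ W)
    (hQ : ∀ s', s'.mem = s.mem → Layout n K s' → s'.reg 4 = m → Q s') :
    wp W (setup K) Q s := by
  simp only [setup, wp_seq, wp_load, wp_const, wp_add, State.set_reg, State.set_mem, hr]
  norm_num [h0, h1]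
  refine ⟨by omega, by omega, hn, hm, wp_bases (n := n) (by simp) (by simp [hr]) hW ?_⟩
  intro s' hm' hr' hb
  refine hQ s' (by simpa using hm') ⟨?_, ?_, ?_, fun j hj => hb j hj.le⟩ ?_
  all_goals rw [hr' _ (by norm_num)]; simp

end WordRAM

/-! ### Degrees and sums of neighbours -/

section NeighbourList

variable {V : Type*} [DecidableEq V]

theorem nbrList_append (es fs : List (V × V)) (v : V) :
    nbrList (es ++ fs) v = nbrList es v ++ nbrList fs v := by
  simp [nbrList]

theorem length_nbrList_le (es : List (V × V)) (v : V) :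
    (nbrList es v).length ≤ 2 * es.length := by
  induction es with
  | nil => simp
  | cons e es ih =>
    rw [nbrList_cons, List.length_append, List.length_append, List.length_cons]
    split_ifs <;> simp <;> omega

theorem sum_nbrList_le {n : ℕ} (es : List (Fin n × Fin n)) (v : Fin n) :
    ((nbrList es v).map Fin.val).sum ≤ 2 * es.length * n := by
  refine (List.sum_le_card_nsmul _ n fun x hx => ?_).trans ?_
  · obtain ⟨y, -, rfl⟩ := List.mem_map.1 hx
    exact y.isLt.le
  · rw [List.length_map, smul_eq_mul]
    exact Nat.mul_le_mul_right _ (length_nbrList_le es v)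

end NeighbourList

namespace WordRAM

variable {W : ℕ} {Q : State → Prop} {s : State} {n K : ℕ}

/-- `A j [v] := A j [v] + a` -/
def addTo (j v a : ℕ) : Program := .seq (ld 9 j v) (.seq (.op (.add 9 9 a)) (st j v 9))

/-- `A j [v] := A j [v] - a` -/
def subFrom (j v a : ℕ) : Program := .seq (ld 9 j v) (.seq (.op (.sub 9 9 a)) (st j v 9))

theorem wp_addTo {j v a : ℕ} (hL : Layout n K s) (hj : j < K) (hW : K * n ≤ W) {x : Fin n}
    (hv : s.reg v = x) (hv8 : v ≠ 8) (hv9 : v ≠ 9) (ha8 : a ≠ 8) (ha9 : a ≠ 9)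
    (hx : s.mem (j * n + x) + s.reg a ≤ W)
    (hQ : ∀ s', Layout n K s' → (∀ r, r ≠ 8 → r ≠ 9 → s'.reg r = s.reg r) →
      s'.mem = (s.put (j * n + x) (s.mem (j * n + x) + s.reg a)).mem → Q s') :
    wp W (addTo j v a) Q s := by
  have h1 := (hL.set (d := 8) (by norm_num) (by norm_num) (j * n + x)).set (d := 9) (by norm_num)
    (by norm_num) (s.mem (j * n + x))
  refine wp_ld hL hj hW hv (by omega) ?_
  rw [wp_seq, wp_add]
  simp only [State.set_reg, if_neg ha8, if_neg ha9, if_true]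
  have h2 := h1.set (d := 9) (by norm_num) (by norm_num) (s.mem (j * n + x) + s.reg a)
  refine ⟨hx, wp_st h2 hj hW (x := x) (by simp [hv8, hv9, hv]) (by norm_num) (by simpa using hx)
    (hQ _ ?_ ?_ ?_)⟩
  · exact (h2.set (by norm_num) (by norm_num) _).put _ _
  · intro r h8 h9
    simp [h8, h9]
  · simp [State.put]

theorem wp_subFrom {j v a : ℕ} (hL : Layout n K s) (hj : j < K) (hW : K * n ≤ W) {x : Fin n}
    (hv : s.reg v = x) (hv8 : v ≠ 8) (hv9 : v ≠ 9) (ha8 : a ≠ 8) (ha9 : a ≠ 9)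
    (hx : s.mem (j * n + x) ≤ W)
    (hQ : ∀ s', Layout n K s' → (∀ r, r ≠ 8 → r ≠ 9 → s'.reg r = s.reg r) →
      s'.mem = (s.put (j * n + x) (s.mem (j * n + x) - s.reg a)).mem → Q s') :
    wp W (subFrom j v a) Q s := by
  have h1 := (hL.set (d := 8) (by norm_num) (by norm_num) (j * n + x)).set (d := 9) (by norm_num)
    (by norm_num) (s.mem (j * n + x))
  refine wp_ld hL hj hW hv (by omega) ?_
  rw [wp_seq, wp_sub]
  simp only [State.set_reg, if_neg ha8, if_neg ha9, if_true]
  have h2 := h1.set (d := 9) (by norm_num) (by norm_num) (s.mem (j * n + x) - s.reg a)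
  refine ⟨by omega, wp_st h2 hj hW (x := x) (by simp [hv8, hv9, hv]) (by norm_num)
    (by simp; omega) (hQ _ ?_ ?_ ?_)⟩
  · exact (h2.set (by norm_num) (by norm_num) _).put _ _
  · intro r h8 h9
    simp [h8, h9]
  · simp [State.put]

theorem graphInput_length (l : List (Fin n × Fin n)) :
    (graphInput l).length = 2 + 2 * l.length := by
  simp [graphInput, List.length_flatMap]
  omega

theorem graphInput_getD (pre suf : List (Fin n × Fin n)) (e : Fin n × Fin n) :
    (graphInput (pre ++ e :: suf)).getD (2 + 2 * pre.length) 0 = e.1 ∧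
      (graphInput (pre ++ e :: suf)).getD (2 + 2 * pre.length + 1) 0 = e.2 := by
  have h : (pre.flatMap fun p => [(p.1 : ℕ), (p.2 : ℕ)]).length = 2 * pre.length := by
    simp [List.length_flatMap]
    omega
  have e1 : 2 + 2 * pre.length = 2 * pre.length + 1 + 1 := by omega
  have e2 : 2 + 2 * pre.length + 1 = 2 * pre.length + 1 + 1 + 1 := by omega
  rw [e2, e1, graphInput, List.getD_cons_succ, List.getD_cons_succ, List.getD_cons_succ,
    List.getD_cons_succ, List.flatMap_append, List.getD_append_right _ _ _ _ h.le,
    List.getD_append_right _ _ _ _ (by omega), h]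
  simp

/-- Reading an edge. -/
def readEdge : Program :=
  .seq (.op (.load 5 3)) (.seq (.op (.add 3 3 1)) (.seq (.op (.load 6 3))
    (.seq (.op (.add 3 3 1)) (.seq (.op (.sub 4 4 1)) (.seq (addTo 2 5 1) (.seq (addTo 3 5 6)
      (.seq (addTo 2 6 1) (addTo 3 6 5))))))))

/-- Reading the edges: array `2` receives the degrees, array `3` the sums of the neighbours. -/
def readEdges : Program :=
  .seq (.op (.const 15 0)) (.seq (.op (.const 3 2)) (.loop (.lt 15 4) readEdge))

/-- The state after the edges in `pre` have been read and while those in `suf` remain. -/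
structure ReadInv (n K : ℕ) (l pre suf : List (Fin n × Fin n)) (s : State) : Prop where
  layout : Layout n K s
  split : pre ++ suf = l
  zero : s.reg 15 = 0
  count : s.reg 4 = suf.length
  pos : s.reg 3 = 2 + 2 * pre.length
  input : ∀ i < 2 * n, s.mem i = (graphInput l).getD i 0
  deg : ∀ u : Fin n, s.mem (2 * n + u) = (nbrList pre u).length
  sum : ∀ u : Fin n, s.mem (3 * n + u) = ((nbrList pre u).map Fin.val).sum

theorem Ends.const_seq {d k T : ℕ} {p : Program} (hk : k ≤ W) (h : Ends W p (s.set d k) T Q) :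
    Ends W (.seq (.op (.const d k)) p) s (1 + T) Q := by
  obtain ⟨t, s', hr, ht, h⟩ := h
  exact ⟨_, _, .seq (.op _ s hk) hr, by omega, h⟩

/-- One bound on the word size covers all needs: addresses below `K * n`, the infinite cost `n + 1`,
degrees, positions in the input, and sums of neighbours of order `n ^ 2`. -/
theorem le_of_bound (hW : (K + 2) * (n + 1) ^ 2 ≤ W) :
    K * n ≤ W ∧ n + 1 ≤ W ∧ 2 * n + 2 ≤ W ∧ 2 * n * n ≤ W ∧ 2 ≤ W := by
  have h1 : (K + 2) * (n + 1) ^ 2 = K * n + (K * n * n + K * n + K) + 2 * n * n + (4 * n + 2) := by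
    ring
  omega

/-- Both ends of the edge receive a new neighbour. Only arrays `2` and `3` are written, and they lie
beyond the cells below `2 * n` that hold the input. -/
theorem wp_readEdge (hK : 4 ≤ K) (hW : (K + 2) * (n + 1) ^ 2 ≤ W)
    {l pre suf : List (Fin n × Fin n)} {e : Fin n × Fin n} (hl : l.length + 1 = n)
    (h : ReadInv n K l pre (e :: suf) s) :
    wp W readEdge (ReadInv n K l (pre ++ [e]) suf) s := by
  obtain ⟨hWK, hW1, hW2, hW3, -⟩ := le_of_bound hW
  obtain ⟨e1, e2⟩ := graphInput_getD pre suf e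
  have hlen : pre.length + suf.length + 1 = l.length := by
    simp [← h.split]; omega
  rw [h.split] at e1 e2
  rw [← h.input _ (by omega), ← h.pos] at e1
  rw [← h.input _ (by omega), ← h.pos] at e2
  obtain ⟨a, b⟩ := e
  simp only at e1 e2
  have ha := a.isLt
  have hb := b.isLt
  have h3 := h.pos
  have h1 := h.layout.one
  have h4 : s.reg 4 = suf.length + 1 := by rw [h.count, List.length_cons]
  simp only [readEdge, wp_seq, wp_load, wp_add, wp_sub, State.set_reg, State.set_mem]
  norm_num only [h1, e1, e2, if_true, if_false]
  refine ⟨by omega, by omega, by omega, by omega, by omega, ?_⟩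
  have hdeg : ∀ u, (nbrList pre u).length + 2 ≤ W := fun u => by
    have := length_nbrList_le pre u; omega
  -- The extra `2 * n` leaves room for the additions caused by the edge being read.
  have hsum : ∀ u, ((nbrList pre u).map Fin.val).sum + 2 * n ≤ W := fun u => by
    have := sum_nbrList_le pre u
    have h5 : 2 * (pre.length + 1) * n ≤ 2 * n * n :=
      Nat.mul_le_mul_right _ (by omega)
    have h6 : 2 * (pre.length + 1) * n = 2 * pre.length * n + 2 * n := by ring
    omega
  set s0 : State := ((((s.set 5 a).set 3 (s.reg 3 + 1)).set 6 b).set 3 (s.reg 3 + 1 + 1)).set 4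
    (s.reg 4 - 1) with hs0
  have hL0 : Layout n K s0 := by
    rw [hs0]
    iterate 5 refine Layout.set ?_ (by norm_num) (by norm_num) _
    exact h.layout
  have r5 : s0.reg 5 = a := by simp [hs0]
  have r6 : s0.reg 6 = b := by simp [hs0]
  have r1 : s0.reg 1 = 1 := hL0.one
  have hm0 : s0.mem = s.mem := by simp [hs0]
  refine wp_addTo hL0 (by omega) hWK r5 (by norm_num) (by norm_num) (by norm_num) (by norm_num)
    (by rw [hm0, h.deg, r1]; have := hdeg a; omega) ?_
  intro s1 hL1 hr1 hm1i
  have hm1 : ∀ j (u : Fin n), s1.mem (j * n + u) =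
      if j = 2 ∧ u = a then (nbrList pre a).length + 1 else s.mem (j * n + u) := fun j u => by
    rw [hm1i, State.put_mem_address, r1, hm0, h.deg]
  have hm1' : ∀ i < 2 * n, s1.mem i = s.mem i := fun i hi => by
    rw [hm1i, State.put_mem, if_neg (by omega), hm0]
  refine wp_addTo hL1 (by omega) hWK (x := a) (by rw [hr1 5 (by norm_num) (by norm_num), r5])
    (by norm_num) (by norm_num) (by norm_num) (by norm_num)
    (by rw [hm1, hr1 6 (by norm_num) (by norm_num), r6]; simp [h.sum]; have := hsum a; omega) ?_
  intro s2 hL2 hr2 hm2i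
  have hm2 : ∀ j (u : Fin n), s2.mem (j * n + u) =
      if j = 3 ∧ u = a then s.mem (3 * n + a) + b else s1.mem (j * n + u) := fun j u => by
    rw [hm2i, State.put_mem_address, hr1 6 (by norm_num) (by norm_num), r6, hm1 3]
    simp
  have hm2' : ∀ i < 2 * n, s2.mem i = s.mem i := fun i hi => by
    rw [hm2i, State.put_mem, if_neg (by omega), hm1' i hi]
  replace hr2 : ∀ r, r ≠ 8 → r ≠ 9 → s2.reg r = s0.reg r := fun r h8 h9 => by
    rw [hr2 r h8 h9, hr1 r h8 h9]
  refine wp_addTo hL2 (by omega) hWK (x := b) (by rw [hr2 6 (by norm_num) (by norm_num), r6])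
    (by norm_num) (by norm_num) (by norm_num) (by norm_num)
    (by
      rw [hm2, hm1, hr2 1 (by norm_num) (by norm_num), r1]
      have := hdeg a
      have := hdeg b
      simp only [h.deg]
      split_ifs <;> omega) ?_
  intro s3 hL3 hr3 hm3i
  have hm3 : ∀ j (u : Fin n), s3.mem (j * n + u) =
      if j = 2 ∧ u = b then s2.mem (2 * n + b) + 1 else s2.mem (j * n + u) := fun j u => by
    rw [hm3i, State.put_mem_address, hr2 1 (by norm_num) (by norm_num), r1]
  have hm3' : ∀ i < 2 * n, s3.mem i = s.mem i := fun i hi => by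
    rw [hm3i, State.put_mem, if_neg (by omega), hm2' i hi]
  replace hr3 : ∀ r, r ≠ 8 → r ≠ 9 → s3.reg r = s0.reg r := fun r h8 h9 => by
    rw [hr3 r h8 h9, hr2 r h8 h9]
  refine wp_addTo hL3 (by omega) hWK (x := b) (by rw [hr3 6 (by norm_num) (by norm_num), r6])
    (by norm_num) (by norm_num) (by norm_num) (by norm_num)
    (by
      rw [hr3 5 (by norm_num) (by norm_num), r5]
      have := hsum a
      have := hsum b
      simp only [hm3, hm2, hm1, h.sum]
      split_ifs <;> omega) ?_
  intro s4 hL4 hr4 hm4i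
  have hm4 : ∀ j (u : Fin n), s4.mem (j * n + u) =
      if j = 3 ∧ u = b then s3.mem (3 * n + b) + a else s3.mem (j * n + u) := fun j u => by
    rw [hm4i, State.put_mem_address, hr3 5 (by norm_num) (by norm_num), r5]
  have hm4' : ∀ i < 2 * n, s4.mem i = s.mem i := fun i hi => by
    rw [hm4i, State.put_mem, if_neg (by omega), hm3' i hi]
  replace hr4 : ∀ r, r ≠ 8 → r ≠ 9 → s4.reg r = s0.reg r := fun r h8 h9 => by
    rw [hr4 r h8 h9, hr3 r h8 h9]
  exact
  { layout := hL4
    split := by simp [← h.split]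
    zero := by rw [hr4 15 (by norm_num) (by norm_num)]; simp [hs0, h.zero]
    count := by rw [hr4 4 (by norm_num) (by norm_num)]; simp [hs0, h4]
    pos := by
      rw [hr4 3 (by norm_num) (by norm_num)]
      simp [hs0, h3]
      omega
    input := fun i hi => by rw [hm4' i hi, h.input i hi]
    deg := fun u => by
      simp only [hm4, hm3, hm2, hm1, h.deg, nbrList_append, List.length_append, nbrList_cons,
        nbrList_nil]
      grind
    sum := fun u => by
      simp only [hm4, hm3, hm2, hm1, h.sum, nbrList_append, List.map_append, List.sum_append,
        nbrList_cons, nbrList_nil]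
      grind }

theorem ends_readEdges (hK : 4 ≤ K) (hW : (K + 2) * (n + 1) ^ 2 ≤ W)
    (l : List (Fin n × Fin n)) (hl : l.length + 1 = n) (hL : Layout n K s)
    (h4 : s.reg 4 = l.length) (hm : s.mem = (initState (graphInput l)).mem) :
    Ends W readEdges s (1 + (1 + (1 + l.length * (1 + readEdge.cost))))
      fun s' => Layout n K s' ∧
        (∀ u : Fin n, s'.mem (2 * n + u) = (nbrList l u).length) ∧
        (∀ u : Fin n, s'.mem (3 * n + u) = ((nbrList l u).map Fin.val).sum) := by
  obtain ⟨-, -, -, -, hW2⟩ := le_of_bound hW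
  -- A tree has `n - 1` edges, so the input occupies 2 + 2(n - 1) = 2n cells, exactly arrays `0` and
  -- `1`. The counters in arrays `2` and `3` therefore start at zero.
  have hz : ∀ i, 2 * n ≤ i → s.mem i = 0 := by
    intro i hi
    rw [hm]
    exact List.getD_eq_default _ _ (by rw [graphInput_length]; omega)
  refine Ends.const_seq (by omega) (Ends.const_seq hW2 ?_)
  refine Ends.loop (fun m s => ∃ pre suf, suf.length = m ∧ ReadInv n K l pre suf s) ?_
    ⟨[], l, rfl, ?_⟩ ?_
  · rintro m s ⟨pre, suf, hm, hI⟩ hb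
    rw [Test.Holds, hI.zero, hI.count] at hb
    obtain ⟨e, suf, rfl⟩ := List.exists_cons_of_length_pos hb
    exact ⟨suf.length, by simp [← hm], wp_mono (wp_readEdge hK hW hl hI)
      fun s hs => ⟨_, _, rfl, hs⟩⟩
  · exact
    { layout := (hL.set (by norm_num) (by norm_num) _).set (by norm_num) (by norm_num) _
      split := rfl
      zero := by simp
      count := by simp [h4]
      pos := by simp
      input := fun i _ => by simp [hm, initState]
      deg := fun u => by simp [hz]
      sum := fun u => by simp [hz _ (show 2 * n ≤ 3 * n + u by omega)] }
  · rintro m s ⟨pre, suf, -, hI⟩ hb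
    rw [Test.Holds, hI.zero, hI.count, List.length_pos_iff, not_not] at hb
    have := hI.split
    subst hb
    rw [List.append_nil] at this
    subst this
    exact ⟨hI.layout, hI.deg, hI.sum⟩

end WordRAM

/-! ### Removing leaves -/

namespace SimpleGraph

variable {n : ℕ}

open Classical in
/-- The neighbours of a vertex. -/
noncomputable def nbrs (H : SimpleGraph (Fin n)) (u : Fin n) : Finset (Fin n) :=
  Finset.univ.filter (H.Adj u)

@[simp]
theorem mem_nbrs {H : SimpleGraph (Fin n)} {u w : Fin n} : w ∈ H.nbrs u ↔ H.Adj u w := by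
  simp [nbrs]

theorem card_nbrs_le (H : SimpleGraph (Fin n)) (u : Fin n) : (H.nbrs u).card ≤ n := by
  simpa using (H.nbrs u).card_le_univ

theorem sum_nbrs_le (H : SimpleGraph (Fin n)) (u : Fin n) :
    ∑ w ∈ H.nbrs u, (w : ℕ) ≤ n * n := by
  refine (Finset.sum_le_card_nsmul _ _ n fun w _ => w.isLt.le).trans ?_
  rw [smul_eq_mul]
  exact Nat.mul_le_mul_right _ (H.card_nbrs_le u)

/-- The graph `H` is obtained from `T` by the removal of the leaves in `es`; the last of them was
removed from `r`. -/
structure Peeling (T H : SimpleGraph (Fin n)) (es : List (Fin n × Fin n)) (r : Fin n) : Prop where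
  nodup : (es.map fun p => s(p.1, p.2)).Nodup
  edges : ∀ e, e ∈ T.edgeSet ↔ e ∈ H.edgeSet ∨ e ∈ es.map fun p => s(p.1, p.2)
  disjoint : ∀ e ∈ es.map fun p => s(p.1, p.2), e ∉ H.edgeSet
  pairwise : es.Pairwise fun e f => e.1 ≠ f.1 ∧ e.1 ≠ f.2
  fst_ne_snd : ∀ e ∈ es, e.1 ≠ e.2
  fst_ne_root : ∀ e ∈ es, e.1 ≠ r
  isolated : ∀ e ∈ es, ∀ w, ¬ H.Adj e.1 w

variable {T H : SimpleGraph (Fin n)} {es : List (Fin n × Fin n)} {r c p : Fin n}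

theorem Peeling.refl (T : SimpleGraph (Fin n)) (r : Fin n) : Peeling T T [] r := by
  constructor <;> simp

theorem Peeling.nodup_verts (h : Peeling T H es r) : (r :: es.map Prod.fst).Nodup := by
  rw [List.nodup_cons]
  constructor
  · intro hr
    obtain ⟨e, he, her⟩ := List.mem_map.1 hr
    exact h.fst_ne_root e he her
  · exact List.pairwise_map.2 (h.pairwise.imp fun h => h.1)

/-- The removed leaves and the root are distinct vertices. Hence the record of the removals fits
into arrays of length `n`. -/
theorem Peeling.length_lt (h : Peeling T H es r) : es.length < n := by
  simpa using h.nodup_verts.length_le_card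

theorem deleteEdge_adj {u w : Fin n} : (H.deleteEdges {s(c, p)}).Adj u w ↔
    H.Adj u w ∧ ¬ (u = c ∧ w = p ∨ u = p ∧ w = c) := by
  simp [deleteEdges_adj]

/-- Leaves removed earlier are isolated in `H`, while `c` and `p` are adjacent there. So no earlier
leaf equals `c` or `p`, which gives both the order condition and the admissibility of `p` as the new
root. -/
theorem Peeling.step (h : Peeling T H es r) (hc : H.nbrs c = {p}) :
    Peeling T (H.deleteEdges {s(c, p)}) (es ++ [(c, p)]) p := by
  have hcp : ∀ w, H.Adj c w ↔ w = p := fun w => by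
    rw [← mem_nbrs, hc, Finset.mem_singleton]
  have hadj : H.Adj c p := (hcp p).2 rfl
  have hiso : ∀ e ∈ es, e.1 ≠ c ∧ e.1 ≠ p := fun e he =>
    ⟨fun h1 => h.isolated e he p (h1 ▸ hadj), fun h1 => h.isolated e he c (h1 ▸ hadj.symm)⟩
  constructor
  · rw [List.map_append, List.nodup_append]
    refine ⟨h.nodup, by simp, fun a ha b hb hab => h.disjoint a ha ?_⟩
    simp only [List.map_cons, List.map_nil, List.mem_singleton] at hb
    rw [hab, hb]
    exact hadj
  · intro e
    rw [h.edges, List.map_append, List.mem_append, edgeSet_deleteEdges, Set.mem_sdiff]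
    simp only [List.map_cons, List.map_nil, List.mem_singleton, Set.mem_singleton_iff]
    constructor
    · rintro (he | he)
      · by_cases hec : e = s(c, p)
        · exact .inr (.inr hec)
        · exact .inl ⟨he, hec⟩
      · exact .inr (.inl he)
    · rintro (he | he | rfl)
      · exact .inl he.1
      · exact .inr he
      · exact .inl hadj
  · intro e he
    rw [edgeSet_deleteEdges, Set.mem_sdiff]
    rintro ⟨h1, h2⟩
    rw [List.map_append, List.mem_append] at he
    rcases he with he | he
    · exact h.disjoint e he h1
    · exact h2 (by simpa using he)
  · rw [List.pairwise_append]
    exact ⟨h.pairwise, by simp, fun e he f hf => by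
      rw [List.mem_singleton] at hf
      subst hf
      exact hiso e he⟩
  · intro e he
    rcases List.mem_append.1 he with he | he
    · exact h.fst_ne_snd e he
    · rw [List.mem_singleton] at he
      subst he
      exact hadj.ne
  · intro e he
    rcases List.mem_append.1 he with he | he
    · exact (hiso e he).2
    · rw [List.mem_singleton] at he
      subst he
      exact hadj.ne
  · intro e he w
    rw [deleteEdge_adj]
    rintro ⟨h1, h2⟩
    rcases List.mem_append.1 he with he | he
    · exact h.isolated e he w h1
    · rw [List.mem_singleton] at he
      subst he
      exact h2 (.inl ⟨rfl, (hcp w).1 h1⟩)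

theorem nbrs_step (hc : H.nbrs c = {p}) (u : Fin n) : (H.deleteEdges {s(c, p)}).nbrs u =
    if u = c then ∅ else if u = p then (H.nbrs p).erase c else H.nbrs u := by
  have hcp : ∀ w, H.Adj c w ↔ w = p := fun w => by
    rw [← mem_nbrs, hc, Finset.mem_singleton]
  have hne := ((hcp p).2 rfl).ne
  ext w
  rw [mem_nbrs, deleteEdge_adj]
  split_ifs with h1 h2
  · subst h1
    simp [hcp, hne]
  · subst h2
    simp [hne.symm, and_comm]
  · simp [h1, h2]

theorem _root_.WordRAM.length_of_isEdgeList {T : SimpleGraph (Fin n)} (hT : T.IsTree) {l : List (Fin n × Fin n)}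
    (hl : WordRAM.IsEdgeList T l) : l.length + 1 = n := by
  classical
  have h1 := hT.card_edgeFinset
  have h2 : T.edgeFinset = (l.map fun p => s(p.1, p.2)).toFinset := by
    ext e
    rw [mem_edgeFinset, hl.2 e, List.mem_toFinset]
  rw [h2, List.toFinset_card_of_nodup hl.1, List.length_map, Fintype.card_fin] at h1
  exact h1

/-- If the graph is acyclic and no leaf remains, then everything has been removed. -/
theorem Peeling.isElimination (hT : T.IsTree) (h : Peeling T H es r)
    (hleaf : ∀ u, (H.nbrs u).card ≠ 1) :
    WordRAM.IsEdgeList T es ∧ IsElimination es r ∧ elimVerts es r = Finset.univ := by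
  have hle : H ≤ T := by
    rw [← edgeSet_subset_edgeSet]
    exact fun e he => (h.edges e).2 (.inl he)
  have hbot : ∀ e, e ∉ H.edgeSet := by
    intro e
    induction e with | _ a b =>
    intro hab
    obtain ⟨u, w, hw, huniq⟩ := (hT.isAcyclic.anti hle).exists_existsUnique_adj hab
    refine hleaf u (Finset.card_eq_one.2 ⟨w, ?_⟩)
    ext x
    rw [mem_nbrs, Finset.mem_singleton]
    exact ⟨huniq x, fun hx => hx ▸ hw⟩
  have hlist : WordRAM.IsEdgeList T es := ⟨h.nodup, fun e => by rw [h.edges]; simp [hbot e]⟩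
  have hlen := WordRAM.length_of_isEdgeList hT hlist
  -- The `n - 1` distinct leaves together with the root exhaust the `n` vertices; hence every parent
  -- is the root or is itself in the list of leaves.
  have huniv : elimVerts es r = Finset.univ := by
    rw [← Finset.card_eq_iff_eq_univ, elimVerts, ← List.toFinset_cons,
      List.toFinset_card_of_nodup h.nodup_verts, List.length_cons, List.length_map, hlen,
      Fintype.card_fin]
  refine ⟨hlist, ⟨h.pairwise, h.fst_ne_snd, h.fst_ne_root, fun e _ => ?_⟩, huniv⟩
  have : e.2 ∈ elimVerts es r := by rw [huniv]; exact Finset.mem_univ _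
  simpa only [elimVerts, Finset.mem_insert, List.mem_toFinset] using this

end SimpleGraph

/-! ### The program that removes the leaves -/

namespace WordRAM

open SimpleGraph

variable {W : ℕ} {Q : State → Prop} {s : State} {n K : ℕ}

theorem nbrList_spec {T : SimpleGraph (Fin n)} {l : List (Fin n × Fin n)}
    (hl : IsEdgeList T l) (u : Fin n) : (nbrList l u).length = (T.nbrs u).card ∧
      ((nbrList l u).map Fin.val).sum = ∑ w ∈ T.nbrs u, (w : ℕ) := by
  have hne : ∀ e ∈ l, e.1 ≠ e.2 := fun e he => T.ne_of_adj (by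
    rw [← mem_edgeSet, hl.2, List.mem_map]
    exact ⟨e, he, rfl⟩)
  have hn := nodup_nbrList hl.1 hne u
  have : T.nbrs u = (nbrList l u).toFinset := by
    ext w
    rw [mem_nbrs, List.mem_toFinset, mem_nbrList, ← hl.2, mem_edgeSet]
  rw [this, List.toFinset_card_of_nodup hn, List.sum_toFinset _ hn]
  exact ⟨rfl, rfl⟩

theorem wp_st' {j v a : ℕ} (hL : Layout n K s) (hj : j < K) (hW : K * n ≤ W) {x : Fin n}
    (hv : s.reg v = x) (ha : a ≠ 8) (hx : s.reg a ≤ W)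
    (hQ : ∀ s', Layout n K s' → (∀ r, r ≠ 8 → s'.reg r = s.reg r) →
      (∀ i (u : Fin n), s'.mem (i * n + u) =
        if i = j ∧ u = x then s.reg a else s.mem (i * n + u)) → Q s') : wp W (st j v a) Q s :=
  wp_st hL hj hW hv ha hx (hQ _ ((hL.set (by norm_num) (by norm_num) _).put _ _)
    (fun r h8 => by simp [h8]) fun i u => by rw [State.put_mem_address]; rfl)

/-- The removal of the leaf in register `4`, which is recorded in the arrays `4` and `5`. -/
def removeLeaf : Program :=
  .seq (ld 6 3 4) (.seq (subFrom 2 6 1) (.seq (subFrom 3 6 4) (.seq (.op (.const 10 0))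
    (.seq (st 2 4 10) (.seq (st 3 4 10) (.seq (st 4 7 4) (.seq (st 5 7 6)
      (.seq (.op (.add 7 7 1)) (.seq (.op (.copy 12 6)) (.op (.copy 4 6)))))))))))

/-- Removing the vertex in register `4` if it is a leaf, and going to the next vertex if not. -/
def peelStep : Program :=
  .seq (ld 9 2 4) (.ite (.eq 9 1) removeLeaf (.seq (.op (.add 3 3 1)) (.op (.copy 4 3))))

/-- Removing leaves as long as possible. -/
def peel : Program :=
  .seq (.op (.const 3 0)) (.seq (.op (.const 4 0)) (.seq (.op (.const 7 0))
    (.seq (.op (.const 12 0)) (.loop (.lt 3 0) peelStep))))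

/-- The state after the removal of the leaves in `es`, with the remaining graph `H`. -/
structure PeelInv (n K : ℕ) (T H : SimpleGraph (Fin n)) (es : List (Fin n × Fin n)) (r : Fin n)
    (s : State) : Prop where
  layout : Layout n K s
  peeling : Peeling T H es r
  bound : s.reg 3 ≤ n
  cur_lt : s.reg 3 < n → s.reg 4 < n
  cur_eq : s.reg 3 = n → s.reg 4 = n
  count : s.reg 7 = es.length
  root : s.reg 12 = r
  noLeaf : ∀ u : Fin n, (u : ℕ) ≤ s.reg 3 → (u : ℕ) ≠ s.reg 4 → (H.nbrs u).card ≠ 1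
  deg : ∀ u : Fin n, s.mem (2 * n + u) = (H.nbrs u).card
  sum : ∀ u : Fin n, s.mem (3 * n + u) = ∑ w ∈ H.nbrs u, (w : ℕ)
  record : ∀ (i : Fin n) (e : Fin n × Fin n), es[(i : ℕ)]? = some e →
    s.mem (4 * n + i) = e.1 ∧ s.mem (5 * n + i) = e.2

/-- Besides `c`, which becomes isolated, only `p` loses a neighbour. So `p` is the only vertex that
can become a leaf, and making it the current vertex preserves `noLeaf`. -/
theorem PeelInv.step {T H : SimpleGraph (Fin n)} {es : List (Fin n × Fin n)} {r c p : Fin n}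
    (h : PeelInv n K T H es r s) (h3 : s.reg 3 < n) (hc : s.reg 4 = c) (hp : H.nbrs c = {p})
    (hlen : es.length < n) {s' : State} (hL : Layout n K s') (r3 : s'.reg 3 = s.reg 3)
    (r4 : s'.reg 4 = p) (r7 : s'.reg 7 = es.length + 1) (r12 : s'.reg 12 = p)
    (m2 : ∀ u : Fin n, s'.mem (2 * n + u) =
      if u = c then 0 else if u = p then (H.nbrs p).card - 1 else (H.nbrs u).card)
    (m3 : ∀ u : Fin n, s'.mem (3 * n + u) = if u = c then 0 else if u = p then
      (∑ w ∈ H.nbrs p, (w : ℕ)) - c else ∑ w ∈ H.nbrs u, (w : ℕ))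
    (m4 : ∀ u : Fin n, s'.mem (4 * n + u) =
      if u = ⟨es.length, hlen⟩ then (c : ℕ) else s.mem (4 * n + u))
    (m5 : ∀ u : Fin n, s'.mem (5 * n + u) =
      if u = ⟨es.length, hlen⟩ then (p : ℕ) else s.mem (5 * n + u)) :
    PeelInv n K T (H.deleteEdges {s(c, p)}) (es ++ [(c, p)]) p s' where
  layout := hL
  peeling := h.peeling.step hp
  bound := by rw [r3]; exact h3.le
  cur_lt _ := by rw [r4]; exact p.isLt
  cur_eq h' := by omega
  count := by simp [r7]
  root := r12
  noLeaf u hu hup := by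
    rw [r3] at hu
    have hup : u ≠ p := fun h => hup (by rw [h, r4])
    rw [nbrs_step hp]
    split_ifs with h1
    · simp
    · exact h.noLeaf u hu fun h2 => h1 (Fin.ext (h2.trans hc))
  deg u := by
    have hpc : c ∈ H.nbrs p := by
      have : H.Adj c p := by rw [← mem_nbrs, hp]; simp
      exact mem_nbrs.2 this.symm
    rw [m2, nbrs_step hp]
    split_ifs
    · rfl
    · rw [Finset.card_erase_of_mem hpc]
    · rfl
  sum u := by
    have hpc : c ∈ H.nbrs p := by
      have : H.Adj c p := by rw [← mem_nbrs, hp]; simp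
      exact mem_nbrs.2 this.symm
    rw [m3, nbrs_step hp]
    split_ifs
    · rfl
    · rw [← Finset.add_sum_erase _ (fun w : Fin n => (w : ℕ)) hpc, Nat.add_sub_cancel_left]
    · rfl
  record i e he := by
    rw [m4, m5]
    rw [List.getElem?_append] at he
    split_ifs at he with hi
    · have hne : i ≠ ⟨es.length, hlen⟩ := fun h => by rw [h] at hi; simp at hi
      rw [if_neg hne, if_neg hne]
      exact h.record i e he
    · have hi' : i = ⟨es.length, hlen⟩ := by
        obtain ⟨h1, -⟩ := List.getElem?_eq_some_iff.1 he
        simp only [List.length_singleton] at h1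
        exact Fin.ext (show (i : ℕ) = es.length by omega)
      subst hi'
      simp only [Nat.sub_self, List.getElem?_cons_zero, Option.some.injEq] at he
      subst he
      simp

theorem wp_removeLeaf (hK : 6 ≤ K) (hW : (K + 2) * (n + 1) ^ 2 ≤ W) {T H : SimpleGraph (Fin n)}
    {es : List (Fin n × Fin n)} {r c : Fin n} (h : PeelInv n K T H es r s)
    (h3 : s.reg 3 < n) (hc : s.reg 4 = c) (hdeg : (H.nbrs c).card = 1)
    (hQ : ∀ s' H' r' e, PeelInv n K T H' (es ++ [e]) r' s' → s'.reg 3 = s.reg 3 → Q s') :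
    wp W removeLeaf Q s := by
  obtain ⟨hWK, hW1, hW2, hW3, -⟩ := le_of_bound hW
  obtain ⟨p, hp⟩ := Finset.card_eq_one.1 hdeg
  have hcp : c ≠ p := by
    have : H.Adj c p := by rw [← mem_nbrs, hp]; simp
    exact this.ne
  have hpc : c ∈ H.nbrs p := by
    have : H.Adj c p := by rw [← mem_nbrs, hp]; simp
    exact mem_nbrs.2 this.symm
  -- The sum over a single neighbour is that neighbour, so the parent is found without adjacency
  -- lists.
  have hsum : s.mem (3 * n + c) = p := by rw [h.sum, hp, Finset.sum_singleton]
  have hcW := c.isLt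
  have hpW := p.isLt
  have hlen := h.peeling.length_lt
  have hsq : 2 * n * n = n * n + n * n := by ring
  refine wp_ld h.layout (by omega) hWK hc (by omega) ?_
  rw [hsum]
  set s0 : State := (s.set 8 (3 * n + c)).set 6 p with hs0
  have hL0 : Layout n K s0 := (h.layout.set (by norm_num) (by norm_num) _).set (by norm_num)
    (by norm_num) _
  have hm0 : s0.mem = s.mem := by simp [hs0]
  refine wp_subFrom hL0 (by omega) hWK (x := p) (by simp [hs0]) (by norm_num) (by norm_num)
    (by norm_num) (by norm_num) (by rw [hm0, h.deg]; have := H.card_nbrs_le p; omega) ?_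
  intro s1 hL1 hr1 hm1i
  have hm1 : ∀ j (u : Fin n), s1.mem (j * n + u) =
      if j = 2 ∧ u = p then (H.nbrs p).card - 1 else s.mem (j * n + u) := fun j u => by
    rw [hm1i, State.put_mem_address, hL0.one, hm0, h.deg]
  refine wp_subFrom hL1 (by omega) hWK (x := p) (by simp [hr1, hs0]) (by norm_num) (by norm_num)
    (by norm_num) (by norm_num)
    (by rw [hm1, h.sum]; have := H.sum_nbrs_le p; simp; omega) ?_
  intro s2 hL2 hr2 hm2i
  have hm2 : ∀ j (u : Fin n), s2.mem (j * n + u) =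
      if j = 3 ∧ u = p then (∑ w ∈ H.nbrs p, (w : ℕ)) - c else s1.mem (j * n + u) := fun j u => by
    rw [hm2i, State.put_mem_address, hm1 3 p, h.sum, hr1 4 (by norm_num) (by norm_num)]
    simp [hs0, hc]
  replace hr2 : ∀ r, r ≠ 8 → r ≠ 9 → s2.reg r = s0.reg r := fun r h8 h9 => by
    rw [hr2 r h8 h9, hr1 r h8 h9]
  have r4 : s2.reg 4 = c := by simp [hr2, hs0, hc]
  have r6 : s2.reg 6 = p := by simp [hr2, hs0]
  have r7 : s2.reg 7 = es.length := by simp [hr2, hs0, h.count]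
  have r3 : s2.reg 3 = s.reg 3 := by simp [hr2, hs0]
  rw [wp_seq, wp_const]
  refine ⟨by omega, ?_⟩
  refine wp_st' (hL2.set (d := 10) (by norm_num) (by norm_num) 0) (by omega) hWK (x := c)
    (by simp [r4]) (by norm_num) (by simp) ?_
  intro s3 hL3 hr3 hm3
  refine wp_st' hL3 (by omega) hWK (x := c) (by simp [hr3, r4]) (by norm_num) (by simp [hr3]) ?_
  intro s4 hL4 hr4 hm4
  refine wp_st' hL4 (by omega) hWK (x := ⟨es.length, hlen⟩) (by simp [hr4, hr3, r7]) (by norm_num)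
    (by simp [hr4, hr3, r4]; omega) ?_
  intro s5 hL5 hr5 hm5
  refine wp_st' hL5 (by omega) hWK (x := ⟨es.length, hlen⟩) (by simp [hr5, hr4, hr3, r7])
    (by norm_num) (by simp [hr5, hr4, hr3, r6]; omega) ?_
  intro s6 hL6 hr6 hm6
  have t1 := hL6.one
  have t3 : s6.reg 3 = s.reg 3 := by simp [hr6, hr5, hr4, hr3, r3]
  have t4 : s5.reg 6 = p := by simp [hr5, hr4, hr3, r6]
  have t5 : s4.reg 4 = c := by simp [hr4, hr3, r4]
  have t6 : s6.reg 6 = p := by simp [hr6, t4]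
  have t7 : s6.reg 7 = es.length := by simp [hr6, hr5, hr4, hr3, r7]
  have t10 : s3.reg 10 = 0 := by simp [hr3]
  simp only [wp_seq, wp_add, wp_copy, State.set_reg]
  norm_num only [if_true, if_false, t1, t6, t7]
  refine ⟨by omega, by omega, by omega, hQ _ (H.deleteEdges {s(c, p)}) p (c, p) ?_ (by simp [t3])⟩
  exact h.step h3 hc hp hlen
    (((hL6.set (by norm_num) (by norm_num) _).set (by norm_num) (by norm_num) _).set
      (by norm_num) (by norm_num) _) (by simp [t3]) (by simp) (by simp) (by simp)
    (fun u => by simp [hm6, hm5, hm4, hm3, hm2, hm1, h.deg])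
    (fun u => by simp [hm6, hm5, hm4, hm3, hm2, hm1, h.sum, t10])
    (fun u => by simp [hm6, hm5, hm4, hm3, hm2, hm1, t5])
    (fun u => by simp [hm6, hm5, hm4, hm3, hm2, hm1, t4])

theorem wp_peelStep (hK : 6 ≤ K) (hW : (K + 2) * (n + 1) ^ 2 ≤ W) {T H : SimpleGraph (Fin n)}
    {es : List (Fin n × Fin n)} {r : Fin n} (h : PeelInv n K T H es r s) (h3 : s.reg 3 < n) :
    wp W peelStep (fun s' => ∃ H' es' r', PeelInv n K T H' es' r' s' ∧
      s'.reg 3 + es'.length = s.reg 3 + es.length + 1) s := by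
  obtain ⟨hWK, hW1, hW2, hW3, -⟩ := le_of_bound hW
  have h4 := h.cur_lt h3
  obtain ⟨c, hc⟩ : ∃ c : Fin n, s.reg 4 = c := ⟨⟨s.reg 4, h4⟩, rfl⟩
  refine wp_ld h.layout (by omega) hWK hc
    (by rw [h.deg]; have := H.card_nbrs_le c; omega) ?_
  rw [h.deg, wp_ite_eq]
  have hL0 := (h.layout.set (d := 8) (by norm_num) (by norm_num) (2 * n + c)).set (d := 9)
    (by norm_num) (by norm_num) (H.nbrs c).card
  have h0 : PeelInv n K T H es r ((s.set 8 (2 * n + c)).set 9 (H.nbrs c).card) :=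
    { layout := hL0
      peeling := h.peeling
      bound := by simpa using h.bound
      cur_lt := by simpa using h.cur_lt
      cur_eq := by simpa using h.cur_eq
      count := by simpa using h.count
      root := by simpa using h.root
      noLeaf := by simpa using h.noLeaf
      deg := h.deg
      sum := h.sum
      record := h.record }
  rw [hL0.one]
  simp only [State.set_reg, if_true]
  constructor
  · intro hdeg
    refine wp_removeLeaf hK hW h0 (by simpa using h3) (by simpa using hc) hdeg ?_
    intro s' H' r' e h' hs'
    refine ⟨H', _, r', h', ?_⟩
    rw [hs']
    simp
    omega
  · intro hdeg
    have h1 := h.layout.one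
    simp only [wp_seq, wp_add, wp_copy, State.set_reg]
    norm_num only [if_true, if_false, h1]
    refine ⟨by omega, by omega, H, es, r, ?_, by omega⟩
    exact
    { layout := (hL0.set (by norm_num) (by norm_num) _).set (by norm_num) (by norm_num) _
      peeling := h.peeling
      bound := by simp; omega
      cur_lt := by simp
      cur_eq := by simp
      count := by simpa using h.count
      root := by simpa using h.root
      noLeaf := fun u hu hne => by
        simp at hu hne
        by_cases huc : u = c
        · rwa [huc]
        · exact h.noLeaf u (by omega) fun h2 => huc (Fin.ext (h2.trans hc))
      deg := h.deg
      sum := h.sum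
      record := h.record }

theorem ends_peel (hK : 6 ≤ K) (hW : (K + 2) * (n + 1) ^ 2 ≤ W) {T : SimpleGraph (Fin n)}
    (hT : T.IsTree) (hL : Layout n K s)
    (hdeg : ∀ u : Fin n, s.mem (2 * n + u) = (T.nbrs u).card)
    (hsum : ∀ u : Fin n, s.mem (3 * n + u) = ∑ w ∈ T.nbrs u, (w : ℕ)) :
    Ends W peel s (1 + (1 + (1 + (1 + (1 + 2 * n * (1 + peelStep.cost))))))
      fun s' => Layout n K s' ∧ ∃ es r, IsEdgeList T es ∧ IsElimination es r ∧
        elimVerts es r = Finset.univ ∧ s'.reg 7 = es.length ∧ s'.reg 12 = r ∧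
        ∀ (i : Fin n) (e : Fin n × Fin n), es[(i : ℕ)]? = some e →
          s'.mem (4 * n + i) = e.1 ∧ s'.mem (5 * n + i) = e.2 := by
  obtain ⟨r0⟩ := hT.connected.nonempty
  have hn := r0.pos
  refine Ends.const_seq (by omega) (Ends.const_seq (by omega) (Ends.const_seq (by omega)
    (Ends.const_seq (by omega) ?_)))
  have hL0 : Layout n K ((((s.set 3 0).set 4 0).set 7 0).set 12 0) := by
    iterate 4 refine Layout.set ?_ (by norm_num) (by norm_num) _
    exact hL
  -- Each iteration either removes a leaf or advances the scan, so the sum of scan position and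
  -- number of removals grows by one and stays within `2 * n`.
  refine Ends.loop (fun m s => ∃ H es r, PeelInv n K T H es r s ∧
    s.reg 3 + es.length + m = 2 * n) ?_ ⟨T, [], ⟨0, hn⟩, ?_, by simp⟩ ?_
  · rintro m s ⟨H, es, r, hI, hm⟩ hb
    rw [Test.Holds, hI.layout.size] at hb
    have := hI.peeling.length_lt
    refine ⟨m - 1, by omega, wp_mono (wp_peelStep hK hW hI hb) ?_⟩
    rintro s' ⟨H', es', r', hI', hs'⟩
    exact ⟨H', es', r', hI', by omega⟩
  · exact
    { layout := hL0
      peeling := .refl T _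
      bound := by simp
      cur_lt := by simp
      cur_eq := by simp
      count := by simp
      root := by simp
      noLeaf := fun u hu hne => by simp at hu hne; omega
      deg := hdeg
      sum := hsum
      record := by simp }
  · rintro m s ⟨H, es, r, hI, -⟩ hb
    rw [Test.Holds, hI.layout.size] at hb
    have h3 : s.reg 3 = n := le_antisymm hI.bound (not_lt.1 hb)
    have h4 := hI.cur_eq h3
    -- When the scan ends, the current vertex is `n`, which is no vertex, so `noLeaf` applies to all
    -- of them.
    obtain ⟨e1, e2, e3⟩ := hI.peeling.isElimination hT fun u =>
      hI.noLeaf u (by omega) (by omega)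
    exact ⟨hI.layout, es, r, e1, e2, e3, hI.count, hI.root, hI.record⟩

end WordRAM

/-! ### The cost tables -/

namespace WordRAM

open TreeAutomaton

variable {W : ℕ} {Q : State → Prop} {s : State} {n : ℕ} (𝒜 : TreeAutomaton)

/-- The costs of the states of a single vertex. -/
def startCost (n : ℕ) (q : ℕ) : ℕ := if 𝒜.ini q then 𝒜.lab q else n + 1

theorem startCost_le (q : ℕ) : startCost 𝒜 n q ≤ n + 1 := by
  have := 𝒜.lab_le q
  unfold startCost
  split_ifs <;> omega

/-- The number of arrays. -/
abbrev arrays : ℕ := 7 + 2 * 𝒜.N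

/-- Writing the initial table of the vertex in register `3`. -/
def initTable : Program :=
  forList (fun q => if 𝒜.ini q then .seq (.op (.const 9 (𝒜.lab q))) (st (7 + q) 3 9)
    else st (7 + q) 3 2) (List.range 𝒜.N)

/-- Writing all initial tables. -/
def initTables : Program :=
  .seq (.op (.const 3 0)) (.loop (.lt 3 0) (.seq (initTable 𝒜) (.op (.add 3 3 1))))

theorem wp_initTable (hW : (arrays 𝒜 + 2) * (n + 1) ^ 2 ≤ W) (hL : Layout n (arrays 𝒜) s)
    {x : Fin n} (h3 : s.reg 3 = x)
    (hQ : ∀ s', Layout n (arrays 𝒜) s' → (∀ r, r ≠ 8 → r ≠ 9 → s'.reg r = s.reg r) →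
      (∀ i (u : Fin n), i < 7 ∨ u ≠ x → s'.mem (i * n + u) = s.mem (i * n + u)) →
      (∀ q < 𝒜.N, s'.mem ((7 + q) * n + x) = startCost 𝒜 n q) → Q s') :
    wp W (initTable 𝒜) Q s := by
  obtain ⟨hWK, hW1, hW2, hW3, -⟩ := le_of_bound hW
  refine wp_forList (fun pre s' => Layout n (arrays 𝒜) s' ∧
    (∀ r, r ≠ 8 → r ≠ 9 → s'.reg r = s.reg r) ∧
    (∀ i (u : Fin n), i < 7 ∨ u ≠ x → s'.mem (i * n + u) = s.mem (i * n + u)) ∧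
    (∀ q ∈ pre, s'.mem ((7 + q) * n + x) = startCost 𝒜 n q)) ⟨hL, by simp, by simp, by simp⟩ ?_ ?_
  · rintro pre q s1 hq ⟨hL1, hr1, hf1, hm1⟩
    rw [List.mem_range] at hq
    have key : ∀ s2, Layout n (arrays 𝒜) s2 → (∀ r, r ≠ 8 → r ≠ 9 → s2.reg r = s1.reg r) →
        (∀ i (u : Fin n), s2.mem (i * n + u) =
          if i = 7 + q ∧ u = x then startCost 𝒜 n q else s1.mem (i * n + u)) →
        (Layout n (arrays 𝒜) s2 ∧ (∀ r, r ≠ 8 → r ≠ 9 → s2.reg r = s.reg r) ∧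
        (∀ i (u : Fin n), i < 7 ∨ u ≠ x → s2.mem (i * n + u) = s.mem (i * n + u)) ∧
        (∀ q' ∈ pre ++ [q], s2.mem ((7 + q') * n + x) = startCost 𝒜 n q')) := by
      intro s2 hL2 hr2 hm2
      refine ⟨hL2, fun r h8 h9 => by rw [hr2 r h8 h9, hr1 r h8 h9], fun i u hiu => ?_,
        fun q' hq' => ?_⟩
      · rw [hm2, if_neg (by rintro ⟨h1, h2⟩; rcases hiu with h | h; omega; exact h h2), hf1 i u hiu]
      · rw [hm2]
        split_ifs with h
        · rw [show q' = q by omega]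
        · refine hm1 q' ?_
          rcases List.mem_append.1 hq' with h' | h'
          · exact h'
          · rw [List.mem_singleton] at h'
            exact absurd ⟨by rw [h'], rfl⟩ h
    have r3 : s1.reg 3 = x := by rw [hr1 3 (by norm_num) (by norm_num), h3]
    have hc : startCost 𝒜 n q ≤ W := (startCost_le 𝒜 q).trans hW1
    by_cases hi : 𝒜.ini q
    · rw [if_pos hi, wp_seq, wp_const]
      rw [startCost, if_pos hi] at hc
      refine ⟨hc, ?_⟩
      refine wp_st' (hL1.set (d := 9) (by norm_num) (by norm_num) _)
        (by simp only [arrays]; omega) hWK (x := x) (by simp [r3]) (by norm_num) (by simpa) ?_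
      intro s2 hL2 hr2 hm2
      refine key s2 hL2 (fun r h8 h9 => by simp [hr2 r h8, h9]) fun i u => ?_
      rw [hm2, startCost, if_pos hi]
      simp
    · rw [if_neg hi]
      refine wp_st' hL1 (by simp only [arrays]; omega) hWK r3 (by norm_num) (by
        rw [hL1.inf]; exact hW1) ?_
      intro s2 hL2 hr2 hm2
      refine key s2 hL2 (fun r h8 h9 => hr2 r h8) fun i u => ?_
      rw [hm2, startCost, if_neg hi, hL1.inf]
  · rintro s' ⟨h1, h2, h3, h4⟩
    exact hQ s' h1 h2 h3 fun q hq => h4 q (List.mem_range.2 hq)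

theorem ends_initTables (hW : (arrays 𝒜 + 2) * (n + 1) ^ 2 ≤ W) (hL : Layout n (arrays 𝒜) s) :
    Ends W (initTables 𝒜) s
      (1 + (1 + n * (1 + ((initTable 𝒜).cost + 1))))
      fun s' => Layout n (arrays 𝒜) s' ∧ s'.reg 7 = s.reg 7 ∧ s'.reg 12 = s.reg 12 ∧
        (∀ i (u : Fin n), i < 7 → s'.mem (i * n + u) = s.mem (i * n + u)) ∧
        (∀ (u : Fin n), ∀ q < 𝒜.N, s'.mem ((7 + q) * n + u) = startCost 𝒜 n q) := by
  obtain ⟨hWK, hW1, hW2, hW3, -⟩ := le_of_bound hW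
  refine Ends.const_seq (by omega) ?_
  refine Ends.loop (p := .seq (initTable 𝒜) (.op (.add 3 3 1)))
    (fun m s' => s'.reg 3 + m = n ∧ Layout n (arrays 𝒜) s' ∧ s'.reg 7 = s.reg 7 ∧
      s'.reg 12 = s.reg 12 ∧
      (∀ i (u : Fin n), i < 7 → s'.mem (i * n + u) = s.mem (i * n + u)) ∧
      (∀ u : Fin n, (u : ℕ) < s'.reg 3 → ∀ q < 𝒜.N,
        s'.mem ((7 + q) * n + u) = startCost 𝒜 n q)) ?_ ?_ ?_
  · rintro m s1 ⟨hm, hL1, h7, h12, hf, ht⟩ hb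
    rw [Test.Holds, hL1.size] at hb
    refine ⟨m - 1, by omega, ?_⟩
    rw [wp_seq]
    refine wp_initTable 𝒜 hW hL1 (x := ⟨s1.reg 3, hb⟩) rfl ?_
    intro s2 hL2 hr2 hf2 hm2
    have r3 := hr2 3 (by norm_num) (by norm_num)
    rw [wp_add, hL2.one]
    refine ⟨by omega, ?_, hL2.set (by norm_num) (by norm_num) _, ?_, ?_, ?_, ?_⟩
    · simp [r3]; omega
    · simp [hr2, h7]
    · simp [hr2, h12]
    · intro i u hi
      rw [State.set_mem, hf2 i u (.inl hi), hf i u hi]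
    · intro u hu q hq
      rw [State.set_reg, if_pos rfl, r3] at hu
      rw [State.set_mem]
      by_cases hux : u = ⟨s1.reg 3, hb⟩
      · rw [hux]
        exact hm2 q hq
      · rw [hf2 _ u (.inr hux)]
        refine ht u ?_ q hq
        have : (u : ℕ) ≠ s1.reg 3 := fun h => hux (Fin.ext h)
        omega
  · refine ⟨by simp, hL.set (by norm_num) (by norm_num) _, by simp, by simp, by simp, by simp⟩
  · rintro m s1 ⟨hm, hL1, h7, h12, hf, ht⟩ hb
    rw [Test.Holds, hL1.size] at hb
    exact ⟨hL1, h7, h12, hf, fun u => ht u (by omega)⟩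

/-! ### Absorbing the leaves -/

/-- Saving the table of the vertex in register `6` for the vertex in register `4`. -/
def saveTable : Program :=
  forList (fun q => .seq (ld 9 (7 + q) 6) (.seq (st (7 + 𝒜.N + q) 4 9) (st (7 + q) 6 2)))
    (List.range 𝒜.N)

/-- Taking a transition into account. -/
def relax (t : ℕ × ℕ × ℕ) : Program :=
  .seq (ld 9 (7 + 𝒜.N + t.1) 4) (.seq (ld 10 (7 + t.2.1) 4) (.seq (.op (.add 9 9 10))
    (.seq (ld 10 (7 + t.2.2) 6) (.ite (.lt 9 10) (st (7 + t.2.2) 6 9) .skip))))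

/-- Absorbing the next leaf. -/
def absorbNext : Program :=
  .seq (ld 4 4 3) (.seq (ld 6 5 3) (.seq (saveTable 𝒜)
    (.seq (forList (relax 𝒜) 𝒜.trans) (.op (.add 3 3 1)))))

/-- The old table of the parent is stored under the index of the child. A vertex is absorbed at most
once, so these cells are never needed for another absorption. The table of the parent is reset to
infinity for the minimum that follows. -/
theorem wp_saveTable (hW : (arrays 𝒜 + 2) * (n + 1) ^ 2 ≤ W) (hL : Layout n (arrays 𝒜) s)
    {c p : Fin n} (h4 : s.reg 4 = c) (h6 : s.reg 6 = p) {a : ℕ → ℕ}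
    (ha : ∀ q < 𝒜.N, s.mem ((7 + q) * n + p) = a q ∧ a q ≤ n + 1)
    (hQ : ∀ s', Layout n (arrays 𝒜) s' → (∀ r, r ≠ 8 → r ≠ 9 → s'.reg r = s.reg r) →
      (∀ i (u : Fin n), i < 7 + 𝒜.N → i < 7 ∨ u ≠ p →
        s'.mem (i * n + u) = s.mem (i * n + u)) →
      (∀ i (u : Fin n), 7 + 𝒜.N ≤ i → u ≠ c → s'.mem (i * n + u) = s.mem (i * n + u)) →
      (∀ q < 𝒜.N, s'.mem ((7 + q) * n + p) = n + 1) →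
      (∀ q < 𝒜.N, s'.mem ((7 + 𝒜.N + q) * n + c) = a q) → Q s') :
    wp W (saveTable 𝒜) Q s := by
  obtain ⟨hWK, hW1, hW2, hW3, -⟩ := le_of_bound hW
  refine wp_forList_nodup List.nodup_range (fun pre s' => Layout n (arrays 𝒜) s' ∧
    (∀ r, r ≠ 8 → r ≠ 9 → s'.reg r = s.reg r) ∧
    (∀ i (u : Fin n), i < 7 + 𝒜.N → i < 7 ∨ u ≠ p →
        s'.mem (i * n + u) = s.mem (i * n + u)) ∧
    (∀ i (u : Fin n), 7 + 𝒜.N ≤ i → u ≠ c → s'.mem (i * n + u) = s.mem (i * n + u)) ∧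
    (∀ q < 𝒜.N, s'.mem ((7 + q) * n + p) = if q ∈ pre then n + 1 else a q) ∧
    (∀ q ∈ pre, s'.mem ((7 + 𝒜.N + q) * n + c) = a q))
    ⟨hL, by simp, by simp, by simp, by simpa using fun q hq => (ha q hq).1, by simp⟩ ?_ ?_
  · rintro pre q s1 hq hqp ⟨hL1, hr1, hf1, hg1, hp1, hc1⟩
    rw [List.mem_range] at hq
    have r4 : s1.reg 4 = c := by rw [hr1 4 (by norm_num) (by norm_num), h4]
    have r6 : s1.reg 6 = p := by rw [hr1 6 (by norm_num) (by norm_num), h6]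
    have hq1 := hp1 q hq
    rw [if_neg hqp] at hq1
    have haq := (ha q hq).2
    refine wp_ld hL1 (by simp only [arrays]; omega) hWK r6 (by omega) ?_
    rw [hq1, wp_seq]
    refine wp_st' ((hL1.set (by norm_num) (by norm_num) _).set (by norm_num) (by norm_num) _)
      (by simp only [arrays]; omega) hWK (x := c) (by simp [r4]) (by norm_num)
      (by simp; omega) ?_
    intro s2 hL2 hr2 hm2
    refine wp_st' hL2 (by simp only [arrays]; omega) hWK (x := p) (by simp [hr2, r6])
      (by norm_num) (by rw [hL2.inf]; omega) ?_
    intro s3 hL3 hr3 hm3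
    have hm3 : ∀ i (u : Fin n), s3.mem (i * n + u) = if i = 7 + q ∧ u = p then n + 1 else
        if i = 7 + 𝒜.N + q ∧ u = c then a q else s1.mem (i * n + u) := fun i u => by
      rw [hm3, hm2, hL2.inf]
      simp
    refine ⟨hL3, fun r h8 h9 => ?_, fun i u hi hu => ?_, fun i u hi hu => ?_, fun q' hq' => ?_,
      fun q' hq' => ?_⟩
    · simp [hr3 r h8, hr2 r h8, h8, h9, hr1 r h8 h9]
    · rw [hm3, if_neg, if_neg (by omega), hf1 i u hi hu]
      rintro ⟨h1, h2⟩
      rcases hu with h | h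
      · omega
      · exact h h2
    · rw [hm3, if_neg (by omega), if_neg (fun h => hu h.2), hg1 i u hi hu]
    · rw [hm3]
      by_cases hqq : q' = q
      · simp [hqq]
      · rw [if_neg (by omega), if_neg (by omega), hp1 q' hq']
        simp [hqq]
    · have hlt : q' ∈ pre ∨ q' = q := by simpa using hq'
      rw [hm3, if_neg (by omega)]
      split_ifs with h
      · rw [show q' = q by omega]
      · refine hc1 q' (hlt.resolve_right fun h1 => h ⟨by rw [h1], rfl⟩)
  · rintro s' ⟨h1, h2, h3, h4, h5, h6⟩
    refine hQ s' h1 h2 h3 h4 (fun q hq => ?_) fun q hq => h6 q (List.mem_range.2 hq)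
    rw [h5 q hq, if_pos (List.mem_range.2 hq)]

/-- Both tables that are read belong to `c`, and only the table of `p` is written. Starting from `n
+ 1`, the successive comparisons carry out the fold that defines `best`. -/
theorem wp_relax (hW : (arrays 𝒜 + 2) * (n + 1) ^ 2 ≤ W) (hL : Layout n (arrays 𝒜) s)
    {c p : Fin n} (hcp : c ≠ p) (h4 : s.reg 4 = c) (h6 : s.reg 6 = p) {a b : ℕ → ℕ}
    (ha : ∀ q < 𝒜.N, s.mem ((7 + 𝒜.N + q) * n + c) = a q ∧ a q ≤ n + 1)
    (hb : ∀ q < 𝒜.N, s.mem ((7 + q) * n + c) = b q ∧ b q ≤ n + 1)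
    (hp : ∀ q < 𝒜.N, s.mem ((7 + q) * n + p) = n + 1)
    (hQ : ∀ s', Layout n (arrays 𝒜) s' →
      (∀ r, r ≠ 8 → r ≠ 9 → r ≠ 10 → s'.reg r = s.reg r) →
      (∀ i (u : Fin n), i < 7 ∨ 7 + 𝒜.N ≤ i ∨ u ≠ p →
        s'.mem (i * n + u) = s.mem (i * n + u)) →
      (∀ q < 𝒜.N, s'.mem ((7 + q) * n + p) = best 𝒜.trans (n + 1) a b q) → Q s') :
    wp W (forList (relax 𝒜) 𝒜.trans) Q s := by
  obtain ⟨hWK, hW1, hW2, hW3, -⟩ := le_of_bound hW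
  refine wp_forList (fun pre s' => Layout n (arrays 𝒜) s' ∧
    (∀ r, r ≠ 8 → r ≠ 9 → r ≠ 10 → s'.reg r = s.reg r) ∧
    (∀ i (u : Fin n), i < 7 ∨ 7 + 𝒜.N ≤ i ∨ u ≠ p →
        s'.mem (i * n + u) = s.mem (i * n + u)) ∧
    (∀ q < 𝒜.N, s'.mem ((7 + q) * n + p) = best pre (n + 1) a b q))
    ⟨hL, by simp, by simp, by simpa [best] using hp⟩ ?_ ?_
  · rintro pre ⟨x, y, z⟩ s1 ht ⟨hL1, hr1, hf1, hp1⟩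
    obtain ⟨hx, hy, hz⟩ := 𝒜.trans_lt _ ht
    simp only at hx hy hz
    have r4 : s1.reg 4 = c := by rw [hr1 4 (by norm_num) (by norm_num) (by norm_num), h4]
    have r6 : s1.reg 6 = p := by rw [hr1 6 (by norm_num) (by norm_num) (by norm_num), h6]
    have hax := ha x hx
    have hby := hb y hy
    have m1 : s1.mem ((7 + 𝒜.N + x) * n + c) = a x := by
      rw [hf1 _ _ (.inr (.inl (by omega))), hax.1]
    have m2 : s1.mem ((7 + y) * n + c) = b y := by
      rw [hf1 _ _ (.inr (.inr hcp)), hby.1]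
    have m3 := hp1 z hz
    have hbest := best_le_cutoff pre (n + 1) a b z
    simp only [relax]
    refine wp_ld hL1 (by simp only [arrays]; omega) hWK r4 (by omega) ?_
    rw [m1, wp_seq]
    have hL2 := (hL1.set (d := 8) (by norm_num) (by norm_num) ((7 + 𝒜.N + x) * n + c)).set (d := 9)
      (by norm_num) (by norm_num) (a x)
    refine wp_ld hL2 (by simp only [arrays]; omega) hWK (x := c) (by simp [r4])
      (by simp; omega) ?_
    have hL3 := (hL2.set (d := 8) (by norm_num) (by norm_num) ((7 + y) * n + c)).set (d := 10)
      (by norm_num) (by norm_num) (b y)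
    simp only [State.set_mem]
    rw [m2, wp_seq, wp_add]
    have e9 : (((((s1.set 8 ((7 + 𝒜.N + x) * n + c)).set 9 (a x)).set 8
        ((7 + y) * n + c)).set 10 (b y)).reg 9) + (((((s1.set 8 ((7 + 𝒜.N + x) * n + c)).set 9
        (a x)).set 8 ((7 + y) * n + c)).set 10 (b y)).reg 10) = a x + b y := by simp
    rw [e9]
    refine ⟨by omega, ?_⟩
    have hL4 := hL3.set (d := 9) (by norm_num) (by norm_num) (a x + b y)
    refine wp_ld hL4 (by simp only [arrays]; omega) hWK (x := p) (by simp [r6])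
      (by simp; omega) ?_
    have hL5 := (hL4.set (d := 8) (by norm_num) (by norm_num) ((7 + z) * n + p)).set (d := 10)
      (by norm_num) (by norm_num) (best pre (n + 1) a b z)
    simp only [State.set_mem]
    rw [m3, wp_ite_lt]
    generalize hs5 : (((((((s1.set 8 ((7 + 𝒜.N + x) * n + c)).set 9 (a x)).set 8
      ((7 + y) * n + c)).set 10 (b y)).set 9 (a x + b y)).set 8 ((7 + z) * n + p)).set 10
      (best pre (n + 1) a b z)) = s5 at hL5 ⊢
    have hr5 : ∀ r, r ≠ 8 → r ≠ 9 → r ≠ 10 → s5.reg r = s.reg r := fun r h8 h9 h10 => by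
      simp [← hs5, h8, h9, h10, hr1]
    have hm5 : s5.mem = s1.mem := by simp [← hs5]
    have r9 : s5.reg 9 = a x + b y := by simp [← hs5]
    have r10 : s5.reg 10 = best pre (n + 1) a b z := by simp [← hs5]
    rw [r9, r10]
    constructor
    · intro hlt
      refine wp_st' hL5 (by simp only [arrays]; omega) hWK (x := p) (by simp [hr5, h6])
        (by norm_num) (by omega) ?_
      intro s6 hL6 hr6 hm6
      refine ⟨hL6, fun r h8 h9 h10 => by rw [hr6 r h8, hr5 r h8 h9 h10], fun i u hiu => ?_,
        fun q hq => ?_⟩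
      · rw [hm6, if_neg, hm5, hf1 i u hiu]
        rintro ⟨h1, h2⟩
        rcases hiu with h | h | h
        · omega
        · omega
        · exact h h2
      · rw [hm6, hm5, hp1 q hq, best_append_singleton, r9]
        by_cases hqz : q = z
        · simp [hqz, hlt]
        · rw [if_neg (by omega), if_neg (fun h => hqz h.1.symm)]
    · intro hlt
      refine ⟨hL5, hr5, fun i u hiu => by rw [hm5, hf1 i u hiu], fun q hq => ?_⟩
      rw [hm5, hp1 q hq, best_append_singleton, if_neg]
      rintro ⟨rfl, h⟩
      exact hlt h
  · rintro s' ⟨h1, h2, h3, h4⟩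
    exact hQ s' h1 h2 h3 h4

/-- The arrays `4` and `5` contain the elimination order, register `7` its length, and register
`12` the root. -/
structure Recorded (es : List (Fin n × Fin n)) (r : Fin n) (s : State) : Prop where
  elim : IsElimination es r
  root : s.reg 12 = r
  record : ∀ (i : Fin n) (e : Fin n × Fin n), es[(i : ℕ)]? = some e →
    s.mem (4 * n + i) = e.1 ∧ s.mem (5 * n + i) = e.2

/-- The state after the first `i` leaves have been absorbed. -/
structure AbsorbInv (es : List (Fin n × Fin n)) (r : Fin n) (i : ℕ) (s : State) : Prop where
  layout : Layout n (arrays 𝒜) s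
  recorded : Recorded es r s
  count : s.reg 7 = es.length
  tables : ∀ (u : Fin n), ∀ q < 𝒜.N, s.mem ((7 + q) * n + u) =
    𝒜.table (n + 1) (fun _ => startCost 𝒜 n) (es.take i) u q
  saved : ∀ j < i, ∀ e, es[j]? = some e → ∀ q < 𝒜.N,
    s.mem ((7 + 𝒜.N + q) * n + e.1) =
        𝒜.table (n + 1) (fun _ => startCost 𝒜 n) (es.take j) e.2 q ∧
      s.mem ((7 + q) * n + e.1) =
        𝒜.table (n + 1) (fun _ => startCost 𝒜 n) (es.take j) e.1 q

theorem startTable_le (es : List (Fin n × Fin n)) (u : Fin n) (q : ℕ) :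
    𝒜.table (n + 1) (fun _ => startCost 𝒜 n) es u q ≤ n + 1 :=
  𝒜.table_le (fun _ q => startCost_le 𝒜 q) es u q

theorem wp_absorbNext (hW : (arrays 𝒜 + 2) * (n + 1) ^ 2 ≤ W) {es : List (Fin n × Fin n)}
    {r : Fin n} (h : AbsorbInv 𝒜 es r (s.reg 3) s) (hi : s.reg 3 < es.length)
    (hlen : es.length < n) :
    wp W (absorbNext 𝒜) (fun s' => s'.reg 3 = s.reg 3 + 1 ∧ AbsorbInv 𝒜 es r (s'.reg 3) s') s := by
  obtain ⟨hWK, hW1, hW2, hW3, -⟩ := le_of_bound hW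
  obtain ⟨i, hi3⟩ : ∃ i : Fin n, s.reg 3 = i := ⟨⟨s.reg 3, by omega⟩, rfl⟩
  rw [hi3] at h hi ⊢
  obtain ⟨e, he⟩ : ∃ e, es[(i : ℕ)]? = some e := ⟨_, List.getElem?_eq_getElem hi⟩
  have hemem : e ∈ es := List.mem_of_getElem? he
  have hcp := h.recorded.elim.fst_ne_snd e hemem
  obtain ⟨hrec4, hrec5⟩ := h.recorded.record i e he
  have l1 := e.1.isLt
  have l2 := e.2.isLt
  have htake : es.take (i + 1) = es.take i ++ [e] := by
    rw [List.take_add_one, he]; rfl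
  -- A leaf absorbed earlier occurs neither as the present child nor as the present parent, so its
  -- own table and the one saved with it stay intact until the reconstruction.
  have hpast : ∀ j < (i : ℕ), ∀ f, es[j]? = some f → f.1 ≠ e.1 ∧ f.1 ≠ e.2 := by
    intro j hj f hf
    have hp := List.pairwise_iff_getElem.1 h.recorded.elim.pairwise j i (by omega) hi hj
    rw [List.getElem?_eq_some_iff] at hf he
    obtain ⟨_, rfl⟩ := hf
    obtain ⟨_, rfl⟩ := he
    exact hp
  set D := 𝒜.table (n + 1) (fun _ => startCost 𝒜 n) (es.take i) with hD
  have hDle : ∀ u q, D u q ≤ n + 1 := startTable_le 𝒜 _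
  refine wp_ld h.layout (by simp only [arrays]; omega) hWK hi3 (by omega) ?_
  rw [hrec4, wp_seq]
  have hL1 := (h.layout.set (d := 8) (by norm_num) (by norm_num) (4 * n + i)).set (d := 4)
      (by norm_num) (by norm_num) e.1
  refine wp_ld hL1 (by simp only [arrays]; omega) hWK (x := i) (by simp [hi3])
    (by simp; omega) ?_
  simp only [State.set_mem]
  rw [hrec5, wp_seq]
  have hL2 := (hL1.set (d := 8) (by norm_num) (by norm_num) (5 * n + i)).set (d := 6)
      (by norm_num) (by norm_num) e.2
  generalize hs2 : ((((s.set 8 (4 * n + i)).set 4 e.1).set 8 (5 * n + i)).set 6 e.2) = s2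
    at hL2 ⊢
  have hr2 : ∀ r, r ≠ 8 → r ≠ 4 → r ≠ 6 → s2.reg r = s.reg r := fun r h8 h4 h6 => by
    simp [← hs2, h8, h4, h6]
  have hm2 : s2.mem = s.mem := by simp [← hs2]
  have r4 : s2.reg 4 = e.1 := by simp [← hs2]
  have r6 : s2.reg 6 = e.2 := by simp [← hs2]
  refine wp_saveTable 𝒜 hW hL2 r4 r6 (a := D e.2)
    (fun q hq => ⟨by rw [hm2, h.tables _ q hq], hDle _ _⟩) ?_
  intro s3 hL3 hr3 hf3 hg3 hp3 hc3
  rw [wp_seq]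
  refine wp_relax 𝒜 hW hL3 hcp (by rw [hr3 4 (by norm_num) (by norm_num), r4])
    (by rw [hr3 6 (by norm_num) (by norm_num), r6]) (a := D e.2) (b := D e.1)
    (fun q hq => ⟨hc3 q hq, hDle _ _⟩)
    (fun q hq => ⟨by rw [hf3 _ _ (by omega) (.inr hcp), hm2, h.tables _ q hq], hDle _ _⟩)
    hp3 ?_
  intro s4 hL4 hr4 hf4 hp4
  have hr : ∀ r, r ≠ 4 → r ≠ 6 → r ≠ 8 → r ≠ 9 → r ≠ 10 → s4.reg r = s.reg r :=
    fun r h4 h6 h8 h9 h10 => by rw [hr4 r h8 h9 h10, hr3 r h8 h9, hr2 r h8 h4 h6]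
  have r3 : s4.reg 3 = i := by rw [hr 3 (by norm_num) (by norm_num) (by norm_num) (by norm_num)
    (by norm_num), hi3]
  rw [wp_add, r3, hL4.one]
  have hlow : ∀ k < 7, ∀ u : Fin n, s4.mem (k * n + u) = s.mem (k * n + u) := fun k hk u => by
    rw [hf4 _ _ (.inl hk), hf3 _ _ (by omega) (.inl hk), hm2]
  have htab : ∀ u : Fin n, u ≠ e.2 → ∀ q < 𝒜.N,
      s4.mem ((7 + q) * n + u) = s.mem ((7 + q) * n + u) := fun u hu q hq => by
    rw [hf4 _ _ (.inr (.inr hu)), hf3 _ _ (by omega) (.inr hu), hm2]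
  refine ⟨by omega, by simp, ?_⟩
  rw [State.set_reg, if_pos rfl]
  exact
  { layout := hL4.set (by norm_num) (by norm_num) _
    recorded :=
    { elim := h.recorded.elim
      root := by simp [hr, h.recorded.root]
      record := fun j f hf => by
        rw [State.set_mem, hlow 4 (by norm_num), hlow 5 (by norm_num)]
        exact h.recorded.record j f hf }
    count := by simp [hr, h.count]
    tables := fun u q hq => by
      rw [State.set_mem, htake, table_append_singleton, absorb, Function.update_apply, ← hD]
      split_ifs with hu
      · rw [hu, hp4 q hq]
      · rw [htab u hu q hq, h.tables u q hq]
    saved := fun j hj f hf q hq => by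
      rw [State.set_mem]
      rcases Nat.lt_succ_iff_lt_or_eq.1 hj with hj | rfl
      · obtain ⟨n1, n2⟩ := hpast j hj f hf
        rw [htab f.1 n2 q hq, hf4 _ _ (.inr (.inl (by omega))), hg3 _ _ (by omega) n1, hm2]
        exact h.saved j hj f hf q hq
      · obtain rfl : e = f := by rw [he] at hf; exact Option.some.inj hf
        rw [htab e.1 hcp q hq, hf4 _ _ (.inr (.inl (by omega))), hc3 q hq, h.tables _ q hq]
        exact ⟨rfl, rfl⟩ }

/-- Absorbing all leaves. -/
def absorbAll : Program := .seq (.op (.const 3 0)) (.loop (.lt 3 7) (absorbNext 𝒜))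

theorem ends_absorbAll (hW : (arrays 𝒜 + 2) * (n + 1) ^ 2 ≤ W) {es : List (Fin n × Fin n)}
    {r : Fin n} (hlen : es.length < n) (hL : Layout n (arrays 𝒜) s) (hR : Recorded es r s)
    (h7 : s.reg 7 = es.length)
    (h0 : ∀ (u : Fin n), ∀ q < 𝒜.N, s.mem ((7 + q) * n + u) = startCost 𝒜 n q) :
    Ends W (absorbAll 𝒜) s (1 + (1 + es.length * (1 + (absorbNext 𝒜).cost)))
      (AbsorbInv 𝒜 es r es.length) := by
  refine Ends.const_seq (by omega) ?_
  refine Ends.loop (fun m s' => s'.reg 3 + m = es.length ∧ AbsorbInv 𝒜 es r (s'.reg 3) s')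
    ?_ ⟨by simp, ?_⟩ ?_
  · rintro m s1 ⟨hm, hI⟩ hb
    rw [Test.Holds, hI.count] at hb
    refine ⟨m - 1, by omega, wp_mono (wp_absorbNext 𝒜 hW hI hb hlen) ?_⟩
    rintro s2 ⟨h1, h2⟩
    exact ⟨by omega, h2⟩
  · exact
    { layout := hL.set (by norm_num) (by norm_num) _
      recorded := ⟨hR.elim, by simp [hR.root], hR.record⟩
      count := by simp [h7]
      tables := fun u q hq => by simp [h0 u q hq, table]
      saved := by simp }
  · rintro m s1 ⟨hm, hI⟩ hb
    rw [Test.Holds, hI.count] at hb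
    obtain h : s1.reg 3 = es.length := by omega
    rwa [h] at hI

end WordRAM

/-! ### Reconstruction of an optimal run -/

namespace TreeAutomaton

variable {V : Type*} [DecidableEq V]

theorem Runs.lt {𝒜 : TreeAutomaton} {es : List (V × V)} {σ : V → ℕ} {r : V} {q : ℕ}
    (h : 𝒜.Runs es σ r q) (hσ : ∀ v, σ v < 𝒜.N) : q < 𝒜.N := by
  induction es generalizing σ with
  | nil => rw [← h]; exact hσ r
  | cons e es ih =>
    obtain ⟨x, hx, h⟩ := h
    refine ih h fun v => ?_
    rw [Function.update_apply]
    split_ifs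
    · exact (𝒜.trans_lt _ hx).2.2
    · exact hσ v

end TreeAutomaton

namespace WordRAM

open TreeAutomaton

variable {W : ℕ} {Q : State → Prop} {s : State} {n : ℕ} (𝒜 : TreeAutomaton)

/-- Considering a final state of the root. -/
def tryRoot (q : ℕ) : Program :=
  if 𝒜.acc q then .seq (ld 9 (7 + q) 12) (.ite (.lt 9 13) (.seq (.op (.copy 13 9))
    (.op (.const 14 q))) .skip) else .skip

/-- Choosing the final state of the root. -/
def chooseRoot : Program :=
  .seq (.op (.copy 13 2)) (.seq (.op (.const 14 0))
    (.seq (forList (tryRoot 𝒜) (List.range 𝒜.N)) (st 6 12 14)))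

theorem wp_chooseRoot (hW : (arrays 𝒜 + 2) * (n + 1) ^ 2 ≤ W) (hL : Layout n (arrays 𝒜) s)
    {r : Fin n} (h12 : s.reg 12 = r) {a : ℕ → ℕ}
    (ha : ∀ q < 𝒜.N, s.mem ((7 + q) * n + r) = a q ∧ a q ≤ n + 1)
    (hex : ∃ q < 𝒜.N, 𝒜.acc q = true ∧ a q ≤ n)
    (hQ : ∀ s', Layout n (arrays 𝒜) s' → s'.reg 7 = s.reg 7 → s'.reg 12 = s.reg 12 →
      (∀ i (u : Fin n), i ≠ 6 → s'.mem (i * n + u) = s.mem (i * n + u)) →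
      (∃ q < 𝒜.N, 𝒜.acc q = true ∧ a q ≤ n ∧ (∀ q' < 𝒜.N, 𝒜.acc q' = true → a q ≤ a q') ∧
        s'.mem (6 * n + r) = q) → Q s') :
    wp W (chooseRoot 𝒜) Q s := by
  obtain ⟨hWK, hW1, hW2, hW3, -⟩ := le_of_bound hW
  have hn := r.pos
  have hNW : 𝒜.N ≤ W := by
    have : arrays 𝒜 * 1 ≤ arrays 𝒜 * n := Nat.mul_le_mul_left _ hn
    simp only [arrays] at this hWK
    omega
  rw [chooseRoot, wp_seq, wp_copy, hL.inf]
  refine ⟨hW1, ?_⟩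
  rw [wp_seq, wp_const]
  refine ⟨by omega, ?_⟩
  rw [wp_seq]
  -- Register `13` holds the running minimum and `14` a state attaining it. The latter is meaningful
  -- only once the minimum has dropped below the infinite value `n + 1`.
  refine wp_forList (fun pre s' => Layout n (arrays 𝒜) s' ∧ s'.mem = s.mem ∧
    s'.reg 7 = s.reg 7 ∧ s'.reg 12 = r ∧ s'.reg 14 ≤ 𝒜.N ∧ s'.reg 13 ≤ n + 1 ∧
    (∀ q ∈ pre, 𝒜.acc q = true → s'.reg 13 ≤ a q) ∧
    (s'.reg 13 ≤ n → s'.reg 14 < 𝒜.N ∧ 𝒜.acc (s'.reg 14) = true ∧ a (s'.reg 14) = s'.reg 13))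
    ⟨(hL.set (by norm_num) (by norm_num) _).set (by norm_num) (by norm_num) _, by simp, by simp,
      by simp [h12], by simp, by simp, by simp, by simp⟩ ?_ ?_
  · rintro pre q s1 hq ⟨hL1, hm1, h7, h12, h14, h13, hle, hat⟩
    rw [List.mem_range] at hq
    have hv : s1.mem ((7 + q) * n + r) = a q := by rw [hm1, (ha q hq).1]
    rw [tryRoot]
    split_ifs with hacc
    · refine wp_ld hL1 (by simp only [arrays]; omega) hWK h12
        (by rw [hv]; exact (ha q hq).2.trans hW1) ?_
      rw [hv, wp_ite_lt]
      have hL2 := (hL1.set (d := 8) (by norm_num) (by norm_num) ((7 + q) * n + r)).set (d := 9)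
        (by norm_num) (by norm_num) (a q)
      have haq := (ha q hq).2
      generalize hs2 : ((s1.set 8 ((7 + q) * n + r)).set 9 (a q)) = s2 at hL2 ⊢
      have hm2 : s2.mem = s.mem := by simp [← hs2, hm1]
      have r7 : s2.reg 7 = s.reg 7 := by simp [← hs2, h7]
      have r9 : s2.reg 9 = a q := by simp [← hs2]
      have r12 : s2.reg 12 = r := by simp [← hs2, h12]
      have r13 : s2.reg 13 = s1.reg 13 := by simp [← hs2]
      have r14 : s2.reg 14 = s1.reg 14 := by simp [← hs2]
      rw [r9, r13]
      constructor
      · intro hlt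
        rw [wp_seq, wp_copy, wp_const, r9]
        refine ⟨by omega, by omega, (hL2.set (by norm_num) (by norm_num) _).set (by norm_num)
          (by norm_num) _, by simp [hm2], by simp [r7], by simp [r12], by simp; omega,
          by simp; omega, fun q' hq' hacc' => ?_, fun _ => by simp [hacc, hq]⟩
        rcases List.mem_append.1 hq' with h | h
        · have := hle q' h hacc'
          simp
          omega
        · rw [List.mem_singleton] at h
          simp [h]
      · intro hlt
        refine ⟨hL2, hm2, r7, r12, by omega, by omega, fun q' hq' hacc' => ?_,
          by rw [r13, r14]; exact hat⟩
        rcases List.mem_append.1 hq' with h | h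
        · rw [r13]
          exact hle q' h hacc'
        · rw [List.mem_singleton] at h
          rw [r13, h]
          omega
    · refine ⟨hL1, hm1, h7, h12, h14, h13, fun q' hq' hacc' => ?_, hat⟩
      rcases List.mem_append.1 hq' with h | h
      · exact hle q' h hacc'
      · rw [List.mem_singleton] at h
        exact absurd (h ▸ hacc') hacc
  · rintro s1 ⟨hL1, hm1, h7, h12', h14, h13, hle, hat⟩
    obtain ⟨q, hq, hacc, haq⟩ := hex
    have hlow := hle q (List.mem_range.2 hq) hacc
    obtain ⟨e1, e2, e3⟩ := hat (by omega)
    refine wp_st' hL1 (by simp only [arrays]; omega) hWK h12' (by norm_num) (by omega) ?_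
    intro s2 hL2 hr2 hm2
    refine hQ s2 hL2 (by rw [hr2 7 (by norm_num), h7]) (by rw [hr2 12 (by norm_num), h12', h12])
      (fun i u hi => by rw [hm2, if_neg (fun h => hi h.1), hm1])
      ⟨s1.reg 14, e1, e2, by omega, fun q' hq' hacc' => ?_, by rw [hm2]; simp⟩
    rw [e3]
    exact hle q' (List.mem_range.2 hq') hacc'

/-- Considering a transition for the reconstruction. -/
def tryTransition (t : ℕ × ℕ × ℕ) : Program :=
  .seq (.op (.const 16 t.2.2)) (.ite (.eq 16 11) (.seq (ld 9 (7 + 𝒜.N + t.1) 4)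
    (.seq (ld 10 (7 + t.2.1) 4) (.seq (.op (.add 9 9 10)) (.ite (.lt 9 13)
      (.seq (.op (.copy 13 9)) (.seq (.op (.const 14 t.1)) (.op (.const 17 t.2.1)))) .skip))))
    .skip)

/-- Reconstructing the absorption of a leaf. -/
def restoreNext : Program :=
  .seq (.op (.sub 7 7 1)) (.seq (ld 4 4 7) (.seq (ld 6 5 7) (.seq (ld 11 6 6)
    (.seq (.op (.copy 13 2)) (.seq (forList (tryTransition 𝒜) 𝒜.trans)
      (.seq (st 6 6 14) (st 6 4 17)))))))

/-- The minimisation is repeated for the known state of the parent, now remembering a transition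
that attains it. As the minimum is at most `n`, it comes from an actual transition and not from the
cutoff. -/
theorem wp_tryTransition (hW : (arrays 𝒜 + 2) * (n + 1) ^ 2 ≤ W) (hL : Layout n (arrays 𝒜) s)
    {c : Fin n} (h4 : s.reg 4 = c) (h13 : s.reg 13 = n + 1) {a b : ℕ → ℕ}
    (ha : ∀ q < 𝒜.N, s.mem ((7 + 𝒜.N + q) * n + c) = a q ∧ a q ≤ n + 1)
    (hb : ∀ q < 𝒜.N, s.mem ((7 + q) * n + c) = b q ∧ b q ≤ n + 1)
    (hbest : best 𝒜.trans (n + 1) a b (s.reg 11) ≤ n)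
    (hQ : ∀ s', Layout n (arrays 𝒜) s' → s'.mem = s.mem → s'.reg 4 = s.reg 4 →
      s'.reg 6 = s.reg 6 → s'.reg 7 = s.reg 7 → s'.reg 12 = s.reg 12 → s'.reg 15 = s.reg 15 →
      (s'.reg 14, s'.reg 17, s.reg 11) ∈ 𝒜.trans →
      best 𝒜.trans (n + 1) a b (s.reg 11) = a (s'.reg 14) + b (s'.reg 17) → Q s') :
    wp W (forList (tryTransition 𝒜) 𝒜.trans) Q s := by
  obtain ⟨hWK, hW1, hW2, hW3, -⟩ := le_of_bound hW
  have hn := c.pos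
  have hNW : 𝒜.N ≤ W := by
    have : arrays 𝒜 * 1 ≤ arrays 𝒜 * n := Nat.mul_le_mul_left _ hn
    simp only [arrays] at this hWK
    omega
  refine wp_forList (fun pre s' => Layout n (arrays 𝒜) s' ∧ s'.mem = s.mem ∧
    (∀ r, r ≠ 8 → r ≠ 9 → r ≠ 10 → r ≠ 13 → r ≠ 14 → r ≠ 16 → r ≠ 17 → s'.reg r = s.reg r) ∧
    s'.reg 13 = best pre (n + 1) a b (s.reg 11) ∧
    (s'.reg 13 ≤ n → (s'.reg 14, s'.reg 17, s.reg 11) ∈ 𝒜.trans ∧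
      s'.reg 13 = a (s'.reg 14) + b (s'.reg 17)))
    ⟨hL, rfl, by simp, by simp [best, h13], by omega⟩ ?_ ?_
  · rintro pre ⟨x, y, z⟩ s1 ht ⟨hL1, hm1, hr1, h13, hat⟩
    obtain ⟨hx, hy, hz⟩ := 𝒜.trans_lt _ ht
    simp only at hx hy hz
    have r4 : s1.reg 4 = c := by simp [hr1, h4]
    have r11 : s1.reg 11 = s.reg 11 := by simp [hr1]
    have hax := ha x hx
    have hby := hb y hy
    simp only [tryTransition]
    rw [wp_seq, wp_const]
    refine ⟨by omega, ?_⟩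
    rw [wp_ite_eq]
    have hL2 := hL1.set (d := 16) (by norm_num) (by norm_num) z
    simp only [State.set_reg, if_true]
    norm_num only [if_false, r11]
    rw [best_append_singleton]
    constructor
    · intro hz11
      subst hz11
      have m1 : s1.mem ((7 + 𝒜.N + x) * n + c) = a x := by rw [hm1, hax.1]
      have m2 : s1.mem ((7 + y) * n + c) = b y := by rw [hm1, hby.1]
      rw [wp_seq]
      refine wp_ld hL2 (by simp only [arrays]; omega) hWK (x := c) (by simp [r4])
        (by simp; omega) ?_
      have hL3 := (hL2.set (d := 8) (by norm_num) (by norm_num) ((7 + 𝒜.N + x) * n + c)).set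
        (d := 9) (by norm_num) (by norm_num) (a x)
      simp only [State.set_mem]
      rw [m1, wp_seq]
      refine wp_ld hL3 (by simp only [arrays]; omega) hWK (x := c) (by simp [r4])
        (by simp; omega) ?_
      have hL4 := (hL3.set (d := 8) (by norm_num) (by norm_num) ((7 + y) * n + c)).set
        (d := 10) (by norm_num) (by norm_num) (b y)
      simp only [State.set_mem]
      rw [m2, wp_seq, wp_add]
      generalize hs4 : (((((s1.set 16 (s.reg 11)).set 8 ((7 + 𝒜.N + x) * n + c)).set 9 (a x)).set 8
        ((7 + y) * n + c)).set 10 (b y)) = s4 at hL4 ⊢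
      have hm4 : s4.mem = s.mem := by simp [← hs4, hm1]
      have r9 : s4.reg 9 = a x := by simp [← hs4]
      have r10 : s4.reg 10 = b y := by simp [← hs4]
      have r13 : s4.reg 13 = s1.reg 13 := by simp [← hs4]
      have r14 : s4.reg 14 = s1.reg 14 := by simp [← hs4]
      have r17 : s4.reg 17 = s1.reg 17 := by simp [← hs4]
      have hr4 : ∀ r, r ≠ 8 → r ≠ 9 → r ≠ 10 → r ≠ 13 → r ≠ 14 → r ≠ 16 → r ≠ 17 →
          s4.reg r = s.reg r := fun r h8 h9 h10 h13 h14 h16 h17 => by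
        simp [← hs4, h8, h9, h10, h16, hr1 r h8 h9 h10 h13 h14 h16 h17]
      rw [r9, r10]
      refine ⟨by omega, ?_⟩
      have hL5 := hL4.set (d := 9) (by norm_num) (by norm_num) (a x + b y)
      rw [wp_ite_lt]
      simp only [State.set_reg, if_true]
      norm_num only [if_false, r13, h13, true_and]
      constructor
      · intro hlt
        rw [wp_seq, wp_copy, wp_seq, wp_const, wp_const]
        rw [if_pos hlt]
        refine ⟨by simp; omega, by omega, by omega,
          ((hL5.set (by norm_num) (by norm_num) _).set (by norm_num) (by norm_num) _).set
            (by norm_num) (by norm_num) _, by simp [hm4], ?_, by simp, fun _ => by simp [ht]⟩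
        intro r h8 h9 h10 h13 h14 h16 h17
        simp [h9, h13, h14, h17, hr4 r h8 h9 h10 h13 h14 h16 h17]
      · intro hlt
        rw [if_neg hlt]
        refine ⟨hL5, by simp [hm4], ?_, by simp [r13, h13], by simpa [r13, r14, r17] using hat⟩
        intro r h8 h9 h10 h13 h14 h16 h17
        simp [h9, hr4 r h8 h9 h10 h13 h14 h16 h17]
    · intro hz11
      rw [if_neg (fun h => hz11 h.1)]
      refine ⟨hL2, by simp [hm1], ?_, by simp [h13], by simpa using hat⟩
      intro r h8 h9 h10 h13 h14 h16 h17
      simp [h16, hr1 r h8 h9 h10 h13 h14 h16 h17]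
  · rintro s1 ⟨hL1, hm1, hr1, h13, hat⟩
    obtain ⟨e1, e2⟩ := hat (by omega)
    exact hQ s1 hL1 hm1 (by simp [hr1]) (by simp [hr1]) (by simp [hr1]) (by simp [hr1])
      (by simp [hr1]) e1 (by omega)

end WordRAM

namespace WordRAM

open TreeAutomaton

variable {W : ℕ} {Q : State → Prop} {s : State} {n : ℕ} (𝒜 : TreeAutomaton)

/-- The state of the reconstruction when the first `i` leaves remain to be restored. -/
structure RestoreInv (es : List (Fin n × Fin n)) (r : Fin n) (q opt i : ℕ) (s : State) :
    Prop where
  layout : Layout n (arrays 𝒜) s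
  recorded : Recorded es r s
  zero : s.reg 15 = 0
  count : s.reg 7 = i
  le : i ≤ es.length
  saved : ∀ j < es.length, ∀ e, es[j]? = some e → ∀ q < 𝒜.N,
    s.mem ((7 + 𝒜.N + q) * n + e.1) =
        𝒜.table (n + 1) (fun _ => startCost 𝒜 n) (es.take j) e.2 q ∧
      s.mem ((7 + q) * n + e.1) =
        𝒜.table (n + 1) (fun _ => startCost 𝒜 n) (es.take j) e.1 q
  runs : 𝒜.Runs (es.drop i) (fun u => s.mem (6 * n + u)) r q
  cost : runCost (𝒜.table (n + 1) (fun _ => startCost 𝒜 n) (es.take i)) (es.drop i) r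
    (fun u => s.mem (6 * n + u)) = opt
  lt : ∀ v ∈ elimVerts (es.drop i) r, s.mem (6 * n + v) < 𝒜.N

theorem wp_restoreNext (hW : (arrays 𝒜 + 2) * (n + 1) ^ 2 ≤ W) {es : List (Fin n × Fin n)}
    {r : Fin n} {q opt i : ℕ} (hopt : opt ≤ n) (hlen : es.length < n)
    (h : RestoreInv 𝒜 es r q opt (i + 1) s) :
    wp W (restoreNext 𝒜) (RestoreInv 𝒜 es r q opt i) s := by
  obtain ⟨hWK, hW1, hW2, hW3, -⟩ := le_of_bound hW
  have hn := r.pos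
  have hNW : 𝒜.N ≤ W := by
    have : arrays 𝒜 * 1 ≤ arrays 𝒜 * n := Nat.mul_le_mul_left _ hn
    simp only [arrays] at this hWK
    omega
  have hi : i < es.length := h.le
  obtain ⟨k, hk⟩ : ∃ k : Fin n, (k : ℕ) = i := ⟨⟨i, by omega⟩, rfl⟩
  obtain ⟨e, he⟩ : ∃ e, es[i]? = some e := ⟨_, List.getElem?_eq_getElem hi⟩
  have hemem : e ∈ es := List.mem_of_getElem? he
  have hcp := h.recorded.elim.fst_ne_snd e hemem
  obtain ⟨hrec4, hrec5⟩ := h.recorded.record k e (by rw [hk, he])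
  have l1 := e.1.isLt
  have l2 := e.2.isLt
  have htake : es.take (i + 1) = es.take i ++ [e] := by
    rw [List.take_add_one, he]; rfl
  have hdrop : es.drop i = e :: es.drop (i + 1) := by
    rw [List.drop_eq_getElem_cons hi]
    rw [List.getElem?_eq_some_iff] at he
    rw [he.2]
  have helim : IsElimination (e :: es.drop (i + 1)) r := hdrop ▸ h.recorded.elim.drop i
  have h7 := h.count
  set D := 𝒜.table (n + 1) (fun _ => startCost 𝒜 n) (es.take i) with hD
  have hDle : ∀ u q, D u q ≤ n + 1 := startTable_le 𝒜 _
  have hcost := h.cost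
  rw [htake, table_append_singleton, ← hD] at hcost
  -- The value of `best` is one summand of the cost of the current run, which is `opt ≤ n`.
  have hbest : best 𝒜.trans (n + 1) (D e.2) (D e.1) (s.mem (6 * n + e.2)) ≤ n := by
    rw [𝒜.runCost_absorb (n + 1) D helim _ _ fun _ _ => rfl] at hcost
    omega
  have hp := h.lt e.2 helim.snd_mem_elimVerts
  rw [restoreNext, wp_seq, wp_sub, h7, h.layout.one, Nat.add_sub_cancel]
  refine ⟨by omega, ?_⟩
  have hL1 := h.layout.set (d := 7) (by norm_num) (by norm_num) i
  refine wp_ld hL1 (by simp only [arrays]; omega) hWK (x := k) (by simp [hk]) (by simp; omega) ?_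
  simp only [State.set_mem]
  rw [hrec4, wp_seq]
  have hL2 := (hL1.set (d := 8) (by norm_num) (by norm_num) (4 * n + k)).set (d := 4)
      (by norm_num) (by norm_num) e.1
  refine wp_ld hL2 (by simp only [arrays]; omega) hWK (x := k) (by simp [hk]) (by simp; omega) ?_
  simp only [State.set_mem]
  rw [hrec5, wp_seq]
  have hL3 := (hL2.set (d := 8) (by norm_num) (by norm_num) (5 * n + k)).set (d := 6)
      (by norm_num) (by norm_num) e.2
  refine wp_ld hL3 (by simp only [arrays]; omega) hWK (x := e.2) (by simp) (by simp; omega) ?_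
  simp only [State.set_mem]
  have hL4 := (hL3.set (d := 8) (by norm_num) (by norm_num) (6 * n + e.2)).set (d := 11)
      (by norm_num) (by norm_num) (s.mem (6 * n + e.2))
  rw [wp_seq, wp_copy, hL4.inf]
  refine ⟨hW1, ?_⟩
  have hL5 := hL4.set (d := 13) (by norm_num) (by norm_num) (n + 1)
  rw [wp_seq]
  generalize hs5 : (((((((((s.set 7 i).set 8 (4 * n + k)).set 4 e.1).set 8 (5 * n + k)).set 6
    e.2).set 8 (6 * n + e.2)).set 11 (s.mem (6 * n + e.2))).set 13 (n + 1))) = s5 at hL5 ⊢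
  have hm5 : s5.mem = s.mem := by simp [← hs5]
  have r4 : s5.reg 4 = e.1 := by simp [← hs5]
  have r6 : s5.reg 6 = e.2 := by simp [← hs5]
  have r7 : s5.reg 7 = i := by simp [← hs5]
  have r11 : s5.reg 11 = s.mem (6 * n + e.2) := by simp [← hs5]
  have r12 : s5.reg 12 = r := by simp [← hs5, h.recorded.root]
  have r13 : s5.reg 13 = n + 1 := by simp [← hs5]
  have r15 : s5.reg 15 = 0 := by simp [← hs5, h.zero]
  refine wp_tryTransition 𝒜 hW hL5 r4 r13 (a := D e.2) (b := D e.1)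
    (fun q hq => ⟨by rw [hm5]; exact (h.saved i hi e he q hq).1, hDle _ _⟩)
    (fun q hq => ⟨by rw [hm5]; exact (h.saved i hi e he q hq).2, hDle _ _⟩)
    (by rw [r11]; exact hbest) ?_
  intro s6 hL6 hm6 t4 t6 t7 t12 t15 htr hb
  rw [r11] at htr hb
  obtain ⟨hx, hy, -⟩ := 𝒜.trans_lt _ htr
  simp only at hx hy
  rw [wp_seq]
  refine wp_st' hL6 (by simp only [arrays]; omega) hWK (x := e.2) (by rw [t6, r6]) (by norm_num)
    (by omega) ?_
  intro s7 hL7 hr7 hm7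
  refine wp_st' hL7 (by simp only [arrays]; omega) hWK (x := e.1)
    (by rw [hr7 4 (by norm_num), t4, r4]) (by norm_num)
    (by rw [hr7 17 (by norm_num)]; omega) ?_
  intro s8 hL8 hr8 hm8
  have hm8 : ∀ j (u : Fin n), s8.mem (j * n + u) = if j = 6 ∧ u = e.1 then s6.reg 17 else
      if j = 6 ∧ u = e.2 then s6.reg 14 else s.mem (j * n + u) := fun j u => by
    rw [hm8, hm7, hr7 17 (by norm_num), hm6, hm5]
  have hframe : ∀ j, j ≠ 6 → ∀ u : Fin n, s8.mem (j * n + u) = s.mem (j * n + u) :=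
    fun j hj u => by rw [hm8, if_neg (fun h => hj h.1), if_neg (fun h => hj h.1)]
  -- The two writes turn the parent's state after the absorption into its state before it, and give
  -- the child its state; this is the assignment that `Runs.unabsorb` expects.
  have hτ : (fun u : Fin n => s8.mem (6 * n + u)) =
      Function.update (Function.update (fun u : Fin n => s.mem (6 * n + u)) e.2 (s6.reg 14)) e.1
        (s6.reg 17) := by
    funext u
    simp [hm8, Function.update_apply]
  obtain ⟨hruns, hcost'⟩ := h.runs.unabsorb (n + 1) D helim htr hb hτ
  exact
  { layout := hL8
    recorded :=
    { elim := h.recorded.elim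
      root := by rw [hr8 12 (by norm_num), hr7 12 (by norm_num), t12, r12]
      record := fun j f hf => by
        rw [hframe 4 (by norm_num), hframe 5 (by norm_num)]
        exact h.recorded.record j f hf }
    zero := by rw [hr8 15 (by norm_num), hr7 15 (by norm_num), t15, r15]
    count := by rw [hr8 7 (by norm_num), hr7 7 (by norm_num), t7, r7]
    le := hi.le
    saved := fun j hj f hf q hq => by
      rw [hframe _ (by omega), hframe _ (by omega)]
      exact h.saved j hj f hf q hq
    runs := hdrop ▸ hruns
    cost := by rw [hdrop, hcost', hcost]
    lt := fun v hv => by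
      rw [hdrop, elimVerts_cons, Finset.mem_insert] at hv
      rw [hm8]
      split_ifs with h1 h2
      · exact hy
      · exact hx
      · exact h.lt v (hv.resolve_left fun h => h1 ⟨rfl, h⟩) }

/-- Reconstructing all absorptions. -/
def restoreAll : Program := .seq (.op (.const 15 0)) (.loop (.lt 15 7) (restoreNext 𝒜))

theorem ends_restoreAll (hW : (arrays 𝒜 + 2) * (n + 1) ^ 2 ≤ W) {es : List (Fin n × Fin n)}
    {r : Fin n} {q opt : ℕ} (hopt : opt ≤ n) (hlen : es.length < n)
    (h : RestoreInv 𝒜 es r q opt es.length (s.set 15 0)) :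
    Ends W (restoreAll 𝒜) s (1 + (1 + es.length * (1 + (restoreNext 𝒜).cost)))
      (RestoreInv 𝒜 es r q opt 0) := by
  refine Ends.const_seq (by omega) ?_
  refine Ends.loop (fun m s => RestoreInv 𝒜 es r q opt m s) ?_ h ?_
  · intro m s1 hI hb
    rw [Test.Holds, hI.zero, hI.count] at hb
    obtain ⟨m, rfl⟩ := Nat.exists_eq_add_of_lt hb
    rw [Nat.zero_add] at hI
    exact ⟨m, by omega, wp_restoreNext 𝒜 hW hopt hlen hI⟩
  · intro m s1 hI hb
    rw [Test.Holds, hI.zero, hI.count] at hb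
    obtain rfl : m = 0 := by omega
    exact hI

/-! ### Output -/

/-- Looking up the label of the state in register `11`. -/
def lookup (q : ℕ) : Program :=
  .seq (.op (.const 16 q)) (.ite (.eq 16 11) (.op (.const 9 (𝒜.lab q))) .skip)

/-- Writing the output for the vertex in register `3`. -/
def writeLabel : Program :=
  .seq (ld 11 6 3) (.seq (forList (lookup 𝒜) (List.range 𝒜.N))
    (.seq (st 0 3 9) (.op (.add 3 3 1))))

/-- Writing the output. -/
def writeLabels : Program :=
  .seq (.op (.const 9 0)) (.seq (.op (.const 3 0)) (.loop (.lt 3 0) (writeLabel 𝒜)))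

/-- The label of a state is a fixed finite function, so comparing the state with every constant
below `𝒜.N` evaluates it in constant time. -/
theorem wp_lookup (hW : (arrays 𝒜 + 2) * (n + 1) ^ 2 ≤ W) (hL : Layout n (arrays 𝒜) s)
    (hNW : 𝒜.N ≤ W) (h11 : s.reg 11 < 𝒜.N)
    (hQ : ∀ s', Layout n (arrays 𝒜) s' → s'.mem = s.mem → s'.reg 3 = s.reg 3 →
      s'.reg 9 = 𝒜.lab (s.reg 11) → Q s') :
    wp W (forList (lookup 𝒜) (List.range 𝒜.N)) Q s := by
  obtain ⟨hWK, hW1, hW2, hW3, hW4⟩ := le_of_bound hW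
  refine wp_forList (fun pre s' => Layout n (arrays 𝒜) s' ∧ s'.mem = s.mem ∧
    s'.reg 3 = s.reg 3 ∧ s'.reg 11 = s.reg 11 ∧
    (s.reg 11 ∈ pre → s'.reg 9 = 𝒜.lab (s.reg 11)))
    ⟨hL, rfl, rfl, rfl, by simp⟩ ?_ ?_
  · rintro pre q s1 hq ⟨hL1, hm1, h3, h11', h9⟩
    rw [List.mem_range] at hq
    have := 𝒜.lab_le q
    rw [lookup, wp_seq, wp_const]
    refine ⟨by omega, ?_⟩
    rw [wp_ite_eq]
    have hL2 := hL1.set (d := 16) (by norm_num) (by norm_num) q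
    simp only [State.set_reg, if_true]
    norm_num only [if_false, h11']
    constructor
    · intro hq'
      rw [wp_const]
      refine ⟨by omega, hL2.set (by norm_num) (by norm_num) _, by simp [hm1], by simp [h3],
        by simp [h11'], by simp [hq']⟩
    · intro hq'
      refine ⟨hL2, by simp [hm1], by simp [h3], by simp [h11'], fun hmem => ?_⟩
      rcases List.mem_append.1 hmem with h | h
      · simpa using h9 h
      · rw [List.mem_singleton] at h
        exact absurd h.symm hq'
  · rintro s1 ⟨hL1, hm1, h3, h11', h9⟩
    exact hQ s1 hL1 hm1 h3 (h9 (List.mem_range.2 h11))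

theorem ends_writeLabels (hW : (arrays 𝒜 + 2) * (n + 1) ^ 2 ≤ W) (hL : Layout n (arrays 𝒜) s)
    {σ : Fin n → ℕ} (hσ : ∀ u : Fin n, s.mem (6 * n + u) = σ u) (hlt : ∀ u, σ u < 𝒜.N) :
    Ends W (writeLabels 𝒜) s (1 + (1 + (1 + n * (1 + (writeLabel 𝒜).cost))))
      fun s' => ∀ u : Fin n, s'.mem u = 𝒜.lab (σ u) := by
  obtain ⟨hWK, hW1, hW2, hW3, hW4⟩ := le_of_bound hW
  refine Ends.const_seq (by omega) (Ends.const_seq (by omega) ?_)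
  -- The output is array `0`. It overwrites the input, which is no longer needed, and leaves the
  -- states in array `6` untouched.
  refine Ends.loop (fun m s' => s'.reg 3 + m = n ∧ Layout n (arrays 𝒜) s' ∧
    (∀ u : Fin n, s'.mem (6 * n + u) = σ u) ∧
    (∀ u : Fin n, (u : ℕ) < s'.reg 3 → s'.mem (0 * n + u) = 𝒜.lab (σ u)))
    ?_ ⟨by simp, (hL.set (by norm_num) (by norm_num) _).set (by norm_num) (by norm_num) _,
      by simpa using hσ, by simp⟩ ?_
  · rintro m s1 ⟨hm, hL1, hσ1, hout⟩ hb
    rw [Test.Holds, hL1.size] at hb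
    refine ⟨m - 1, by omega, ?_⟩
    obtain ⟨x, hx⟩ : ∃ x : Fin n, s1.reg 3 = x := ⟨⟨s1.reg 3, hb⟩, rfl⟩
    have hNW : 𝒜.N ≤ W := by
      have : arrays 𝒜 * 1 ≤ arrays 𝒜 * n := Nat.mul_le_mul_left _ (by omega)
      simp only [arrays] at this hWK
      omega
    have hlx := hlt x
    have hlab := 𝒜.lab_le (σ x)
    refine wp_ld hL1 (by simp only [arrays]; omega) hWK hx (by rw [hσ1]; omega) ?_
    rw [hσ1, wp_seq]
    refine wp_lookup 𝒜 hW ((hL1.set (by norm_num) (by norm_num) _).set (by norm_num)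
      (by norm_num) _) hNW (by simpa using hlx) ?_
    intro s2 hL2 hm2 h3 h9
    simp only [State.set_reg, if_true, State.set_mem] at h3 h9 hm2
    norm_num only [if_false] at h3
    rw [wp_seq]
    refine wp_st' hL2 (by simp only [arrays]; omega) hWK (x := x) (by rw [h3, hx]) (by norm_num)
      (by omega) ?_
    intro s3 hL3 hr3 hm3
    have r3 : s3.reg 3 = x := by rw [hr3 3 (by norm_num), h3, hx]
    rw [wp_add, r3, hL3.one]
    refine ⟨by omega, by simp; omega, hL3.set (by norm_num) (by norm_num) _, fun u => ?_,
      fun u hu => ?_⟩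
    · rw [State.set_mem, hm3, if_neg (by omega), hm2, hσ1]
    · rw [State.set_reg, if_pos rfl] at hu
      rw [State.set_mem, hm3]
      split_ifs with h
      · rw [h9, h.2]
      · have hne : (u : ℕ) ≠ x := fun h' => h ⟨rfl, Fin.ext h'⟩
        rw [hm2]
        exact hout u (by omega)
  · rintro m s1 ⟨hm, hL1, hσ1, hout⟩ hb u
    rw [Test.Holds, hL1.size] at hb
    have := hout u (by omega)
    rwa [Nat.zero_mul, Nat.zero_add] at this

/-! ### The complete program -/

/-- Finding an optimal run when the elimination order is known. -/
def solve : Program :=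
  .seq (initTables 𝒜) (.seq (absorbAll 𝒜) (.seq (chooseRoot 𝒜)
    (.seq (restoreAll 𝒜) (writeLabels 𝒜))))

/-- A bound for the running time of `solve`. -/
def solveTime (n : ℕ) : ℕ :=
  (1 + (1 + n * (1 + ((initTable 𝒜).cost + 1)))) +
    ((1 + (1 + n * (1 + (absorbNext 𝒜).cost))) + ((chooseRoot 𝒜).cost +
      ((1 + (1 + n * (1 + (restoreNext 𝒜).cost))) +
        (1 + (1 + (1 + n * (1 + (writeLabel 𝒜).cost)))))))

theorem Ends.mono {p : Program} {T T' : ℕ} {R : State → Prop} (h : Ends W p s T R)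
    (hT : T ≤ T') (hQ : ∀ s, R s → Q s) : Ends W p s T' Q := by
  obtain ⟨t, s', hr, ht, h⟩ := h
  exact ⟨t, s', hr, ht.trans hT, hQ _ h⟩

theorem ends_solve (hW : (arrays 𝒜 + 2) * (n + 1) ^ 2 ≤ W) {es : List (Fin n × Fin n)}
    {r : Fin n} (hlen : es.length < n) (hL : Layout n (arrays 𝒜) s) (hR : Recorded es r s)
    (h7 : s.reg 7 = es.length) (huniv : elimVerts es r = Finset.univ)
    (hex : ∃ (σ : Fin n → ℕ) (q : ℕ), (∀ v, σ v < 𝒜.N) ∧ (∀ v, 𝒜.ini (σ v) = true) ∧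
      𝒜.acc q = true ∧ 𝒜.Runs es σ r q) :
    Ends W (solve 𝒜) s (solveTime 𝒜 n) fun s' => ∃ (σ : Fin n → ℕ) (q : ℕ),
      (∀ v, σ v < 𝒜.N) ∧ (∀ v, 𝒜.ini (σ v) = true) ∧ 𝒜.acc q = true ∧ 𝒜.Runs es σ r q ∧
      (∀ v : Fin n, s'.mem v = 𝒜.lab (σ v)) ∧
      ∀ (σ' : Fin n → ℕ) (q' : ℕ), (∀ v, σ' v < 𝒜.N) → (∀ v, 𝒜.ini (σ' v) = true) →
        𝒜.acc q' = true → 𝒜.Runs es σ' r q' → ∑ v, 𝒜.lab (σ v) ≤ ∑ v, 𝒜.lab (σ' v) := by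
  have hcost : ∀ σ : Fin n → ℕ, (∀ v, 𝒜.ini (σ v) = true) →
      runCost (fun _ => startCost 𝒜 n) es r σ = ∑ v, 𝒜.lab (σ v) := by
    intro σ hσ
    rw [runCost, huniv]
    exact Finset.sum_congr rfl fun v _ => by rw [startCost, if_pos (hσ v)]
  have hlow : ∀ (σ' : Fin n → ℕ) (q' : ℕ), (∀ v, 𝒜.ini (σ' v) = true) → 𝒜.Runs es σ' r q' →
      𝒜.table (n + 1) (fun _ => startCost 𝒜 n) es r q' ≤ ∑ v, 𝒜.lab (σ' v) := by
    intro σ' q' hini hrun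
    rw [← hcost σ' hini]
    exact 𝒜.table_le_runCost _ _ hR.elim hrun
  refine Ends.seq (ends_initTables 𝒜 hW hL) ?_
  rintro s1 ⟨hL1, e7, e12, hf1, ht1⟩
  have hR1 : Recorded es r s1 := ⟨hR.elim, by rw [e12, hR.root], fun i e he => by
    rw [hf1 _ _ (by norm_num), hf1 _ _ (by norm_num)]; exact hR.record i e he⟩
  refine Ends.seq ((ends_absorbAll 𝒜 hW hlen hL1 hR1 (by rw [e7, h7]) ht1).mono
    (T' := 1 + (1 + n * (1 + (absorbNext 𝒜).cost))) (by gcongr) fun _ h => h) ?_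
  intro s2 hI2
  refine Ends.seq (R := fun s3 => ∃ q < 𝒜.N, 𝒜.acc q = true ∧
    𝒜.table (n + 1) (fun _ => startCost 𝒜 n) es r q ≤ n ∧
    (∀ q' < 𝒜.N, 𝒜.acc q' = true → 𝒜.table (n + 1) (fun _ => startCost 𝒜 n) es r q ≤
      𝒜.table (n + 1) (fun _ => startCost 𝒜 n) es r q') ∧
    RestoreInv 𝒜 es r q (𝒜.table (n + 1) (fun _ => startCost 𝒜 n) es r q) es.length
      (s3.set 15 0)) (Ends.of_wp ?_) ?_
  · refine wp_chooseRoot 𝒜 hW hI2.layout hI2.recorded.root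
      (a := 𝒜.table (n + 1) (fun _ => startCost 𝒜 n) es r)
      (fun q hq => ⟨by rw [hI2.tables r q hq, List.take_length], startTable_le 𝒜 _ _ _⟩) ?_ ?_
    · obtain ⟨σ, q, hσ, hini, hacc, hrun⟩ := hex
      refine ⟨q, hrun.lt hσ, hacc, (hlow σ q hini hrun).trans ?_⟩
      refine (Finset.sum_le_card_nsmul _ _ 1 fun v _ => 𝒜.lab_le _).trans ?_
      simp
    · rintro s3 hL3 f7 f12 hf3 ⟨q, hq, hacc, hqn, hmin, hm⟩
      refine ⟨q, hq, hacc, hqn, hmin, ?_⟩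
      exact
      { layout := hL3.set (by norm_num) (by norm_num) _
        recorded := ⟨hR.elim, by simp [f12, hI2.recorded.root], fun i e he => by
          rw [State.set_mem, hf3 _ _ (by norm_num), hf3 _ _ (by norm_num)]
          exact hI2.recorded.record i e he⟩
        zero := by simp
        count := by simp [f7, hI2.count]
        le := le_rfl
        saved := fun j hj e he q hq => by
          rw [State.set_mem, hf3 _ _ (by omega), hf3 _ _ (by omega)]
          exact hI2.saved j hj e he q hq
        runs := by
          rw [List.drop_length, Runs]
          exact hm
        cost := by
          rw [List.drop_length, List.take_length]
          simp [runCost, elimVerts, hm]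
        lt := fun v hv => by
          rw [List.drop_length] at hv
          obtain rfl : v = r := by simpa [elimVerts] using hv
          rw [State.set_mem, hm]
          exact hq }
  · rintro s3 ⟨q, hq, hacc, hqn, hmin, hI3⟩
    refine Ends.seq ((ends_restoreAll 𝒜 hW hqn hlen hI3).mono
      (T' := 1 + (1 + n * (1 + (restoreNext 𝒜).cost))) (by gcongr) fun _ h => h) ?_
    intro s4 hI4
    set σ : Fin n → ℕ := fun u => s4.mem (6 * n + u) with hσdef
    have hσ : ∀ v, σ v < 𝒜.N := fun v => hI4.lt v (by rw [List.drop_zero, huniv]; simp)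
    have hrun : 𝒜.Runs es σ r q := by simpa using hI4.runs
    have hc : runCost (fun _ => startCost 𝒜 n) es r σ =
        𝒜.table (n + 1) (fun _ => startCost 𝒜 n) es r q := by simpa [table] using hI4.cost
    -- A state that is not initial would alone cost `n + 1`, more than the whole run.
    have hini : ∀ v, 𝒜.ini (σ v) = true := by
      intro v
      by_contra hv
      have h1 : startCost 𝒜 n (σ v) ≤ runCost (fun _ => startCost 𝒜 n) es r σ := by
        rw [runCost, huniv]
        exact Finset.single_le_sum (f := fun v => startCost 𝒜 n (σ v)) (fun _ _ => Nat.zero_le _)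
          (Finset.mem_univ v)
      rw [startCost, if_neg hv] at h1
      omega
    refine (ends_writeLabels 𝒜 hW hI4.layout (σ := σ) (fun _ => rfl) hσ).mono le_rfl ?_
    intro s5 hs5
    refine ⟨σ, q, hσ, hini, hacc, hrun, hs5, fun σ' q' hσ' hini' hacc' hrun' => ?_⟩
    rw [← hcost σ hini, hc]
    exact (hmin q' (hrun'.lt hσ') hacc').trans (hlow σ' q' hini' hrun')

end WordRAM

namespace WordRAM

open TreeAutomaton SimpleGraph

variable (𝒜 : TreeAutomaton)

/-- The program that computes an optimal run on a tree given by its edge list. -/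
def optimize : Program :=
  .seq (setup (arrays 𝒜)) (.seq readEdges (.seq peel (solve 𝒜)))

/-- For `n ≥ 1` the constant factor is absorbed by `K + 2 ≤ 2 ^ (K + 2) ≤ (n + 1) ^ (K + 2)`. -/
theorem bound_le_pow (K n : ℕ) (hn : 0 < n) : (K + 2) * (n + 1) ^ 2 ≤ (n + 1) ^ (K + 4) := by
  rw [show K + 4 = (K + 2) + 2 by ring, pow_add]
  refine Nat.mul_le_mul_right _ ?_
  exact (Nat.lt_two_pow_self).le.trans (Nat.pow_le_pow_left (by omega) _)

/-- If a tree automaton accepts some labelling along every elimination order of a tree, then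
`optimize` finds a labelling of minimum cost in linear time. -/
theorem exists_linear_time_optimize : ∃ C : ℕ, ∀ (n : ℕ) (T : SimpleGraph (Fin n))
    (l : List (Fin n × Fin n)), T.IsTree → IsEdgeList T l →
    (∀ es r, IsEdgeList T es → IsElimination es r →
      ∃ (σ : Fin n → ℕ) (q : ℕ), (∀ v, σ v < 𝒜.N) ∧ (∀ v, 𝒜.ini (σ v) = true) ∧
        𝒜.acc q = true ∧ 𝒜.Runs es σ r q) →
    ∃ t s es r, Run ((n + 1) ^ (arrays 𝒜 + 4)) (optimize 𝒜) (initState (graphInput l)) t s ∧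
      t ≤ C * n ∧ IsEdgeList T es ∧ IsElimination es r ∧ elimVerts es r = Finset.univ ∧
      ∃ (σ : Fin n → ℕ) (q : ℕ),
        (∀ v, σ v < 𝒜.N) ∧ (∀ v, 𝒜.ini (σ v) = true) ∧ 𝒜.acc q = true ∧ 𝒜.Runs es σ r q ∧
        (∀ v : Fin n, s.mem v = 𝒜.lab (σ v)) ∧
        ∀ (σ' : Fin n → ℕ) (q' : ℕ), (∀ v, σ' v < 𝒜.N) → (∀ v, 𝒜.ini (σ' v) = true) →
          𝒜.acc q' = true → 𝒜.Runs es σ' r q' → ∑ v, 𝒜.lab (σ v) ≤ ∑ v, 𝒜.lab (σ' v) := by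
  -- The total running time is affine in `n`. As a tree has `n ≥ 1`, the constant `A + B` gives a
  -- bound linear in `n`.
  obtain ⟨A, B, hAB⟩ : ∃ A B : ℕ, ∀ n,
      (setup (arrays 𝒜)).cost + ((1 + (1 + (1 + n * (1 + readEdge.cost)))) +
        ((1 + (1 + (1 + (1 + (1 + 2 * n * (1 + peelStep.cost)))))) + solveTime 𝒜 n)) =
      A + B * n := by
    refine ⟨(setup (arrays 𝒜)).cost + 3 + 5 + 2 + 2 + (chooseRoot 𝒜).cost + 2 + 3,
      (1 + readEdge.cost) + 2 * (1 + peelStep.cost) + (1 + ((initTable 𝒜).cost + 1)) +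
      (1 + (absorbNext 𝒜).cost) + (1 + (restoreNext 𝒜).cost) + (1 + (writeLabel 𝒜).cost),
      fun n => ?_⟩
    rw [solveTime]
    ring
  refine ⟨A + B, fun n T l hT hl hfeas => ?_⟩
  obtain ⟨v0⟩ := hT.connected.nonempty
  have hn := v0.pos
  have hW := bound_le_pow (arrays 𝒜) n hn
  obtain ⟨hWK, hW1, hW2, hW3, hW4⟩ := le_of_bound hW
  have hlen := length_of_isEdgeList hT hl
  suffices h : Ends ((n + 1) ^ (arrays 𝒜 + 4)) (optimize 𝒜) (initState (graphInput l))
      ((setup (arrays 𝒜)).cost + ((1 + (1 + (1 + n * (1 + readEdge.cost)))) +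
        ((1 + (1 + (1 + (1 + (1 + 2 * n * (1 + peelStep.cost)))))) + solveTime 𝒜 n)))
      fun s => ∃ es r, IsEdgeList T es ∧ IsElimination es r ∧ elimVerts es r = Finset.univ ∧
      ∃ (σ : Fin n → ℕ) (q : ℕ),
        (∀ v, σ v < 𝒜.N) ∧ (∀ v, 𝒜.ini (σ v) = true) ∧ 𝒜.acc q = true ∧ 𝒜.Runs es σ r q ∧
        (∀ v : Fin n, s.mem v = 𝒜.lab (σ v)) ∧
        ∀ (σ' : Fin n → ℕ) (q' : ℕ), (∀ v, σ' v < 𝒜.N) → (∀ v, 𝒜.ini (σ' v) = true) →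
          𝒜.acc q' = true → 𝒜.Runs es σ' r q' → ∑ v, 𝒜.lab (σ v) ≤ ∑ v, 𝒜.lab (σ' v) by
    obtain ⟨t, s, hr, ht, es, r, h⟩ := h
    refine ⟨t, s, es, r, hr, ht.trans ?_, h⟩
    rw [hAB, Nat.add_mul]
    exact Nat.add_le_add_right (Nat.le_mul_of_pos_right A hn) _
  refine Ends.seq (R := fun s => s.mem = (initState (graphInput l)).mem ∧
    Layout n (arrays 𝒜) s ∧ s.reg 4 = l.length) (Ends.of_wp ?_) ?_
  · exact wp_setup (n := n) (m := l.length) (fun _ => rfl) rfl rfl hWK hW1 (by omega)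
      fun s h1 h2 h3 => ⟨h1, h2, h3⟩
  rintro s1 ⟨hm1, hL1, h4⟩
  refine Ends.seq ((ends_readEdges (by simp only [arrays]; omega) hW l hlen hL1 h4 hm1).mono
    (T' := 1 + (1 + (1 + n * (1 + readEdge.cost)))) (by gcongr; omega) fun _ h => h) ?_
  rintro s2 ⟨hL2, hdeg, hsum⟩
  refine Ends.seq (ends_peel (by simp only [arrays]; omega) hW hT hL2
    (fun u => by rw [hdeg, (nbrList_spec hl u).1])
    (fun u => by rw [hsum, (nbrList_spec hl u).2])) ?_
  rintro s3 ⟨hL3, es, r, hes, helim, huniv, h7, h12, hrec⟩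
  have hlt : es.length < n := by
    have := length_of_isEdgeList hT hes
    omega
  exact (ends_solve 𝒜 hW hlt hL3 ⟨helim, h12, hrec⟩ h7 huniv (hfeas es r hes helim)).mono le_rfl
    fun s h => ⟨es, r, hes, helim, huniv, h⟩

end WordRAM

/-! ### The linear-time algorithm for liar's vertex-edge dominating sets -/

theorem mainTheorem1 :
    ∃ (P : WordRAM.Program) (C k : ℕ),
      ∀ (n : ℕ) (T : SimpleGraph (Fin n)) (l : List (Fin n × Fin n)),
        T.IsTree → WordRAM.IsEdgeList T l →
        ∃ (t : ℕ) (s : WordRAM.State) (L : Finset (Fin n)),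
          WordRAM.Run ((n + 1) ^ k) P (WordRAM.initState (WordRAM.graphInput l)) t s ∧
          t ≤ C * n ∧
          WordRAM.OutputsSet s L ∧
          T.IsMinLiarsVEDominating L := by
  obtain ⟨C, hC⟩ := WordRAM.exists_linear_time_optimize LiarsVE.automaton
  refine ⟨WordRAM.optimize LiarsVE.automaton, C, WordRAM.arrays LiarsVE.automaton + 4,
    fun n T l hT hl => ?_⟩
  -- The feasibility required by the general algorithm comes from the set of all vertices, whatever
  -- the elimination order.
  obtain ⟨t, s, es, r, hrun, ht, hes, helim, huniv, σ, q, hσ, hini, hacc, hr, hout, hmin⟩ :=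
    hC n T l hT hl fun es r hes helim => by
      obtain ⟨σ, q, h1, h2, -, h3, h4⟩ := LiarsVE.exists_runs_of_isLiarsVEDominating hT.isAcyclic
        hes.1 hes.2 helim hT.isAcyclic.isLiarsVEDominating_univ
      exact ⟨σ, q, h1, h2, h3, h4⟩
  refine ⟨t, s, Finset.univ.filter fun v => LiarsVE.lab (σ v) = 1, hrun, ht, fun v => ?_,
    LiarsVE.isLiarsVEDominating_of_runs hT.isAcyclic hes.1 hes.2 helim huniv hσ hini hacc hr,
    fun L' hL' => ?_⟩
  · have hv : s.mem v = LiarsVE.lab (σ v) := hout v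
    have := LiarsVE.lab_le (σ v)
    rw [hv]
    simp only [Finset.mem_filter_univ]
    split_ifs <;> omega
  -- Any competing set yields an accepting run along the same elimination order whose total label is
  -- its cardinality, so the optimality of the computed run carries over to sets.
  · obtain ⟨σ', q', h1, h2, hlab, h3, h4⟩ := LiarsVE.exists_runs_of_isLiarsVEDominating
      hT.isAcyclic hes.1 hes.2 helim hL'
    have hle : ∑ v, LiarsVE.lab (σ v) ≤ ∑ v, LiarsVE.lab (σ' v) := hmin σ' q' h1 h2 h3 h4
    have e1 : ∑ v, LiarsVE.lab (σ' v) = L'.card := by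
      simp [hlab]
    have e2 : ∑ v, LiarsVE.lab (σ v) =
        (Finset.univ.filter fun v => LiarsVE.lab (σ v) = 1).card := by
      rw [Finset.card_filter]
      refine Finset.sum_congr rfl fun v _ => ?_
      have := LiarsVE.lab_le (σ v)
      split_ifs <;> omega
    omega
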